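/- **Setting.** Let $I,T,B,P,R$ be natural numbers, $\Gamma\in\mathbb R^{B\times B}$ symmetric positive definite, $\Delta_1,\dots,\Delta_I\in\mathbb R^{P\times P}$ symmetric positive semidefinite, $W\in\mathbb R^{B\times R}$ and $V_1,\dots,V_I\in\mathbb R^{P\times R}$. Let $X_{it}$ ($1\le i\le I$, $1\le t\le T$) be independent random $B\times P$ matrices, $X_{it}\sim\mathcal N(0,\Gamma\otimes\Delta_i)$, i.e. centered Gaussian with $\mathbb E[(X_{it})_{bp}(X_{it})_{b'p'}]=\Gamma_{bb'}(\Delta_i)_{pp'}$, and let $y_{it}=\operatorname{tr}(W^TX_{it}V_i)$. **Algorithm.** Put $$\hat A=\frac1{IT^2}\sum_{i,t,t'}y_{it}y_{it'}X_{it}X_{it'}^T,\qquad \hat\Gamma=\frac1{ITP}\sum_{i,t}X_{it}X_{it}^T,\qquad \hat B=\hat\Gamma^{-1/2}\hat A\,\hat\Gamma^{-1/2},$$ and $\hat W=\hat\Gamma^{-1/2}U$, where the columns of $U\in\mathbb R^{B\times R}$ are orthonormal eigenvectors of $\hat B$ for its $R$ largest eigenvalues (any choice of them). For $B\times R$ matrices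 let $\operatorname{dist}(W_1,W_2)=\|\Pi_{W_1}-\Pi_{W_2}\|_2$, where $\Pi_{W_j}$ is the orthogonal projection onto the column space of $W_j$. Throughout, $\|\cdot\|_2$ is the spectral norm. **Coefficients.** Let $L_i=\|\Gamma\|_2^2\|W\|_2^2\|\Delta_i\|_2^2\|V_i\|_2^2$, $Q=\frac1I\sum_iV_i^T\Delta_i^2V_i$, and let $\lambda$ be the $R$-th largest eigenvalue of $\Gamma WQW^T\Gamma$ (its smallest nonzero eigenvalue if its rank is $R$). Assume $\lambda>0$. Define $$\eta=\frac{\frac1I\sum_iL_i}{\lambda},\quad \alpha=\frac{\frac1I\sum_iL_i^2}{\lambda^2},\quad \mu=\frac{\sqrt{\frac1I\sum_iL_i^4}}{\lambda^2},\quad \nu=\frac{\max_iL_i}{\lambda},$$ $$\psi=\frac{\frac1I\sum_i\|\Delta_i\|_2^2}{\big(\frac1{IP}\sum_i\operatorname{tr}\Delta_i\big)^2},\quad \chi=\frac{\max_i\|\Delta_i\|_2}{\frac1{IP}\sum_i\operatorname{tr}\Delta_i},\quad \kappa_\Gamma=\frac{\|\Gamma\|_2}{\lambda_{\min}(\Gamma)}.$$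 **Theorem.** There are absolute constants $c_1,c_2,c_3,D'>0$ and a function $c:\mathbb R\to(1,\infty)$ such that the following holds for all data as above, with $$k=c(\kappa_\Gamma)^2\Big(c_1\alpha+c_2\mu+c_3\max\{\nu,\nu^2\}+5D'\max\{\kappa_\Gamma\eta\chi,\ \kappa_\Gamma^2\eta^2\psi\}\Big).$$ If $\epsilon>0$, $R<T$ and $$IT\ \ge\ k\,\epsilon^{-2}R^4\max\Big\{\frac{\log(IT)}T,1\Big\}^2\max\Big\{\frac PT,1\Big\}B,$$ then $$\mathbb P\big(\operatorname{dist}(\hat W,W)\ge\epsilon\big)\ \le\ \frac1B+9e^{-B}.$$ -/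

import Mathlib

open Matrix MeasureTheory ProbabilityTheory
open scoped Kronecker

noncomputable section

namespace MultiTask

/-- The spectral norm of a real matrix (operator norm for the Euclidean norms). -/
def specNorm {m n : ℕ} (A : Matrix (Fin m) (Fin n) ℝ) : ℝ :=
  ‖(Matrix.toEuclideanLin A).toContinuousLinearMap‖

/-- The `r`-th largest eigenvalue (with multiplicity, `r = 1, …, n`) of a symmetric matrix. -/
def eig {n : ℕ} (A : Matrix (Fin n) (Fin n) ℝ) (r : ℕ) : ℝ :=
  open scoped Classical in
  if h : A.IsHermitian ∧ 1 ≤ r ∧ r ≤ n then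
    h.1.eigenvalues₀ ⟨r - 1, by rw [Fintype.card_fin]; omega⟩
  else 0

/-- The columns of `U` are orthonormal eigenvectors of `A` for its `R` largest eigenvalues. -/
def IsTopEigenframe {n R : ℕ} (A : Matrix (Fin n) (Fin n) ℝ) (U : Matrix (Fin n) (Fin R) ℝ) :
    Prop :=
  Uᵀ * U = 1 ∧ A * U = U * Matrix.diagonal (fun r : Fin R => eig A (r + 1))

open scoped MatrixOrder in
/-- `A^{-1/2}` for a positive definite matrix `A`. -/
def invSqrt {n : ℕ} (A : Matrix (Fin n) (Fin n) ℝ) : Matrix (Fin n) (Fin n) ℝ :=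
  (CFC.sqrt A)⁻¹

/-- The column space of a matrix, as a subspace of Euclidean space. -/
def colSpace {n R : ℕ} (W : Matrix (Fin n) (Fin R) ℝ) : Submodule ℝ (EuclideanSpace ℝ (Fin n)) :=
  LinearMap.range (Matrix.toEuclideanLin W)

/-- The distance between the column spaces: the operator norm of the difference of the orthogonal
projections onto them (the sine of the largest principal angle, if the dimensions agree). -/
def subspaceDist {n R : ℕ} (W₁ W₂ : Matrix (Fin n) (Fin R) ℝ) : ℝ :=
  ‖(colSpace W₁).starProjection - (colSpace W₂).starProjection‖

/-- The entries of a matrix, as a vector of Euclidean space. -/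
def vecOf {B P : ℕ} (X : Matrix (Fin B) (Fin P) ℝ) : EuclideanSpace ℝ (Fin B × Fin P) :=
  WithLp.toLp 2 (fun bp => X bp.1 bp.2)

/-- The model for the covariates: the matrices `X i t` are independent, and `X i t` is a centered
Gaussian matrix with covariance `Γ ⊗ Δ i`, that is
`E[(X i t) b p * (X i t) b' p'] = Γ b b' * Δ i p p'`. -/
def GaussianModel {I T B P : ℕ} {Ω : Type*} [MeasurableSpace Ω] (Pr : Measure Ω)
    (Γ : Matrix (Fin B) (Fin B) ℝ) (Δ : Fin I → Matrix (Fin P) (Fin P) ℝ)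
    (X : Fin I → Fin T → Ω → Matrix (Fin B) (Fin P) ℝ) : Prop :=
  (∀ i t, HasLaw (fun ω => vecOf (X i t ω)) (multivariateGaussian 0 (Γ ⊗ₖ Δ i)) Pr) ∧
  iIndepFun (fun (it : Fin I × Fin T) ω => vecOf (X it.1 it.2 ω)) Pr

/-! ### The algorithm, applied to a sample `x i t` with responses `y i t` -/

section Algorithm

variable {I T B P : ℕ}

/-- `Â = (1 / (I T²)) ∑_{i,t,t'} y_{it} y_{it'} X_{it} X_{it'}ᵀ`. -/
def AHat (x : Fin I → Fin T → Matrix (Fin B) (Fin P) ℝ) (y : Fin I → Fin T → ℝ) :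
    Matrix (Fin B) (Fin B) ℝ :=
  (1 / ((I : ℝ) * (T : ℝ) ^ 2)) •
    ∑ i, ∑ t, ∑ t', (y i t * y i t') • (x i t * (x i t')ᵀ)

/-- `Γ̂ = (1 / (I T P)) ∑_{i,t} X_{it} X_{it}ᵀ`. -/
def GammaHat (x : Fin I → Fin T → Matrix (Fin B) (Fin P) ℝ) : Matrix (Fin B) (Fin B) ℝ :=
  (1 / ((I : ℝ) * T * P)) • ∑ i, ∑ t, x i t * (x i t)ᵀ

/-- `B̂ = Γ̂^{-1/2} Â Γ̂^{-1/2}`. -/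
def BHat (x : Fin I → Fin T → Matrix (Fin B) (Fin P) ℝ) (y : Fin I → Fin T → ℝ) :
    Matrix (Fin B) (Fin B) ℝ :=
  invSqrt (GammaHat x) * AHat x y * invSqrt (GammaHat x)

/-- `Ŵ` is a possible output of the algorithm: `Ŵ = Γ̂^{-1/2} eigv_R(B̂)`, for some choice of
orthonormal eigenvectors for the `R` largest eigenvalues of `B̂`. -/
def IsOutput {R : ℕ} (x : Fin I → Fin T → Matrix (Fin B) (Fin P) ℝ) (y : Fin I → Fin T → ℝ)
    (What : Matrix (Fin B) (Fin R) ℝ) : Prop :=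
  ∃ U : Matrix (Fin B) (Fin R) ℝ,
    IsTopEigenframe (BHat x y) U ∧ What = invSqrt (GammaHat x) * U

end Algorithm

/-! ### The constant `k` -/

section Constant

variable {I B P R : ℕ} (Γ : Matrix (Fin B) (Fin B) ℝ) (Δ : Fin I → Matrix (Fin P) (Fin P) ℝ)
  (W : Matrix (Fin B) (Fin R) ℝ) (V : Fin I → Matrix (Fin P) (Fin R) ℝ)

/-- The average of a quantity over the `I` tasks. -/
def avg {I : ℕ} (f : Fin I → ℝ) : ℝ := (1 / (I : ℝ)) * ∑ i, f i

/-- `L_i = ‖Γ‖₂² ‖W‖₂² ‖Δ_i‖₂² ‖V_i‖₂²`. -/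
def Lcoef (i : Fin I) : ℝ :=
  specNorm Γ ^ 2 * specNorm W ^ 2 * specNorm (Δ i) ^ 2 * specNorm (V i) ^ 2

/-- `Q = (1 / I) ∑_i V_iᵀ Δ_i² V_i`. -/
def Qmat : Matrix (Fin R) (Fin R) ℝ := (1 / (I : ℝ)) • ∑ i, (V i)ᵀ * (Δ i * Δ i) * V i

/-- The `R`-th largest eigenvalue of the `B × B` matrix `Γ W Q Wᵀ Γ`, which has rank at most `R`:
its smallest nonzero eigenvalue when the rank is `R`. -/
def lamSignal : ℝ := eig (Γ * W * Qmat Δ V * Wᵀ * Γ) R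

/-- `η = (avg_i L_i) / λ`. -/
def etaCoef : ℝ := avg (fun i => Lcoef Γ Δ W V i) / lamSignal Γ Δ W V

/-- `α = (avg_i L_i²) / λ²`. -/
def alphaCoef : ℝ := avg (fun i => Lcoef Γ Δ W V i ^ 2) / lamSignal Γ Δ W V ^ 2

/-- `μ = √(avg_i L_i⁴) / λ²`. -/
def muCoef : ℝ := √(avg (fun i => Lcoef Γ Δ W V i ^ 4)) / lamSignal Γ Δ W V ^ 2

/-- `ν = (max_i L_i) / λ`. -/
def nuCoef : ℝ := (⨆ i, Lcoef Γ Δ W V i) / lamSignal Γ Δ W V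

/-- `(1 / (I P)) ∑_i tr Δ_i`. -/
def traceScale : ℝ := (1 / ((I : ℝ) * P)) * ∑ i, (Δ i).trace

/-- `ψ = (avg_i ‖Δ_i‖₂²) / ((1 / (I P)) ∑_i tr Δ_i)²`. -/
def psiCoef : ℝ := avg (fun i => specNorm (Δ i) ^ 2) / traceScale Δ ^ 2

/-- `χ = (max_i ‖Δ_i‖₂) / ((1 / (I P)) ∑_i tr Δ_i)`. -/
def chiCoef : ℝ := (⨆ i, specNorm (Δ i)) / traceScale Δ

/-- The condition number `κ_Γ = ‖Γ‖₂ / λ_min(Γ)`. -/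
def kappa : ℝ := specNorm Γ / eig Γ B

/-- `k' = c₁ α + c₂ μ + c₃ max{ν, ν²} + 5 D' max{κ η χ, κ² η² ψ}`. -/
def kPrime (c₁ c₂ c₃ D' : ℝ) : ℝ :=
  c₁ * alphaCoef Γ Δ W V + c₂ * muCoef Γ Δ W V
    + c₃ * max (nuCoef Γ Δ W V) (nuCoef Γ Δ W V ^ 2)
    + 5 * D' * max (kappa Γ * etaCoef Γ Δ W V * chiCoef Δ)
        (kappa Γ ^ 2 * etaCoef Γ Δ W V ^ 2 * psiCoef Δ)

/-- `k = c(κ_Γ)² k'`. -/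
def kConst (c₁ c₂ c₃ D' : ℝ) (c : ℝ → ℝ) : ℝ :=
  c (kappa Γ) ^ 2 * kPrime Γ Δ W V c₁ c₂ c₃ D'

end Constant

end MultiTask

end

/-!
Write `r` for the responses. Regressing each Gaussian matrix `X i t` on its response leaves a
residual that is independent of all the responses, so conditionally on `r` the matrix `Â` is a
quadratic form in independent Gaussians, with mean `noiseCoef Δ r • Γ + condSignal Γ Δ W V r`. The
first term only shifts the spectrum of the whitened matrix, and the second one has the form
`Γ W K`. Hence, had `Γ̂` and `Â` no fluctuations, the leading eigenvectors, whitened once more by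
`Γ̂^(-1/2)`, would span exactly the column space of `W`. Bernstein bounds for Gaussian quadratic
forms, made uniform over the sphere by a net, control three fluctuations: of `Γ̂`, of the empirical
variances of the responses (so that `condSignal` keeps `R` eigenvalues of order `λ`), and of `Â`
given the responses. A perturbation argument for the generalized eigenproblem of `(Â, Γ̂)` turns
them into a bound on `dist(Ŵ, W)`.
-/

namespace MultiTask

/-! ### Exponential moments of Gaussian quadratic forms -/

lemma one_le_one_sub_mul_exp {x : ℝ} (hx : |x| ≤ 1 / 2) : 1 ≤ (1 - x) * Real.exp (x + x ^ 2) := by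
  have hupper := (abs_le.1 hx).2
  have hpos : 0 ≤ 1 - x := by linarith
  rcases le_total 0 x with h0 | h0
  · have hcubic : 0 ≤ 1 - x - x ^ 2 - x ^ 3 := by
      have : x ^ 2 ≤ (1 / 2) ^ 2 := by gcongr
      have : x ^ 3 ≤ (1 / 2) ^ 3 := by gcongr
      linarith
    calc (1 : ℝ) ≤ 1 + x ^ 2 / 2 * (1 - x - x ^ 2 - x ^ 3) :=
          le_add_of_nonneg_right (by positivity)
      _ = (1 - x) * (1 + (x + x ^ 2) + (x + x ^ 2) ^ 2 / 2) := by ring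
      _ ≤ _ := by gcongr; exact Real.quadratic_le_exp_of_nonneg (by positivity)
  · calc (1 : ℝ) ≤ 1 - x ^ 3 := by linarith [Odd.pow_nonpos (by decide : Odd 3) h0]
      _ = (1 - x) * (x + x ^ 2 + 1) := by ring
      _ ≤ _ := by gcongr; exact Real.add_one_le_exp _

lemma inv_sqrt_one_sub_two_mul_le_exp {a : ℝ} (ha : |a| ≤ 1 / 4) :
    (√(1 - 2 * a))⁻¹ ≤ Real.exp (a + 2 * a ^ 2) := by
  obtain ⟨-, hupper⟩ := abs_le.1 ha
  have hpos : 0 < 1 - 2 * a := by linarith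
  have hexp : Real.exp (2 * a + (2 * a) ^ 2) = Real.exp (a + 2 * a ^ 2) ^ 2 := by
    rw [← Real.exp_nat_mul]; congr 1; push_cast; ring
  rw [inv_le_iff_one_le_mul₀ (Real.sqrt_pos.2 hpos), mul_comm,
    ← Real.sqrt_sq (Real.exp_pos (a + 2 * a ^ 2)).le, ← Real.sqrt_mul hpos.le, Real.one_le_sqrt,
    ← hexp]
  exact one_le_one_sub_mul_exp (by rw [abs_mul, abs_two]; linarith)

-- Completing the square: tilting by a quadratic exponent rescales the variance to `w`.
lemma gaussianPDFReal_mul_exp_quadratic {v w : NNReal} (hv : v ≠ 0) {s : ℝ}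
    (hd : 0 < 1 - 2 * (s * v)) (hw : (w : ℝ) = v / (1 - 2 * (s * v))) (m x : ℝ) :
    gaussianPDFReal 0 v x * Real.exp (s * (x ^ 2 + 2 * m * x - v))
      = ((√(1 - 2 * (s * v)))⁻¹ * Real.exp (2 * s ^ 2 * m ^ 2 * w - s * v)) *
        gaussianPDFReal (2 * s * m * w) w x := by
  have hnorm : √(2 * Real.pi * v) = √(1 - 2 * (s * v)) * √(2 * Real.pi * w) := by
    rw [← Real.sqrt_mul hd.le, hw, mul_div_assoc', mul_div_cancel₀ _ hd.ne']
  have hexp : Real.exp (-(x - 0) ^ 2 / (2 * v)) * Real.exp (s * (x ^ 2 + 2 * m * x - v))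
      = Real.exp (2 * s ^ 2 * m ^ 2 * w - s * v)
        * Real.exp (-(x - 2 * s * m * w) ^ 2 / (2 * w)) := by
    have hd' : 1 - 2 * v * s ≠ 0 := by rw [mul_assoc, mul_comm (v : ℝ)]; exact hd.ne'
    rw [← Real.exp_add, ← Real.exp_add]
    congr 1
    rw [hw]; field_simp; ring
  rw [gaussianPDFReal, gaussianPDFReal, mul_assoc, hexp, hnorm, mul_inv]
  ring

lemma lintegral_exp_quadratic_gaussianReal {v : NNReal} {s : ℝ} (hd : 0 < 1 - 2 * (s * v))
    (m : ℝ) :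
    ∫⁻ x, ENNReal.ofReal (Real.exp (s * (x ^ 2 + 2 * m * x - v))) ∂(gaussianReal 0 v)
      = ENNReal.ofReal ((√(1 - 2 * (s * v)))⁻¹ *
          Real.exp (2 * s ^ 2 * m ^ 2 * (v / (1 - 2 * (s * v))) - s * v)) := by
  by_cases hv : v = 0
  · subst hv; simp
  let w : NNReal := ⟨v / (1 - 2 * (s * v)), by positivity⟩
  have hw : w ≠ 0 := by
    rw [← NNReal.coe_ne_zero]
    exact div_ne_zero (NNReal.coe_ne_zero.2 hv) hd.ne'
  have hdensity : ∀ x,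
      (gaussianPDF 0 v * fun x => ENNReal.ofReal (Real.exp (s * (x ^ 2 + 2 * m * x - v)))) x
        = ENNReal.ofReal ((√(1 - 2 * (s * v)))⁻¹ * Real.exp (2 * s ^ 2 * m ^ 2 * w - s * v)) *
          ENNReal.ofReal (gaussianPDFReal (2 * s * m * w) w x) := fun x => by
    rw [Pi.mul_apply, gaussianPDF, ← ENNReal.ofReal_mul (gaussianPDFReal_nonneg _ _ _),
      gaussianPDFReal_mul_exp_quadratic (w := w) hv hd rfl, ENNReal.ofReal_mul (by positivity)]
  rw [gaussianReal_of_var_ne_zero _ hv, lintegral_withDensity_eq_lintegral_mul _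
    (measurable_gaussianPDF 0 v) (by fun_prop)]
  simp_rw [hdensity]
  rw [lintegral_const_mul _ (by fun_prop), lintegral_gaussianPDFReal_eq_one _ hw, mul_one]
  rfl

lemma lintegral_exp_quadratic_gaussianReal_le (v : NNReal) (s m : ℝ) (hs : |s| * v ≤ 1 / 4) :
    ∫⁻ x, ENNReal.ofReal (Real.exp (s * (x ^ 2 + 2 * m * x - v))) ∂(gaussianReal 0 v)
      ≤ ENNReal.ofReal (Real.exp (s ^ 2 * (2 * v ^ 2 + 4 * v * m ^ 2))) := by
  have hsv : |s * v| ≤ 1 / 4 := by rwa [abs_mul, abs_of_nonneg v.coe_nonneg]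
  have hupper := (abs_le.1 hsv).2
  have hd : 0 < 1 - 2 * (s * v) := by linarith
  have htilt : v / (1 - 2 * (s * v)) ≤ 2 * (v : ℝ) := by
    rw [div_le_iff₀ hd]; nlinarith [v.coe_nonneg]
  rw [lintegral_exp_quadratic_gaussianReal hd]
  refine ENNReal.ofReal_le_ofReal ?_
  calc _ ≤ Real.exp (s * v + 2 * (s * v) ^ 2) * Real.exp (2 * s ^ 2 * m ^ 2 * (2 * v) - s * v) := by
        gcongr; exact inv_sqrt_one_sub_two_mul_le_exp hsv
    _ = _ := by rw [← Real.exp_add]; congr 1; ring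

section Moments

variable {Ω : Type*} [MeasurableSpace Ω] {μ : Measure Ω} {J K κ : Type*}

lemma lintegral_prod_comp_of_iIndepFun [Fintype K] {E : K → Type*} [∀ k, MeasurableSpace (E k)]
    {F : ∀ k, Ω → E k} (hF : iIndepFun F μ) (hm : ∀ k, AEMeasurable (F k) μ)
    {f : ∀ k, E k → ENNReal} (hf : ∀ k, Measurable (f k)) :
    ∫⁻ ω, ∏ k, f k (F k ω) ∂μ = ∏ k, ∫⁻ ω, f k (F k ω) ∂μ := by
  have hindep : iIndepFun (fun k => (hm k).mk (F k)) μ := hF.congr fun k => (hm k).ae_eq_mk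
  have hprod := lintegral_prod_eq_prod_lintegral_of_indepFun Finset.univ
    (fun k ω => f k ((hm k).mk (F k) ω)) (hindep.comp f hf)
    (fun k => (hf k).comp (hm k).measurable_mk)
  have hfactor : ∀ k, ∫⁻ ω, f k (F k ω) ∂μ = ∫⁻ ω, f k ((hm k).mk (F k) ω) ∂μ := fun k =>
    lintegral_congr_ae ((hm k).ae_eq_mk.fun_comp (f k))
  simp_rw [hfactor, ← hprod]
  refine lintegral_congr_ae ?_
  filter_upwards [ae_all_iff.2 fun k => (hm k).ae_eq_mk] with ω hω
  simp_rw [hω]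

lemma lintegral_exp_quadratic_le_of_uncorrelated [Fintype K] {F : K → Ω → ℝ}
    (hG : HasGaussianLaw (fun ω k => F k ω) μ) (h0 : ∀ k, μ[F k] = 0)
    (hc : ∀ k l, k ≠ l → cov[F k, F l; μ] = 0) (m : K → ℝ) (s : ℝ)
    (hs : ∀ k, |s| * Var[F k; μ] ≤ 1 / 4) :
    ∫⁻ ω, ENNReal.ofReal
        (Real.exp (s * ∑ k, (F k ω ^ 2 + 2 * m k * F k ω - Var[F k; μ]))) ∂μ
      ≤ ENNReal.ofReal
        (Real.exp (s ^ 2 * ∑ k, (2 * Var[F k; μ] ^ 2 + 4 * Var[F k; μ] * m k ^ 2))) := by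
  have hk : ∀ k, HasGaussianLaw (F k) μ := fun k => hG.eval k
  simp_rw [Finset.mul_sum, Real.exp_sum, ENNReal.ofReal_prod_of_nonneg
    (fun _ _ => (Real.exp_pos _).le)]
  rw [lintegral_prod_comp_of_iIndepFun (f := fun k x => ENNReal.ofReal
    (Real.exp (s * (x ^ 2 + 2 * m k * x - Var[F k; μ])))) (hG.iIndepFun_of_covariance_eq_zero hc)
    (fun k => (hk k).aemeasurable) (fun k => by fun_prop)]
  refine Finset.prod_le_prod' fun k _ => ?_
  have hlaw := (hk k).map_eq_gaussianReal
  rw [h0 k] at hlaw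
  have hbound := lintegral_exp_quadratic_gaussianReal_le (Var[F k; μ]).toNNReal s (m k)
    (by rw [Real.coe_toNNReal _ (variance_nonneg _ _)]; exact hs k)
  rwa [← hlaw, lintegral_map' (by fun_prop) (hk k).aemeasurable,
    Real.coe_toNNReal _ (variance_nonneg _ _)] at hbound

variable [Fintype κ]

lemma covariance_sum_mul_sum_mul [IsFiniteMeasure μ] [Fintype K] {Y : κ → Ω → ℝ} {Z : K → Ω → ℝ}
    (hY : ∀ p, MemLp (Y p) 2 μ) (hZ : ∀ q, MemLp (Z q) 2 μ) (a : κ → ℝ) (c : K → ℝ) :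
    cov[fun ω => ∑ p, a p * Y p ω, fun ω => ∑ q, c q * Z q ω; μ]
      = ∑ p, ∑ q, a p * (c q * cov[Y p, Z q; μ]) := by
  rw [covariance_fun_sum_fun_sum (fun p => (hY p).const_mul _) (fun q => (hZ q).const_mul _)]
  simp only [covariance_const_mul_left, covariance_const_mul_right, mul_left_comm]

lemma sum_coord_mul_sum_coord (b : OrthonormalBasis κ ℝ (EuclideanSpace ℝ κ)) (x y : κ → ℝ) :
    ∑ k, (∑ p, b k p * x p) * (∑ p, b k p * y p) = ∑ p, x p * y p := by
  have h := b.sum_inner_mul_inner (WithLp.toLp 2 x) (WithLp.toLp 2 y)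
  simpa [PiLp.inner_apply, mul_comm] using h

lemma sum_sq_coord_eq_one (b : OrthonormalBasis κ ℝ (EuclideanSpace ℝ κ)) (k : κ) :
    ∑ p, b k p ^ 2 = 1 := by
  have h := EuclideanSpace.norm_sq_eq (b k)
  rw [b.orthonormal.1 k] at h
  simpa using h.symm

-- The basis diagonalizes the covariance matrix of `Y`.
lemma exists_orthonormalBasis_covariance_eq_zero [IsFiniteMeasure μ] {Y : κ → Ω → ℝ}
    (hY : ∀ p, MemLp (Y p) 2 μ) :
    ∃ b : OrthonormalBasis κ ℝ (EuclideanSpace ℝ κ), ∀ k l, k ≠ l →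
      cov[fun ω => ∑ p, b k p * Y p ω, fun ω => ∑ p, b l p * Y p ω; μ] = 0 := by
  classical
  let S : Matrix κ κ ℝ := Matrix.of fun p q => cov[Y p, Y q; μ]
  have hS : S.IsHermitian := by ext p q; simp [S, covariance_comm]
  refine ⟨hS.eigenvectorBasis, fun k l hkl => ?_⟩
  set b := hS.eigenvectorBasis
  have heigen : ∀ p, ∑ q, b l q * cov[Y p, Y q; μ] = hS.eigenvalues l * b l p := fun p => by
    have h := congrFun (hS.mulVec_eigenvectorBasis l) p
    simpa [mulVec, dotProduct, S, mul_comm] using h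
  have horth : ∑ p, b k p * b l p = 0 := by
    have h := b.orthonormal.2 hkl
    simpa [PiLp.inner_apply, mul_comm] using h
  rw [covariance_sum_mul_sum_mul hY hY]
  simp_rw [← Finset.mul_sum, heigen, mul_left_comm _ (hS.eigenvalues l), ← Finset.mul_sum, horth,
    mul_zero]

lemma integral_sum_mul_eq_zero {Y : κ → Ω → ℝ} (hY : ∀ p, Integrable (Y p) μ)
    (h0 : ∀ p, μ[Y p] = 0) (a : κ → ℝ) : ∫ ω, ∑ p, a p * Y p ω ∂μ = 0 := by
  rw [integral_finsetSum _ fun p _ => (hY p).const_mul _]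
  simp [integral_const_mul, h0]

lemma sum_variance_coord [IsFiniteMeasure μ] {Y : κ → Ω → ℝ} (hY : ∀ p, MemLp (Y p) 2 μ)
    (h0 : ∀ p, μ[Y p] = 0) (b : OrthonormalBasis κ ℝ (EuclideanSpace ℝ κ)) :
    ∑ k, Var[fun ω => ∑ p, b k p * Y p ω; μ] = ∑ p, Var[Y p; μ] := by
  have hF : ∀ k, MemLp (fun ω => ∑ p, b k p * Y p ω) 2 μ := fun k =>
    memLp_finsetSum _ fun p _ => (hY p).const_mul _
  have hF0 : ∀ k, μ[fun ω => ∑ p, b k p * Y p ω] = 0 := fun k =>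
    integral_sum_mul_eq_zero (fun p => (hY p).integrable one_le_two) h0 _
  calc ∑ k, Var[fun ω => ∑ p, b k p * Y p ω; μ]
      = ∑ k, ∫ ω, (∑ p, b k p * Y p ω) ^ 2 ∂μ := Finset.sum_congr rfl fun k _ =>
        variance_of_integral_eq_zero (hF k).1.aemeasurable (hF0 k)
    _ = ∑ p, ∫ ω, Y p ω ^ 2 ∂μ := by
        rw [← integral_finsetSum _ fun k _ => (hF k).integrable_sq,
          ← integral_finsetSum _ fun p _ => (hY p).integrable_sq]
        simp_rw [sq, sum_coord_mul_sum_coord]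
    _ = ∑ p, Var[Y p; μ] := Finset.sum_congr rfl fun p _ =>
        (variance_of_integral_eq_zero (hY p).1.aemeasurable (h0 p)).symm

lemma hasGaussianLaw_sum_mul [Finite J] {Y : J → κ → Ω → ℝ}
    (hG : HasGaussianLaw (fun ω (x : J × κ) => Y x.1 x.2 ω) μ) (a : J → κ → κ → ℝ) :
    HasGaussianLaw (fun ω (x : J × κ) => ∑ p, a x.1 x.2 p * Y x.1 p ω) μ := by
  have := Fintype.ofFinite J
  have h := hG.map_fun (ContinuousLinearMap.pi fun x : J × κ =>
    ∑ p, a x.1 x.2 p • ContinuousLinearMap.proj (R := ℝ) (φ := fun _ : J × κ => ℝ) (x.1, p))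
  convert! h using 2
  ext x
  simp

-- Rotating each block onto the eigenbasis of its covariance makes all coordinates independent.
lemma lintegral_exp_block_quadratic_le [Fintype J] {Y : J → κ → Ω → ℝ}
    (hG : HasGaussianLaw (fun ω (x : J × κ) => Y x.1 x.2 ω) μ)
    (h0 : ∀ j p, μ[Y j p] = 0) (hc : ∀ i j, i ≠ j → ∀ p q, cov[Y i p, Y j q; μ] = 0)
    {τ : J → ℝ} (hτ : ∀ j (w : κ → ℝ), Var[fun ω => ∑ p, w p * Y j p ω; μ] ≤ τ j * ∑ p, w p ^ 2)
    (m : J → κ → ℝ) {s : ℝ} (hs : ∀ j, |s| * τ j ≤ 1 / 4) :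
    ∫⁻ ω, ENNReal.ofReal (Real.exp (s * ∑ j, ∑ p,
        (Y j p ω ^ 2 + 2 * m j p * Y j p ω - Var[Y j p; μ]))) ∂μ
      ≤ ENNReal.ofReal (Real.exp (s ^ 2 * ∑ j,
        (2 * Fintype.card κ * τ j ^ 2 + 4 * τ j * ∑ p, m j p ^ 2))) := by
  have := hG.isProbabilityMeasure
  have hL : ∀ j p, MemLp (Y j p) 2 μ := fun j p => (hG.eval (j, p)).memLp_two
  choose b hb using fun j => exists_orthonormalBasis_covariance_eq_zero (hL j)
  let F : J × κ → Ω → ℝ := fun x ω => ∑ p, b x.1 x.2 p * Y x.1 p ω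
  let m' : J × κ → ℝ := fun x => ∑ p, b x.1 x.2 p * m x.1 p
  have hF0 : ∀ x, μ[F x] = 0 := fun x =>
    integral_sum_mul_eq_zero (fun p => (hL _ p).integrable one_le_two) (h0 _) _
  have hFc : ∀ x y, x ≠ y → cov[F x, F y; μ] = 0 := by
    rintro ⟨i, k⟩ ⟨j, l⟩ hne
    by_cases hij : i = j
    · subst hij
      exact hb i k l fun h => hne (by rw [h])
    · refine (covariance_sum_mul_sum_mul (hL i) (hL j) _ _).trans ?_
      simp [hc i j hij]
  have hvar : ∀ x, Var[F x; μ] ≤ τ x.1 := fun x => by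
    simpa [sum_sq_coord_eq_one] using hτ x.1 (b x.1 x.2)
  have hrotate : ∀ ω, ∑ x, (F x ω ^ 2 + 2 * m' x * F x ω - Var[F x; μ])
      = ∑ j, ∑ p, (Y j p ω ^ 2 + 2 * m j p * Y j p ω - Var[Y j p; μ]) := fun ω => by
    rw [Fintype.sum_prod_type]
    refine Finset.sum_congr rfl fun j _ => ?_
    simp_rw [F, m', Finset.sum_sub_distrib, Finset.sum_add_distrib, mul_assoc, ← Finset.mul_sum,
      sq, sum_coord_mul_sum_coord, sum_variance_coord (hL j) (h0 j)]
  have key := lintegral_exp_quadratic_le_of_uncorrelated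
    (hasGaussianLaw_sum_mul hG fun j k p => b j k p) hF0 hFc m' s fun x =>
      (mul_le_mul_of_nonneg_left (hvar x) (abs_nonneg s)).trans (hs x.1)
  rw [lintegral_congr fun ω =>
    congrArg (fun z => ENNReal.ofReal (Real.exp (s * z))) (hrotate ω)] at key
  refine key.trans (ENNReal.ofReal_le_ofReal (Real.exp_le_exp.2
    (mul_le_mul_of_nonneg_left ?_ (sq_nonneg s))))
  rw [Fintype.sum_prod_type]
  refine Finset.sum_le_sum fun j _ => ?_
  calc _ ≤ ∑ k, (2 * τ j ^ 2 + 4 * τ j * m' (j, k) ^ 2) := by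
        gcongr with k
        exacts [variance_nonneg _ _, hvar (j, k), hvar (j, k)]
    _ = _ := by
        simp_rw [Finset.sum_add_distrib, ← Finset.mul_sum, m', sq, sum_coord_mul_sum_coord]
        simp; ring

end Moments

/-! ### Tail bounds -/

lemma exists_bernstein_parameter {V b x t : ℝ} (hb : 0 < b) (ht : 0 ≤ t)
    (hVx : 4 * V * x ≤ t ^ 2) (hbx : 2 * b * x ≤ t) :
    ∃ s, 0 ≤ s ∧ s * b ≤ 1 ∧ s ^ 2 * V - s * t ≤ -x := by
  rcases lt_or_ge (t * b) (2 * V) with htb | htb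
  · have hV0 : 0 < V := by nlinarith [mul_nonneg ht hb.le]
    refine ⟨t / (2 * V), by positivity, ?_, ?_⟩
    · rw [div_mul_eq_mul_div, div_le_one (by positivity)]; exact htb.le
    · rw [show (t / (2 * V)) ^ 2 * V - t / (2 * V) * t = -(t ^ 2 / (4 * V)) by field_simp; ring,
        neg_le_neg_iff, le_div_iff₀ (by positivity)]
      linarith
  · refine ⟨1 / b, by positivity, by field_simp; rfl, ?_⟩
    rw [show (1 / b) ^ 2 * V - 1 / b * t = (V - t * b) / b ^ 2 by field_simp,
      div_le_iff₀ (by positivity)]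
    nlinarith

section Tails

variable {Ω : Type*} [MeasurableSpace Ω] {μ : Measure Ω} {J κ : Type*}

lemma measure_ge_le_of_lintegral_exp_le {ξ : Ω → ℝ} (hξ : AEMeasurable ξ μ) {V b x t : ℝ}
    (hb : 0 < b) (h : ∀ s, 0 ≤ s → s * b ≤ 1 →
      ∫⁻ ω, ENNReal.ofReal (Real.exp (s * ξ ω)) ∂μ ≤ ENNReal.ofReal (Real.exp (s ^ 2 * V)))
    (ht : 0 ≤ t) (hVx : 4 * V * x ≤ t ^ 2) (hbx : 2 * b * x ≤ t) :
    μ {ω | t ≤ ξ ω} ≤ ENNReal.ofReal (Real.exp (-x)) := by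
  obtain ⟨s, hs0, hsb, hsx⟩ := exists_bernstein_parameter hb ht hVx hbx
  have hmarkov := meas_ge_le_lintegral_div (μ := μ)
    (f := fun ω => ENNReal.ofReal (Real.exp (s * ξ ω))) (by fun_prop)
    (ε := ENNReal.ofReal (Real.exp (s * t))) (by simp [Real.exp_pos]) ENNReal.ofReal_ne_top
  calc μ {ω | t ≤ ξ ω}
      ≤ μ {ω | ENNReal.ofReal (Real.exp (s * t)) ≤ ENNReal.ofReal (Real.exp (s * ξ ω))} :=
        measure_mono fun ω hω => ENNReal.ofReal_le_ofReal
          (Real.exp_le_exp.2 (mul_le_mul_of_nonneg_left hω hs0))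
    _ ≤ ENNReal.ofReal (Real.exp (s ^ 2 * V)) / ENNReal.ofReal (Real.exp (s * t)) :=
        hmarkov.trans (ENNReal.div_le_div_right (h s hs0 hsb) _)
    _ = ENNReal.ofReal (Real.exp (s ^ 2 * V - s * t)) := by
        rw [← ENNReal.ofReal_div_of_pos (Real.exp_pos _), ← Real.exp_sub]
    _ ≤ _ := ENNReal.ofReal_le_ofReal (Real.exp_le_exp.2 hsx)

lemma measure_abs_ge_le_of_lintegral_exp_le {ξ : Ω → ℝ} (hξ : AEMeasurable ξ μ) {V b x t : ℝ}
    (hb : 0 < b) (h : ∀ s, |s| * b ≤ 1 →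
      ∫⁻ ω, ENNReal.ofReal (Real.exp (s * ξ ω)) ∂μ ≤ ENNReal.ofReal (Real.exp (s ^ 2 * V)))
    (ht : 0 ≤ t) (hVx : 4 * V * x ≤ t ^ 2) (hbx : 2 * b * x ≤ t) :
    μ {ω | t ≤ |ξ ω|} ≤ 2 * ENNReal.ofReal (Real.exp (-x)) := by
  have hupper := measure_ge_le_of_lintegral_exp_le hξ hb
    (fun s hs0 hs => h s (by rwa [abs_of_nonneg hs0])) ht hVx hbx
  have hlower := measure_ge_le_of_lintegral_exp_le hξ.neg hb
    (fun s hs0 hs => by simpa using h (-s) (by rwa [abs_neg, abs_of_nonneg hs0])) ht hVx hbx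
  calc μ {ω | t ≤ |ξ ω|} ≤ μ ({ω | t ≤ ξ ω} ∪ {ω | t ≤ (-ξ) ω}) :=
        measure_mono fun ω hω => le_abs.1 (show t ≤ |ξ ω| from hω)
    _ ≤ _ := measure_union_le _ _
    _ ≤ _ := by rw [two_mul]; exact add_le_add hupper hlower

lemma measure_abs_block_quadratic_ge_le [Fintype J] [Fintype κ] {Y : J → κ → Ω → ℝ}
    (hG : HasGaussianLaw (fun ω (x : J × κ) => Y x.1 x.2 ω) μ)
    (h0 : ∀ j p, μ[Y j p] = 0) (hc : ∀ i j, i ≠ j → ∀ p q, cov[Y i p, Y j q; μ] = 0)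
    {τ : J → ℝ} (hτ : ∀ j (w : κ → ℝ), Var[fun ω => ∑ p, w p * Y j p ω; μ] ≤ τ j * ∑ p, w p ^ 2)
    (m : J → κ → ℝ) {b Q x t : ℝ} (hb : 0 < b) (hτb : ∀ j, 4 * τ j ≤ b)
    (hQ : ∑ j, (2 * Fintype.card κ * τ j ^ 2 + 4 * τ j * ∑ p, m j p ^ 2) ≤ Q)
    (ht : 0 ≤ t) (hQx : 4 * Q * x ≤ t ^ 2) (hbx : 2 * b * x ≤ t) :
    μ {ω | t ≤ |∑ j, ∑ p, (Y j p ω ^ 2 + 2 * m j p * Y j p ω - Var[Y j p; μ])|}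
      ≤ 2 * ENNReal.ofReal (Real.exp (-x)) := by
  have hY : ∀ j p, AEMeasurable (Y j p) μ := fun j p => (hG.eval (j, p)).aemeasurable
  refine measure_abs_ge_le_of_lintegral_exp_le (by fun_prop) hb (fun s hs => ?_) ht hQx hbx
  refine (lintegral_exp_block_quadratic_le hG h0 hc hτ m fun j => ?_).trans
    (ENNReal.ofReal_le_ofReal (Real.exp_le_exp.2 (mul_le_mul_of_nonneg_left hQ (sq_nonneg s))))
  linarith [mul_le_mul_of_nonneg_left (hτb j) (abs_nonneg s)]

lemma measure_prodMk_mem_le_of_indepFun {E F : Type*} [MeasurableSpace E]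
    [MeasurableSpace F] [IsProbabilityMeasure μ] {Y : Ω → E} {Z : Ω → F}
    (hi : IndepFun Y Z μ) (hY : AEMeasurable Y μ) (hZ : AEMeasurable Z μ) {A : Set (E × F)}
    (hA : MeasurableSet A) {δ : ENNReal} (h : ∀ c, μ {ω | (c, Z ω) ∈ A} ≤ δ) :
    μ {ω | (Y ω, Z ω) ∈ A} ≤ δ := by
  have : IsProbabilityMeasure (μ.map Y) := Measure.isProbabilityMeasure_map hY
  calc μ {ω | (Y ω, Z ω) ∈ A} = (μ.map fun ω => (Y ω, Z ω)) A :=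
        (Measure.map_apply_of_aemeasurable (hY.prodMk hZ) hA).symm
    _ = ∫⁻ c, (μ.map Z) (Prod.mk c ⁻¹' A) ∂(μ.map Y) := by
        rw [(indepFun_iff_map_prod_eq_prod_map_map hY hZ).1 hi, Measure.prod_apply hA]
    _ ≤ ∫⁻ _, δ ∂(μ.map Y) := lintegral_mono fun c => by
        rw [Measure.map_apply_of_aemeasurable hZ (measurable_prodMk_left hA)]
        exact h c
    _ = δ := by simp

end Tails

/-! ### Spectral norms and quadratic forms -/

section QuadraticForms

variable {ι κ : Type*} [Fintype ι] [Fintype κ]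

lemma dotProduct_self_nonneg (x : ι → ℝ) : 0 ≤ x ⬝ᵥ x := dotProduct_star_self_nonneg x

lemma dotProduct_self_eq_norm_sq (x : ι → ℝ) : x ⬝ᵥ x = ‖WithLp.toLp 2 x‖ ^ 2 := by
  rw [EuclideanSpace.norm_sq_eq]; simp [dotProduct, sq]

lemma dotProduct_eq_inner (x y : ι → ℝ) :
    x ⬝ᵥ y = inner ℝ (WithLp.toLp 2 x) (WithLp.toLp 2 y) := by
  simp [dotProduct, PiLp.inner_apply, mul_comm]

lemma dotProduct_mulVec_eq_transpose (A : Matrix ι κ ℝ) (x : ι → ℝ) (y : κ → ℝ) :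
    x ⬝ᵥ A *ᵥ y = Aᵀ *ᵥ x ⬝ᵥ y := by
  rw [dotProduct_mulVec, mulVec_transpose]

lemma posDef_of_mul_dotProduct_le {G : Matrix ι ι ℝ} (hG : G.IsHermitian) {m : ℝ} (hm : 0 < m)
    (h : ∀ x, m * (x ⬝ᵥ x) ≤ x ⬝ᵥ G *ᵥ x) : G.PosDef := by
  refine Matrix.PosDef.of_dotProduct_mulVec_pos hG fun x hx => ?_
  have hx0 : 0 < x ⬝ᵥ x := (dotProduct_self_nonneg x).lt_of_ne' (dotProduct_self_eq_zero.not.2 hx)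
  simpa using (mul_pos hm hx0).trans_le (h x)

lemma mul_norm_le_norm_mulVec {A : Matrix ι ι ℝ} {l : ℝ}
    (h : ∀ x, l * (x ⬝ᵥ x) ≤ x ⬝ᵥ A *ᵥ x) (x : ι → ℝ) :
    l * ‖WithLp.toLp 2 x‖ ≤ ‖WithLp.toLp 2 (A *ᵥ x)‖ := by
  have hinner := h x
  rw [dotProduct_self_eq_norm_sq, dotProduct_eq_inner] at hinner
  rcases (norm_nonneg (WithLp.toLp 2 x)).eq_or_lt with h0 | hpos
  · rw [← h0, mul_zero]; exact norm_nonneg _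
  · refine le_of_mul_le_mul_left ?_ hpos
    linarith [hinner.trans (real_inner_le_norm _ _)]

end QuadraticForms

section SpectralNorm

variable {l m n : ℕ}

lemma specNorm_nonneg (A : Matrix (Fin m) (Fin n) ℝ) : 0 ≤ specNorm A := norm_nonneg _

lemma norm_mulVec_le (A : Matrix (Fin m) (Fin n) ℝ) (x : Fin n → ℝ) :
    ‖WithLp.toLp 2 (A *ᵥ x)‖ ≤ specNorm A * ‖WithLp.toLp 2 x‖ :=
  (Matrix.toEuclideanLin A).toContinuousLinearMap.le_opNorm (WithLp.toLp 2 x)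

lemma mulVec_dotProduct_self_le (A : Matrix (Fin m) (Fin n) ℝ) (x : Fin n → ℝ) :
    A *ᵥ x ⬝ᵥ A *ᵥ x ≤ specNorm A ^ 2 * (x ⬝ᵥ x) := by
  rw [dotProduct_self_eq_norm_sq, dotProduct_self_eq_norm_sq, ← mul_pow]
  exact pow_le_pow_left₀ (norm_nonneg _) (norm_mulVec_le A x) 2

lemma abs_dotProduct_mulVec_self_le (A : Matrix (Fin n) (Fin n) ℝ) (x : Fin n → ℝ) :
    |x ⬝ᵥ A *ᵥ x| ≤ specNorm A * (x ⬝ᵥ x) := by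
  rw [dotProduct_self_eq_norm_sq, dotProduct_eq_inner]
  calc _ ≤ ‖WithLp.toLp 2 x‖ * ‖WithLp.toLp 2 (A *ᵥ x)‖ := abs_real_inner_le_norm _ _
    _ ≤ ‖WithLp.toLp 2 x‖ * (specNorm A * ‖WithLp.toLp 2 x‖) := by
      gcongr; exact norm_mulVec_le A x
    _ = _ := by ring

lemma dotProduct_mulVec_self_le (A : Matrix (Fin n) (Fin n) ℝ) (x : Fin n → ℝ) :
    x ⬝ᵥ A *ᵥ x ≤ specNorm A * (x ⬝ᵥ x) :=
  (le_abs_self _).trans (abs_dotProduct_mulVec_self_le A x)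

lemma abs_dotProduct_mulVec_sub_le (A C : Matrix (Fin n) (Fin n) ℝ) (x : Fin n → ℝ) :
    |x ⬝ᵥ A *ᵥ x - x ⬝ᵥ C *ᵥ x| ≤ specNorm (A - C) * (x ⬝ᵥ x) := by
  rw [← dotProduct_sub, ← sub_mulVec]
  exact abs_dotProduct_mulVec_self_le _ x

lemma specNorm_sub_le (A C : Matrix (Fin m) (Fin n) ℝ) :
    specNorm (A - C) ≤ specNorm A + specNorm C := by
  simpa only [specNorm, map_sub] using norm_sub_le _ _

lemma specNorm_smul (c : ℝ) (A : Matrix (Fin m) (Fin n) ℝ) :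
    specNorm (c • A) = |c| * specNorm A := by
  simpa only [specNorm, map_smul, Real.norm_eq_abs] using norm_smul c _

open scoped Matrix.Norms.L2Operator in
lemma specNorm_transpose (A : Matrix (Fin m) (Fin n) ℝ) : specNorm Aᵀ = specNorm A := by
  have := Matrix.l2_opNorm_conjTranspose A
  rwa [conjTranspose_eq_transpose_of_trivial] at this

open scoped Matrix.Norms.L2Operator in
lemma specNorm_mul_le (A : Matrix (Fin l) (Fin m) ℝ) (C : Matrix (Fin m) (Fin n) ℝ) :
    specNorm (A * C) ≤ specNorm A * specNorm C := Matrix.l2_opNorm_mul A C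

lemma specNorm_pos_of_ne_zero {A : Matrix (Fin m) (Fin n) ℝ} (h : A ≠ 0) : 0 < specNorm A :=
  norm_pos_iff.2 fun h0 => h <| by
    simpa only [LinearEquiv.map_eq_zero_iff] using h0

end SpectralNorm

/-! ### Nets of the unit sphere -/

lemma exists_finset_separated_net (E : Type*) [NormedAddCommGroup E] [NormedSpace ℝ E]
    [FiniteDimensional ℝ E] :
    ∃ s : Finset E, s.card ≤ 5 ^ Module.finrank ℝ E ∧ (∀ c ∈ s, ‖c‖ = 2) ∧
      ∀ x : E, ‖x‖ = 2 → ∃ c ∈ s, ‖x - c‖ < 1 := by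
  classical
  let IsSep : Finset E → Prop := fun s =>
    (∀ c ∈ s, ‖c‖ = 2) ∧ ∀ c ∈ s, ∀ d ∈ s, c ≠ d → 1 ≤ ‖c - d‖
  have hcard : ∀ s, IsSep s → s.card ≤ 5 ^ Module.finrank ℝ E := fun s hs =>
    Besicovitch.card_le_of_separated s (fun c hc => (hs.1 c hc).le) hs.2
  let IsCard : ℕ → Prop := fun k => ∃ s, IsSep s ∧ s.card = k
  have hcard0 : IsCard 0 := ⟨∅, ⟨by simp, by simp⟩, rfl⟩
  -- A separated set of maximal cardinality is a net: any uncovered point could be added to it.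
  obtain ⟨s, hs, hsmax⟩ := Nat.findGreatest_spec (Nat.zero_le (5 ^ Module.finrank ℝ E)) hcard0
  refine ⟨s, hcard s hs, hs.1, fun x hx => ?_⟩
  by_contra! hfar
  have hxs : x ∉ s := fun h => by
    have := hfar x h
    rw [sub_self, norm_zero] at this
    linarith
  have hins : IsSep (insert x s) := by
    refine ⟨by simpa [hx] using hs.1, fun c hc d hd hne => ?_⟩
    rcases Finset.mem_insert.1 hc with rfl | hcs <;> rcases Finset.mem_insert.1 hd with rfl | hds
    · exact absurd rfl hne
    · exact hfar d hds
    · rw [norm_sub_rev]; exact hfar c hcs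
    · exact hs.2 c hcs d hds hne
  have hle := Nat.le_findGreatest (P := IsCard) (hcard _ hins) ⟨_, hins, rfl⟩
  rw [← hsmax, Finset.card_insert_of_notMem hxs] at hle
  omega

section SphereNet

variable {E : Type*} [NormedAddCommGroup E] [InnerProductSpace ℝ E]

lemma norm_sub_mul_norm_add_le_of_norm_eq_one {x u : E} (hx : ‖x‖ = 1) (hu : ‖u‖ = 1)
    (hxu : ‖x - u‖ ≤ 1 / 2) : ‖x - u‖ * ‖x + u‖ ≤ 31 / 32 := by
  have hpar := parallelogram_law_with_norm ℝ x u
  rw [hx, hu] at hpar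
  have hsub : ‖x - u‖ ^ 2 ≤ 1 / 4 := by nlinarith [norm_nonneg (x - u)]
  refine le_of_sq_le_sq ?_ (by norm_num)
  calc (‖x - u‖ * ‖x + u‖) ^ 2 = ‖x - u‖ ^ 2 * (4 - ‖x - u‖ ^ 2) := by
        rw [mul_pow]; congr 1; linarith
    _ ≤ (31 / 32) ^ 2 := by nlinarith [sq_nonneg (‖x - u‖)]

lemma abs_inner_apply_self_le_of_norm_sub_le {T : E →L[ℝ] E}
    (hT : (T : E →ₗ[ℝ] E).IsSymmetric) {x u : E} (hx : ‖x‖ = 1) (hu : ‖u‖ = 1)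
    (hxu : ‖x - u‖ ≤ 1 / 2) :
    |inner ℝ x (T x)| ≤ |inner ℝ u (T u)| + 31 / 32 * ‖T‖ := by
  have hsymm : inner ℝ u (T x) = inner ℝ x (T u) := by
    rw [real_inner_comm]; exact hT x u
  have hsplit : inner ℝ x (T x) = inner ℝ u (T u) + inner ℝ (x - u) (T (x + u)) := by
    rw [map_add, inner_sub_left, inner_add_right, inner_add_right, hsymm]; ring
  rw [hsplit]
  refine (abs_add_le _ _).trans ?_
  gcongr
  calc |inner ℝ (x - u) (T (x + u))| ≤ ‖x - u‖ * ‖T (x + u)‖ := abs_real_inner_le_norm _ _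
    _ ≤ ‖x - u‖ * (‖T‖ * ‖x + u‖) := by gcongr; exact T.le_opNorm _
    _ = ‖x - u‖ * ‖x + u‖ * ‖T‖ := by ring
    _ ≤ 31 / 32 * ‖T‖ := by gcongr; exact norm_sub_mul_norm_add_le_of_norm_eq_one hx hu hxu

lemma opNorm_le_of_forall_abs_inner_le {T : E →L[ℝ] E} (hT : (T : E →ₗ[ℝ] E).IsSymmetric) {c : ℝ}
    (hc : 0 ≤ c) (h : ∀ x, ‖x‖ = 1 → |inner ℝ x (T x)| ≤ c) : ‖T‖ ≤ c := by
  rw [T.norm_eq_iSup_rayleighQuotient hT]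
  refine ciSup_le fun x => ?_
  rcases eq_or_ne x 0 with rfl | hx
  · simpa using hc
  · have hx0 : ‖x‖ ≠ 0 := norm_ne_zero_iff.2 hx
    have hnormalize : T.rayleighQuotient x = inner ℝ (‖x‖⁻¹ • x) (T (‖x‖⁻¹ • x)) := by
      rw [map_smul, inner_smul_left, inner_smul_right, ContinuousLinearMap.rayleighQuotient,
        ContinuousLinearMap.reApplyInnerSelf_apply, real_inner_comm]
      simp only [RCLike.re_to_real, map_inv₀, conj_trivial]
      field_simp
    rw [hnormalize]
    exact h _ (norm_smul_inv_norm hx)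

lemma exists_finset_opNorm_le [FiniteDimensional ℝ E] :
    ∃ N : Finset E, N.card ≤ 5 ^ Module.finrank ℝ E ∧ (∀ u ∈ N, ‖u‖ = 1) ∧
      ∀ T : E →L[ℝ] E, (T : E →ₗ[ℝ] E).IsSymmetric → ∀ t, 0 ≤ t →
        (∀ u ∈ N, |inner ℝ u (T u)| ≤ t) → ‖T‖ ≤ 32 * t := by
  classical
  obtain ⟨s, hcard, hnorm, hnet⟩ := exists_finset_separated_net E
  have hunit : ∀ c ∈ s, ‖(1 / 2 : ℝ) • c‖ = 1 := fun c hc => by simp [norm_smul, hnorm c hc]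
  refine ⟨s.image fun c => (1 / 2 : ℝ) • c, Finset.card_image_le.trans hcard,
    by simpa using hunit, fun T hT t ht hN => ?_⟩
  have hle : ‖T‖ ≤ t + 31 / 32 * ‖T‖ := by
    refine opNorm_le_of_forall_abs_inner_le hT (by positivity) fun x hx => ?_
    obtain ⟨c, hc, hxc⟩ := hnet ((2 : ℝ) • x) (by simp [norm_smul, hx])
    have hnear : ‖x - (1 / 2 : ℝ) • c‖ ≤ 1 / 2 := by
      have : x - (1 / 2 : ℝ) • c = (1 / 2 : ℝ) • ((2 : ℝ) • x - c) := by module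
      rw [this, norm_smul, Real.norm_of_nonneg (by norm_num)]; linarith
    exact (abs_inner_apply_self_le_of_norm_sub_le hT hx (hunit c hc) hnear).trans
      (by gcongr; exact hN _ (Finset.mem_image_of_mem _ hc))
  linarith

end SphereNet

lemma exists_finset_specNorm_le (n : ℕ) : ∃ N : Finset (Fin n → ℝ), N.card ≤ 5 ^ n ∧
    (∀ u ∈ N, u ⬝ᵥ u = 1) ∧ ∀ A : Matrix (Fin n) (Fin n) ℝ, A.IsHermitian → ∀ t, 0 ≤ t →
      (∀ u ∈ N, |u ⬝ᵥ A *ᵥ u| ≤ t) → specNorm A ≤ 32 * t := by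
  classical
  obtain ⟨N, hcard, hunit, hN⟩ := exists_finset_opNorm_le (E := EuclideanSpace ℝ (Fin n))
  rw [finrank_euclideanSpace_fin] at hcard
  refine ⟨N.image WithLp.ofLp, Finset.card_image_le.trans hcard, ?_, fun A hA t ht hq => ?_⟩
  · refine Finset.forall_mem_image.2 fun u hu => ?_
    rw [dotProduct_self_eq_norm_sq, WithLp.toLp_ofLp, hunit u hu, one_pow]
  · refine hN (Matrix.toEuclideanLin A).toContinuousLinearMap
      (isSymmetric_toEuclideanLin_iff.mpr hA) t ht fun u hu => ?_
    have hu' := hq u.ofLp (Finset.mem_image_of_mem _ hu)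
    rwa [dotProduct_eq_inner] at hu'

/-! ### Eigenvalues -/

section Eigenvalues

variable {n R : ℕ} {A : Matrix (Fin n) (Fin n) ℝ}

lemma eig_eq_zero {r : ℕ} (h : ¬ (A.IsHermitian ∧ 1 ≤ r ∧ r ≤ n)) : eig A r = 0 := dif_neg h

lemma eig_anti (hA : A.IsHermitian) {r : ℕ} (hr : 1 ≤ r) (hrR : r ≤ R) (hR : R ≤ n) :
    eig A R ≤ eig A r := by
  rw [eig, eig, dif_pos ⟨hA, hr.trans hrR, hR⟩, dif_pos ⟨hA, hr, hrR.trans hR⟩]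
  apply hA.eigenvalues₀_antitone
  simp only [Fin.mk_le_mk]
  omega

lemma exists_eigenbasis (hA : A.IsHermitian) :
    ∃ b : OrthonormalBasis (Fin n) ℝ (EuclideanSpace ℝ (Fin n)),
      ∀ x : Fin n → ℝ, x ⬝ᵥ A *ᵥ x =
        ∑ k : Fin n, eig A (k + 1) * inner ℝ (b k) (WithLp.toLp 2 x) ^ 2 := by
  have hsymm := isSymmetric_toEuclideanLin_iff.mpr hA
  let b₀ := hsymm.eigenvectorBasis finrank_euclideanSpace
  let b := b₀.reindex (finCongr (Fintype.card_fin n))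
  have hb : ∀ k : Fin n, Matrix.toEuclideanLin A (b k) = eig A (k + 1) • b k := by
    intro k
    rw [OrthonormalBasis.reindex_apply, hsymm.apply_eigenvectorBasis finrank_euclideanSpace, eig,
      dif_pos ⟨hA, by omega, by omega⟩]
    rfl
  refine ⟨b, fun x => ?_⟩
  rw [dotProduct_eq_inner, ← b.sum_inner_mul_inner]
  refine Finset.sum_congr rfl fun k _ => ?_
  have happly : inner ℝ (b k) (WithLp.toLp 2 (A *ᵥ x))
      = eig A (k + 1) * inner ℝ (b k) (WithLp.toLp 2 x) := by
    rw [← real_inner_smul_left, ← hb]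
    exact (hsymm (b k) (WithLp.toLp 2 x)).symm
  rw [happly, real_inner_comm]
  ring

lemma eig_mul_dotProduct_le_of_inner_eq_zero (hA : A.IsHermitian) (hR : R ≤ n)
    {b : OrthonormalBasis (Fin n) ℝ (EuclideanSpace ℝ (Fin n))}
    (hb : ∀ x : Fin n → ℝ, x ⬝ᵥ A *ᵥ x =
      ∑ k : Fin n, eig A (k + 1) * inner ℝ (b k) (WithLp.toLp 2 x) ^ 2)
    {x : Fin n → ℝ} (hx : ∀ k : Fin n, R ≤ k → inner ℝ (b k) (WithLp.toLp 2 x) = 0) :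
    eig A R * (x ⬝ᵥ x) ≤ x ⬝ᵥ A *ᵥ x := by
  rw [hb, dotProduct_self_eq_norm_sq, ← b.sum_sq_norm_inner_right, Finset.mul_sum]
  refine Finset.sum_le_sum fun k _ => ?_
  rw [Real.norm_eq_abs, sq_abs]
  rcases lt_or_ge (k : ℕ) R with hk | hk
  · exact mul_le_mul_of_nonneg_right (eig_anti hA (by omega) (by omega) hR) (sq_nonneg _)
  · rw [hx k hk]; simp

lemma eig_mul_dotProduct_le (hA : A.IsHermitian) (x : Fin n → ℝ) :
    eig A n * (x ⬝ᵥ x) ≤ x ⬝ᵥ A *ᵥ x := by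
  obtain ⟨b, hb⟩ := exists_eigenbasis hA
  exact eig_mul_dotProduct_le_of_inner_eq_zero hA le_rfl hb fun k hk => absurd k.2 (by omega)

lemma inner_sum_castLE_smul (b : OrthonormalBasis (Fin n) ℝ (EuclideanSpace ℝ (Fin n)))
    (hR : R ≤ n) (a : Fin R → ℝ) (k : Fin n) :
    inner ℝ (b k) (∑ r, a r • b (Fin.castLE hR r)) = if h : (k : ℕ) < R then a ⟨k, h⟩ else 0 := by
  simp_rw [inner_sum, inner_smul_right, b.inner_eq_ite]
  split_ifs with h
  · rw [Finset.sum_eq_single ⟨k, h⟩]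
    · simp
    · intro r _ hr
      rw [if_neg, mul_zero]
      rintro rfl
      exact hr rfl
    · simp
  · refine Finset.sum_eq_zero fun r _ => ?_
    rw [if_neg, mul_zero]
    rintro rfl
    exact h r.2

lemma exists_frame_eig_le (hA : A.IsHermitian) (hR : R ≤ n) :
    ∃ Y : Matrix (Fin n) (Fin R) ℝ, (∀ a, Y *ᵥ a = 0 → a = 0) ∧
      ∀ a, eig A R * (Y *ᵥ a ⬝ᵥ Y *ᵥ a) ≤ Y *ᵥ a ⬝ᵥ A *ᵥ (Y *ᵥ a) := by
  obtain ⟨b, hb⟩ := exists_eigenbasis hA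
  let Y : Matrix (Fin n) (Fin R) ℝ := Matrix.of fun i r => b (Fin.castLE hR r) i
  have hY : ∀ a : Fin R → ℝ, WithLp.toLp 2 (Y *ᵥ a) = ∑ r, a r • b (Fin.castLE hR r) := by
    intro a
    ext i
    simp [Y, mulVec, dotProduct, mul_comm]
  refine ⟨Y, fun a ha => ?_, fun a => ?_⟩
  · ext r
    have := inner_sum_castLE_smul b hR a (Fin.castLE hR r)
    rw [← hY, ha] at this
    simpa using this.symm
  · refine eig_mul_dotProduct_le_of_inner_eq_zero hA hR hb fun k hk => ?_
    rw [hY, inner_sum_castLE_smul, dif_neg (by omega)]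

lemma dotProduct_mulVec_le_eig_of_inner_eq_zero (hA : A.IsHermitian) (h1 : 1 ≤ R)
    {b : OrthonormalBasis (Fin n) ℝ (EuclideanSpace ℝ (Fin n))}
    (hb : ∀ x : Fin n → ℝ, x ⬝ᵥ A *ᵥ x =
      ∑ k : Fin n, eig A (k + 1) * inner ℝ (b k) (WithLp.toLp 2 x) ^ 2)
    {x : Fin n → ℝ} (hx : ∀ k : Fin n, (k : ℕ) < R - 1 → inner ℝ (b k) (WithLp.toLp 2 x) = 0) :
    x ⬝ᵥ A *ᵥ x ≤ eig A R * (x ⬝ᵥ x) := by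
  rw [hb, dotProduct_self_eq_norm_sq, ← b.sum_sq_norm_inner_right, Finset.mul_sum]
  refine Finset.sum_le_sum fun k _ => ?_
  rw [Real.norm_eq_abs, sq_abs]
  rcases lt_or_ge (k : ℕ) (R - 1) with hk | hk
  · rw [hx k hk]; simp
  · exact mul_le_mul_of_nonneg_right (eig_anti hA h1 (by omega) (by omega)) (sq_nonneg _)

-- Courant–Fischer: some nonzero vector of the `R`-dimensional range of `Y` is orthogonal to the
-- first `R - 1` eigenvectors.
lemma le_eig_of_frame (hA : A.IsHermitian) (h1 : 1 ≤ R) (hR : R ≤ n)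
    {Y : Matrix (Fin n) (Fin R) ℝ} (hY : ∀ a, Y *ᵥ a = 0 → a = 0) {m : ℝ}
    (h : ∀ a, m * (Y *ᵥ a ⬝ᵥ Y *ᵥ a) ≤ Y *ᵥ a ⬝ᵥ A *ᵥ (Y *ᵥ a)) : m ≤ eig A R := by
  obtain ⟨b, hb⟩ := exists_eigenbasis hA
  let φ : (Fin R → ℝ) →ₗ[ℝ] (Fin (R - 1) → ℝ) := LinearMap.pi fun k =>
    (innerₛₗ ℝ (b ⟨k, by omega⟩)) ∘ₗ (WithLp.linearEquiv 2 ℝ (Fin n → ℝ)).symm.toLinearMap ∘ₗ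
      Y.mulVecLin
  have hker : LinearMap.ker φ ≠ ⊥ :=
    LinearMap.ker_ne_bot_of_finrank_lt (by simp only [Module.finrank_fin_fun]; omega)
  obtain ⟨a, ha, ha0⟩ := (Submodule.ne_bot_iff _).1 hker
  have hpos : 0 < Y *ᵥ a ⬝ᵥ Y *ᵥ a := (dotProduct_self_nonneg _).lt_of_ne'
    (dotProduct_self_eq_zero.not.2 fun h0 => ha0 (hY a h0))
  refine le_of_mul_le_mul_right ((h a).trans ?_) hpos
  exact dotProduct_mulVec_le_eig_of_inner_eq_zero hA h1 hb fun k hk =>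
    congrFun (LinearMap.mem_ker.1 ha) ⟨k, hk⟩

end Eigenvalues

/-! ### Distances between subspaces -/

section SubspaceDistance

variable {E : Type*} [NormedAddCommGroup E] [InnerProductSpace ℝ E] {K L : Submodule ℝ E}

lemma norm_sub_starProjection_le [L.HasOrthogonalProjection] (x : E) {w : E} (hw : w ∈ L) :
    ‖x - L.starProjection x‖ ≤ ‖x - w‖ := by
  rw [L.starProjection_minimal]
  exact ciInf_le ⟨0, by rintro _ ⟨y, rfl⟩; positivity⟩ (⟨w, hw⟩ : L)

lemma norm_starProjection_sub_starProjection_le_one [K.HasOrthogonalProjection]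
    [L.HasOrthogonalProjection] : ‖K.starProjection - L.starProjection‖ ≤ 1 := by
  -- Half the difference of the reflections in `K` and `L`, which are isometries.
  refine ContinuousLinearMap.opNorm_le_bound _ zero_le_one fun z => ?_
  have hrefl : (2 : ℝ) • (K.starProjection - L.starProjection) z
      = K.reflection z - L.reflection z := by
    rw [K.reflection_apply, L.reflection_apply, FunLike.coe_sub, Pi.sub_apply]
    module
  have hle := norm_sub_le (K.reflection z) (L.reflection z)
  rw [← hrefl, norm_smul, LinearIsometryEquiv.norm_map, LinearIsometryEquiv.norm_map,
    Real.norm_of_nonneg (by norm_num)] at hle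
  linarith

-- The projection `K → L` is injective, hence bijective by dimension count.
lemma exists_mem_starProjection_eq [FiniteDimensional ℝ K] [FiniteDimensional ℝ L]
    (hdim : Module.finrank ℝ L ≤ Module.finrank ℝ K) {δ : ℝ} (hδ : δ < 1)
    (h : ∀ x ∈ K, ‖x - L.starProjection x‖ ≤ δ * ‖x‖) {v : E} (hv : v ∈ L) :
    ∃ x ∈ K, L.starProjection x = v := by
  let f : K →ₗ[ℝ] L := L.orthogonalProjectionOnto.toLinearMap ∘ₗ K.subtype
  have hf : ∀ x : K, ((f x : L) : E) = L.starProjection x := fun x => rfl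
  have hinj : Function.Injective f := by
    rw [injective_iff_map_eq_zero]
    intro x hx
    have hle := h x x.2
    rw [← hf, hx, ZeroMemClass.coe_zero, sub_zero] at hle
    have hx0 : ‖(x : E)‖ = 0 := by nlinarith [norm_nonneg (x : E)]
    exact Subtype.ext (norm_eq_zero.1 hx0)
  have heq : Module.finrank ℝ K = Module.finrank ℝ L :=
    le_antisymm (LinearMap.finrank_le_finrank_of_injective hinj) hdim
  obtain ⟨x, hx⟩ :=
    (LinearMap.injective_iff_surjective_of_finrank_eq_finrank heq).1 hinj ⟨v, hv⟩
  exact ⟨x, x.2, by rw [← hf, hx]⟩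

lemma norm_sub_starProjection_le_of_finrank_le [FiniteDimensional ℝ K] [FiniteDimensional ℝ L]
    (hdim : Module.finrank ℝ L ≤ Module.finrank ℝ K) {δ : ℝ} (hδ0 : 0 ≤ δ) (hδ : δ ≤ 1 / 2)
    (h : ∀ x ∈ K, ‖x - L.starProjection x‖ ≤ δ * ‖x‖) {v : E} (hv : v ∈ L) :
    ‖v - K.starProjection v‖ ≤ 2 * δ * ‖v‖ := by
  obtain ⟨x, hxK, rfl⟩ := exists_mem_starProjection_eq hdim (by linarith) h hv
  set v := L.starProjection x
  have hxv : ‖x‖ ≤ 2 * ‖v‖ := by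
    nlinarith [norm_sub_norm_le x v, h x hxK, norm_nonneg x]
  calc ‖v - K.starProjection v‖ ≤ ‖v - x‖ := norm_sub_starProjection_le v hxK
    _ = ‖x - v‖ := norm_sub_rev _ _
    _ ≤ δ * ‖x‖ := h x hxK
    _ ≤ δ * (2 * ‖v‖) := by gcongr
    _ = _ := by ring

lemma norm_starProjection_sub_starProjection_apply_le [K.HasOrthogonalProjection]
    [L.HasOrthogonalProjection] {c : ℝ} (h : ∀ v ∈ L, ‖v - K.starProjection v‖ ≤ c * ‖v‖)
    (hc : 0 ≤ c) (z : E) : ‖L.starProjection (z - K.starProjection z)‖ ≤ c * ‖z‖ := by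
  set v := L.starProjection (z - K.starProjection z) with hv
  have hadjoint : inner ℝ v v = inner ℝ (v - K.starProjection v) z := by
    have hvv : inner ℝ v v = inner ℝ v (z - K.starProjection z) := by
      rw [hv, L.inner_starProjection_left_eq_right, L.starProjection_eq_self_iff.2
        (L.starProjection_apply_mem _), ← L.inner_starProjection_left_eq_right]
    rw [hvv, inner_sub_right, inner_sub_left, K.inner_starProjection_left_eq_right]
  have hsq : ‖v‖ * ‖v‖ ≤ ‖v‖ * (c * ‖z‖) := by
    calc ‖v‖ * ‖v‖ = inner ℝ (v - K.starProjection v) z := by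
          rw [← hadjoint, real_inner_self_eq_norm_mul_norm]
      _ ≤ ‖v - K.starProjection v‖ * ‖z‖ := real_inner_le_norm _ _
      _ ≤ c * ‖v‖ * ‖z‖ := by gcongr; exact h v (L.starProjection_apply_mem _)
      _ = _ := by ring
  rcases (norm_nonneg v).eq_or_lt with hv0 | hvpos
  · rw [← hv0]; positivity
  · exact le_of_mul_le_mul_left hsq hvpos

lemma norm_starProjection_sub_starProjection_le [FiniteDimensional ℝ K] [FiniteDimensional ℝ L]
    (hdim : Module.finrank ℝ L ≤ Module.finrank ℝ K) {δ : ℝ} (hδ0 : 0 ≤ δ) (hδ : δ ≤ 1 / 2)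
    (h : ∀ x ∈ K, ∃ w ∈ L, ‖x - w‖ ≤ δ * ‖x‖) :
    ‖K.starProjection - L.starProjection‖ ≤ 3 * δ := by
  have hKL : ∀ x ∈ K, ‖x - L.starProjection x‖ ≤ δ * ‖x‖ := fun x hx => by
    obtain ⟨w, hw, hle⟩ := h x hx
    exact (norm_sub_starProjection_le x hw).trans hle
  refine ContinuousLinearMap.opNorm_le_bound _ (by positivity) fun z => ?_
  have hin : ‖K.starProjection z - L.starProjection (K.starProjection z)‖ ≤ δ * ‖z‖ :=
    (hKL _ (K.starProjection_apply_mem z)).trans (by gcongr; exact K.norm_starProjection_apply_le z)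
  have hout : ‖L.starProjection (z - K.starProjection z)‖ ≤ 2 * δ * ‖z‖ :=
    norm_starProjection_sub_starProjection_apply_le
      (fun v hv => norm_sub_starProjection_le_of_finrank_le hdim hδ0 hδ hKL hv) (by positivity) z
  have hsplit : (K.starProjection - L.starProjection) z
      = (K.starProjection z - L.starProjection (K.starProjection z))
        - L.starProjection (z - K.starProjection z) := by
    rw [map_sub, FunLike.coe_sub, Pi.sub_apply]
    abel
  rw [hsplit]
  linarith [norm_sub_le (K.starProjection z - L.starProjection (K.starProjection z))
    (L.starProjection (z - K.starProjection z))]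

variable {n R : ℕ}

lemma finrank_colSpace_le (W : Matrix (Fin n) (Fin R) ℝ) :
    Module.finrank ℝ (colSpace W) ≤ R :=
  (LinearMap.finrank_range_le _).trans_eq finrank_euclideanSpace_fin

lemma finrank_colSpace_eq {W : Matrix (Fin n) (Fin R) ℝ} (hW : ∀ a, W *ᵥ a = 0 → a = 0) :
    Module.finrank ℝ (colSpace W) = R := by
  have hinj : Function.Injective (Matrix.toEuclideanLin W) := by
    rw [injective_iff_map_eq_zero]
    exact fun a ha => WithLp.ofLp_injective 2 (hW a.ofLp (congrArg WithLp.ofLp ha))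
  rw [colSpace, LinearMap.finrank_range_of_inj hinj, finrank_euclideanSpace_fin]

lemma subspaceDist_le {W₁ W₂ : Matrix (Fin n) (Fin R) ℝ} {δ : ℝ} (hδ0 : 0 ≤ δ)
    (hδ : δ ≤ 1 / 2) (hinj : ∀ a, W₁ *ᵥ a = 0 → a = 0)
    (h : ∀ a, ∃ w, ‖WithLp.toLp 2 (W₁ *ᵥ a - W₂ *ᵥ w)‖ ≤ δ * ‖WithLp.toLp 2 (W₁ *ᵥ a)‖) :
    subspaceDist W₁ W₂ ≤ 3 * δ := by
  refine norm_starProjection_sub_starProjection_le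
    ((finrank_colSpace_le W₂).trans_eq (finrank_colSpace_eq hinj).symm) hδ0 hδ ?_
  rintro _ ⟨a, rfl⟩
  obtain ⟨w, hw⟩ := h a.ofLp
  exact ⟨_, ⟨WithLp.toLp 2 w, rfl⟩, hw⟩

lemma subspaceDist_le_one (W₁ W₂ : Matrix (Fin n) (Fin R) ℝ) : subspaceDist W₁ W₂ ≤ 1 :=
  norm_starProjection_sub_starProjection_le_one

end SubspaceDistance

/-! ### The whitened eigenproblem under perturbation -/

open scoped MatrixOrder in
lemma exists_sqrt_inverse_invSqrt {n : ℕ} {G : Matrix (Fin n) (Fin n) ℝ} (hG : G.PosDef) :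
    ∃ Q : Matrix (Fin n) (Fin n) ℝ, Qᵀ = Q ∧ Q * Q = G ∧ invSqrt G * Q = 1 ∧ Q * invSqrt G = 1 ∧
      (invSqrt G)ᵀ = invSqrt G := by
  have hsq : CFC.sqrt G * CFC.sqrt G = G := CFC.sqrt_mul_sqrt_self G hG.posSemidef.nonneg
  have hsymm : (CFC.sqrt G)ᵀ = CFC.sqrt G := by
    have := (CFC.sqrt_nonneg G).isSelfAdjoint
    rwa [IsSelfAdjoint, star_eq_conjTranspose, conjTranspose_eq_transpose_of_trivial] at this
  have hdet : IsUnit (CFC.sqrt G).det := by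
    refine isUnit_of_mul_isUnit_left (y := (CFC.sqrt G).det) ?_
    rw [← det_mul, hsq]
    exact hG.det_pos.ne'.isUnit
  refine ⟨CFC.sqrt G, hsymm, hsq, Matrix.nonsing_inv_mul _ hdet, Matrix.mul_nonsing_inv _ hdet, ?_⟩
  rw [invSqrt, Matrix.transpose_nonsing_inv, hsymm]

section Whitening

variable {n R : ℕ} {G A : Matrix (Fin n) (Fin n) ℝ} {U : Matrix (Fin n) (Fin R) ℝ}

lemma isHermitian_invSqrt_mul_mul_invSqrt (hG : G.PosDef) (hA : A.IsHermitian) :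
    (invSqrt G * A * invSqrt G).IsHermitian := by
  obtain ⟨-, -, -, -, -, hN⟩ := exists_sqrt_inverse_invSqrt hG
  have hAt : Aᵀ = A := by rw [← conjTranspose_eq_transpose_of_trivial]; exact hA
  rw [IsHermitian, conjTranspose_eq_transpose_of_trivial, transpose_mul, transpose_mul, hN, hAt,
    Matrix.mul_assoc]

lemma le_eig_invSqrt_mul_mul_invSqrt (hG : G.PosDef) (hA : A.IsHermitian) (h1 : 1 ≤ R)
    (hR : R ≤ n) {Y : Matrix (Fin n) (Fin R) ℝ} (hY : ∀ a, Y *ᵥ a = 0 → a = 0) {m : ℝ}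
    (h : ∀ a, m * (Y *ᵥ a ⬝ᵥ G *ᵥ (Y *ᵥ a)) ≤ Y *ᵥ a ⬝ᵥ A *ᵥ (Y *ᵥ a)) :
    m ≤ eig (invSqrt G * A * invSqrt G) R := by
  obtain ⟨Q, hQt, hQQ, hNQ, -, hN⟩ := exists_sqrt_inverse_invSqrt hG
  have hcancel : ∀ x, invSqrt G *ᵥ (Q *ᵥ x) = x := fun x => by
    rw [mulVec_mulVec, hNQ, one_mulVec]
  refine le_eig_of_frame (isHermitian_invSqrt_mul_mul_invSqrt hG hA) h1 hR (Y := Q * Y)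
    (fun a ha => hY a ?_) fun a => ?_
  · rw [← hcancel (Y *ᵥ a), mulVec_mulVec a Q Y, ha, mulVec_zero]
  · rw [← mulVec_mulVec]
    set x := Y *ᵥ a
    have hnorm : Q *ᵥ x ⬝ᵥ Q *ᵥ x = x ⬝ᵥ G *ᵥ x := by
      rw [← hQQ, ← mulVec_mulVec, dotProduct_mulVec_eq_transpose Q x, hQt]
    have hquad : Q *ᵥ x ⬝ᵥ (invSqrt G * A * invSqrt G) *ᵥ (Q *ᵥ x) = x ⬝ᵥ A *ᵥ x := by
      rw [← mulVec_mulVec, ← mulVec_mulVec, hcancel, dotProduct_mulVec_eq_transpose (invSqrt G),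
        hN, hcancel]
    rw [hnorm, hquad]
    exact h a

lemma mul_invSqrt_mul_eq_of_isTopEigenframe (hG : G.PosDef)
    (hU : IsTopEigenframe (invSqrt G * A * invSqrt G) U) :
    A * (invSqrt G * U) = G * (invSqrt G * U) *
      Matrix.diagonal fun r : Fin R => eig (invSqrt G * A * invSqrt G) (r + 1) := by
  obtain ⟨Q, -, hQQ, -, hQN, -⟩ := exists_sqrt_inverse_invSqrt hG
  have hGU : G * (invSqrt G * U) = Q * U :=
    calc G * (invSqrt G * U) = Q * Q * (invSqrt G * U) := by rw [hQQ]
      _ = Q * (Q * invSqrt G * U) := by simp only [Matrix.mul_assoc]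
      _ = Q * U := by rw [hQN, Matrix.one_mul]
  calc A * (invSqrt G * U) = Q * invSqrt G * (A * (invSqrt G * U)) := by
        rw [hQN, Matrix.one_mul]
    _ = Q * (invSqrt G * A * invSqrt G * U) := by simp only [Matrix.mul_assoc]
    _ = _ := by rw [hU.2, hGU, Matrix.mul_assoc Q U]

lemma dotProduct_mulVec_invSqrt_mul (hG : G.PosDef) (hU : Uᵀ * U = 1) (a : Fin R → ℝ) :
    (invSqrt G * U) *ᵥ a ⬝ᵥ G *ᵥ ((invSqrt G * U) *ᵥ a) = a ⬝ᵥ a := by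
  obtain ⟨Q, hQt, hQQ, -, hQN, -⟩ := exists_sqrt_inverse_invSqrt hG
  have hQ : Q *ᵥ ((invSqrt G * U) *ᵥ a) = U *ᵥ a := by
    rw [mulVec_mulVec, ← Matrix.mul_assoc, hQN, Matrix.one_mul]
  calc _ = Q *ᵥ ((invSqrt G * U) *ᵥ a) ⬝ᵥ Q *ᵥ ((invSqrt G * U) *ᵥ a) := by
        rw [dotProduct_mulVec_eq_transpose Q, hQt, mulVec_mulVec _ Q Q, hQQ, dotProduct_comm]
    _ = a ⬝ᵥ a := by
        rw [hQ, dotProduct_mulVec_eq_transpose, mulVec_mulVec, hU, one_mulVec]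

-- The shifted generalized eigenproblem `A - s G` is inverted on the span of the eigenvectors.
lemma exists_mulVec_eq_of_eigengap (hG : G.PosDef)
    (hU : IsTopEigenframe (invSqrt G * A * invSqrt G) U) {s d : ℝ} (hd : 0 < d)
    (hgap : ∀ r : Fin R, d ≤ eig (invSqrt G * A * invSqrt G) (r + 1) - s) (a : Fin R → ℝ) :
    ∃ b : Fin R → ℝ, b ⬝ᵥ b ≤ d⁻¹ ^ 2 * (a ⬝ᵥ a) ∧
      A *ᵥ ((invSqrt G * U) *ᵥ b)
        = s • G *ᵥ ((invSqrt G * U) *ᵥ b) + G *ᵥ ((invSqrt G * U) *ᵥ a) := by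
  set ev : Fin R → ℝ := fun r => eig (invSqrt G * A * invSqrt G) (r + 1)
  have hgap0 : ∀ r, 0 < ev r - s := fun r => hd.trans_le (hgap r)
  refine ⟨fun r => (ev r - s)⁻¹ * a r, ?_, ?_⟩
  · rw [dotProduct, dotProduct, Finset.mul_sum]
    refine Finset.sum_le_sum fun r _ => ?_
    have hinv : (ev r - s)⁻¹ ≤ d⁻¹ := inv_anti₀ hd (hgap r)
    calc (ev r - s)⁻¹ * a r * ((ev r - s)⁻¹ * a r) = (ev r - s)⁻¹ ^ 2 * (a r * a r) := by ring
      _ ≤ d⁻¹ ^ 2 * (a r * a r) := by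
        have := mul_self_nonneg (a r)
        have := inv_nonneg.2 (hgap0 r).le
        gcongr
  · rw [mulVec_mulVec, mul_invSqrt_mul_eq_of_isTopEigenframe hG hU, ← mulVec_mulVec,
      ← mulVec_mulVec, ← mulVec_smul, ← mulVec_smul, ← mulVec_add, ← mulVec_add]
    congr 2
    ext r
    have := (hgap0 r).ne'
    rw [mulVec_diagonal, Pi.add_apply, Pi.smul_apply, smul_eq_mul]
    change ev r * _ = _
    field_simp
    ring

lemma dotProduct_self_invSqrt_mul_le (hG : G.PosDef) (hU : Uᵀ * U = 1) {m M ρ : ℝ} (hm : 0 < m)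
    (hρ : 0 ≤ ρ) (hlow : ∀ x, m * (x ⬝ᵥ x) ≤ x ⬝ᵥ G *ᵥ x)
    (hupp : ∀ x, x ⬝ᵥ G *ᵥ x ≤ M * (x ⬝ᵥ x)) {a b : Fin R → ℝ} (hab : b ⬝ᵥ b ≤ ρ * (a ⬝ᵥ a)) :
    (invSqrt G * U) *ᵥ b ⬝ᵥ (invSqrt G * U) *ᵥ b
      ≤ M / m * ρ * ((invSqrt G * U) *ᵥ a ⬝ᵥ (invSqrt G * U) *ᵥ a) := by
  have hb := hlow ((invSqrt G * U) *ᵥ b)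
  have ha := hupp ((invSqrt G * U) *ᵥ a)
  rw [dotProduct_mulVec_invSqrt_mul hG hU] at ha hb
  refine le_of_mul_le_mul_left (hb.trans (hab.trans ?_)) hm
  calc ρ * (a ⬝ᵥ a) ≤ ρ * (M * ((invSqrt G * U) *ᵥ a ⬝ᵥ (invSqrt G * U) *ᵥ a)) := by gcongr
    _ = _ := by field_simp

end Whitening

section Perturbation

variable {n R : ℕ} {Γ Γh Ah : Matrix (Fin n) (Fin n) ℝ} {W U Y : Matrix (Fin n) (Fin R) ℝ}
  {K : Matrix (Fin R) (Fin n) ℝ} {l g ρ c h t : ℝ}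

lemma half_mul_dotProduct_le (hlΓ : ∀ x, l * (x ⬝ᵥ x) ≤ x ⬝ᵥ Γ *ᵥ x)
    (hρ : specNorm (Γh - Γ) ≤ l / 2) (x : Fin n → ℝ) :
    l / 2 * (x ⬝ᵥ x) ≤ x ⬝ᵥ Γh *ᵥ x := by
  have hdev := (abs_le.1 (abs_dotProduct_mulVec_sub_le Γh Γ x)).1
  linarith [hlΓ x, mul_le_mul_of_nonneg_right hρ (dotProduct_self_nonneg x)]

lemma dotProduct_le_three_halves_mul (hgΓ : ∀ x, x ⬝ᵥ Γ *ᵥ x ≤ g * (x ⬝ᵥ x))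
    (hρ : specNorm (Γh - Γ) ≤ g / 2) (x : Fin n → ℝ) :
    x ⬝ᵥ Γh *ᵥ x ≤ 3 / 2 * g * (x ⬝ᵥ x) := by
  have hdev := (abs_le.1 (abs_dotProduct_mulVec_sub_le Γh Γ x)).2
  linarith [hgΓ x, mul_le_mul_of_nonneg_right hρ (dotProduct_self_nonneg x)]

lemma specNorm_sub_smul_sub_le (hc : 0 ≤ c) (hρ : specNorm (Γh - Γ) ≤ ρ)
    {H : Matrix (Fin n) (Fin n) ℝ} (hE : specNorm (Ah - c • Γ - H) ≤ t) :
    specNorm (Ah - c • Γh - H) ≤ t + c * ρ := by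
  have hsplit : Ah - c • Γh - H = (Ah - c • Γ - H) - c • (Γh - Γ) := by rw [smul_sub]; abel
  rw [hsplit]
  refine (specNorm_sub_le _ _).trans ?_
  rw [specNorm_smul, abs_of_nonneg hc]
  gcongr

lemma eigengap_of_perturbation (h1R : 1 ≤ R) (hRn : R ≤ n) (hΓh : Γh.PosDef) (hg : 0 < g)
    (hupp : ∀ x, x ⬝ᵥ Γh *ᵥ x ≤ 3 / 2 * g * (x ⬝ᵥ x)) (hAh : Ah.IsHermitian)
    {H : Matrix (Fin n) (Fin n) ℝ} (hE : specNorm (Ah - c • Γh - H) ≤ h / 2)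
    (hY : ∀ a, Y *ᵥ a = 0 → a = 0)
    (hYH : ∀ a, h * (Y *ᵥ a ⬝ᵥ Y *ᵥ a) ≤ Y *ᵥ a ⬝ᵥ H *ᵥ (Y *ᵥ a)) (hh : 0 < h) (r : Fin R) :
    h / (3 * g) ≤ eig (invSqrt Γh * Ah * invSqrt Γh) (r + 1) - c := by
  have hlast : c + h / (3 * g) ≤ eig (invSqrt Γh * Ah * invSqrt Γh) R := by
    refine le_eig_invSqrt_mul_mul_invSqrt hΓh hAh h1R hRn hY fun a => ?_
    set x := Y *ᵥ a
    have hsplit : x ⬝ᵥ Ah *ᵥ x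
        = c * (x ⬝ᵥ Γh *ᵥ x) + x ⬝ᵥ H *ᵥ x + x ⬝ᵥ (Ah - c • Γh - H) *ᵥ x := by
      simp only [sub_mulVec, smul_mulVec, dotProduct_sub, dotProduct_smul, smul_eq_mul]; ring
    have herr := (abs_le.1 (abs_dotProduct_mulVec_self_le (Ah - c • Γh - H) x)).1
    have herr' := mul_le_mul_of_nonneg_right hE (dotProduct_self_nonneg x)
    have hgap : h / (3 * g) * (x ⬝ᵥ Γh *ᵥ x) ≤ h / 2 * (x ⬝ᵥ x) := by
      refine (mul_le_mul_of_nonneg_left (hupp x) (by positivity)).trans_eq ?_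
      field_simp
    linarith [hYH a]
  have hanti := eig_anti (isHermitian_invSqrt_mul_mul_invSqrt hΓh hAh) (r := r + 1) (R := R)
    (by omega) (by omega) hRn
  linarith

-- If `z` solves `(Ah - c Γh) z = Γh x`, then `x` is `W (K z)` up to `Γ⁻¹` of small terms.
lemma mul_norm_sub_le_of_mulVec_eq (hlΓ : ∀ x, l * (x ⬝ᵥ x) ≤ x ⬝ᵥ Γ *ᵥ x)
    (hρ : specNorm (Γh - Γ) ≤ ρ) (hE : specNorm (Ah - c • Γh - Γ * W * K) ≤ t)
    {x z : Fin n → ℝ} (hz : Ah *ᵥ z = c • Γh *ᵥ z + Γh *ᵥ x) :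
    l * ‖WithLp.toLp 2 (x - W *ᵥ (K *ᵥ z))‖
      ≤ t * ‖WithLp.toLp 2 z‖ + ρ * ‖WithLp.toLp 2 x‖ := by
  have hΓ : Γ *ᵥ (x - W *ᵥ (K *ᵥ z)) = (Ah - c • Γh - Γ * W * K) *ᵥ z - (Γh - Γ) *ᵥ x := by
    simp only [mulVec_sub, sub_mulVec, smul_mulVec, hz, mulVec_mulVec, Matrix.mul_assoc]
    abel
  refine (mul_norm_le_norm_mulVec hlΓ _).trans ?_
  rw [hΓ, WithLp.toLp_sub]
  refine (norm_sub_le _ _).trans (add_le_add ?_ ?_)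
  · exact (norm_mulVec_le _ _).trans (by gcongr)
  · exact (norm_mulVec_le _ _).trans (by gcongr)

lemma exists_norm_sub_mulVec_le (h1R : 1 ≤ R) (hRn : R ≤ n) (hl : 0 < l) (hlg : l ≤ g)
    (hlΓ : ∀ x, l * (x ⬝ᵥ x) ≤ x ⬝ᵥ Γ *ᵥ x) (hgΓ : ∀ x, x ⬝ᵥ Γ *ᵥ x ≤ g * (x ⬝ᵥ x))
    (hΓh : Γh.PosDef) (hρ : specNorm (Γh - Γ) ≤ ρ) (hρl : ρ ≤ l / 2) (hAh : Ah.IsHermitian)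
    (hE : specNorm (Ah - c • Γh - Γ * W * K) ≤ t) (hY : ∀ a, Y *ᵥ a = 0 → a = 0)
    (hYH : ∀ a, h * (Y *ᵥ a ⬝ᵥ Y *ᵥ a) ≤ Y *ᵥ a ⬝ᵥ (Γ * W * K) *ᵥ (Y *ᵥ a))
    (hh : 0 < h) (hth : 2 * t ≤ h) (hU : IsTopEigenframe (invSqrt Γh * Ah * invSqrt Γh) U)
    (a : Fin R → ℝ) :
    ∃ w, ‖WithLp.toLp 2 ((invSqrt Γh * U) *ᵥ a - W *ᵥ w)‖
      ≤ (6 * (g / l) ^ 2 * (t / h) + ρ / l) * ‖WithLp.toLp 2 ((invSqrt Γh * U) *ᵥ a)‖ := by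
  have hg := hl.trans_le hlg
  have ht : 0 ≤ t := (specNorm_nonneg _).trans hE
  have hlow := half_mul_dotProduct_le hlΓ (hρ.trans hρl)
  have hupp := dotProduct_le_three_halves_mul hgΓ (hρ.trans (hρl.trans (by linarith)))
  obtain ⟨b, hb, heq⟩ := exists_mulVec_eq_of_eigengap hΓh hU (by positivity)
    (eigengap_of_perturbation h1R hRn hΓh hg hupp hAh (hE.trans (by linarith)) hY hYH hh) a
  have hclose := mul_norm_sub_le_of_mulVec_eq hlΓ hρ hE heq
  set x := (invSqrt Γh * U) *ᵥ a
  set z := (invSqrt Γh * U) *ᵥ b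
  have hz : ‖WithLp.toLp 2 z‖ ≤ 6 * (g / l) * (g / h) * ‖WithLp.toLp 2 x‖ := by
    refine le_of_sq_le_sq ?_ (by positivity)
    rw [mul_pow, ← dotProduct_self_eq_norm_sq, ← dotProduct_self_eq_norm_sq]
    refine (dotProduct_self_invSqrt_mul_le hΓh hU.1 (by positivity) (by positivity) hlow hupp
      hb).trans (mul_le_mul_of_nonneg_right ?_ (dotProduct_self_nonneg x))
    have hκ : 1 ≤ g / l := (one_le_div hl).2 hlg
    calc 3 / 2 * g / (l / 2) * (h / (3 * g))⁻¹ ^ 2 = 27 * (g / l) * (g / h) ^ 2 := by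
          field_simp
          norm_num
      _ ≤ 36 * (g / l) ^ 2 * (g / h) ^ 2 := by gcongr ?_ * _; nlinarith
      _ = _ := by ring
  refine ⟨K *ᵥ z, le_of_mul_le_mul_left (hclose.trans ?_) hl⟩
  calc _ ≤ t * (6 * (g / l) * (g / h) * ‖WithLp.toLp 2 x‖) + ρ * ‖WithLp.toLp 2 x‖ := by gcongr
    _ = _ := by field_simp

lemma subspaceDist_invSqrt_mul_le (h1R : 1 ≤ R) (hRn : R ≤ n) (hl : 0 < l) (hlg : l ≤ g)
    (hlΓ : ∀ x, l * (x ⬝ᵥ x) ≤ x ⬝ᵥ Γ *ᵥ x) (hgΓ : ∀ x, x ⬝ᵥ Γ *ᵥ x ≤ g * (x ⬝ᵥ x))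
    (hΓh : Γh.IsHermitian) (hρ : specNorm (Γh - Γ) ≤ ρ) (hρl : ρ ≤ l / 2) (hAh : Ah.IsHermitian)
    (hc : 0 ≤ c) (hE : specNorm (Ah - c • Γ - Γ * W * K) ≤ t) (hY : ∀ a, Y *ᵥ a = 0 → a = 0)
    (hYH : ∀ a, h * (Y *ᵥ a ⬝ᵥ Y *ᵥ a) ≤ Y *ᵥ a ⬝ᵥ (Γ * W * K) *ᵥ (Y *ᵥ a))
    (hh : 0 < h) (hth : 2 * (t + c * ρ) ≤ h)
    (hU : IsTopEigenframe (invSqrt Γh * Ah * invSqrt Γh) U)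
    (hδ : 6 * (g / l) ^ 2 * ((t + c * ρ) / h) + ρ / l ≤ 1 / 2) :
    subspaceDist (invSqrt Γh * U) W ≤ 3 * (6 * (g / l) ^ 2 * ((t + c * ρ) / h) + ρ / l) := by
  have hpd : Γh.PosDef := posDef_of_mul_dotProduct_le hΓh (by positivity)
    (half_mul_dotProduct_le hlΓ (hρ.trans hρl))
  have hρ0 := (specNorm_nonneg _).trans hρ
  have ht0 := (specNorm_nonneg _).trans hE
  refine subspaceDist_le (by positivity) hδ (fun a ha => ?_)
    (exists_norm_sub_mulVec_le h1R hRn hl hlg hlΓ hgΓ hpd hρ hρl hAh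
      (specNorm_sub_smul_sub_le hc hρ hE) hY hYH hh hth hU)
  have hnorm := dotProduct_mulVec_invSqrt_mul hpd hU.1 a
  rw [ha, zero_dotProduct] at hnorm
  exact dotProduct_self_eq_zero.1 hnorm.symm

end Perturbation

/-! ### Linear forms in independent Gaussian vectors -/

section LinearForms

variable {Ω J κ : Type*} [Fintype κ]

/-- The quadratic form `cᵀ S c`: the variance of the response `c ⬝ᵥ v` to a Gaussian vector `v` with
covariance matrix `S`. -/
def respVar (S : Matrix κ κ ℝ) (c : κ → ℝ) : ℝ := c ⬝ᵥ S *ᵥ c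

lemma respVar_nonneg {S : Matrix κ κ ℝ} (hS : S.PosSemidef) (c : κ → ℝ) : 0 ≤ respVar S c :=
  hS.dotProduct_mulVec_nonneg c

lemma respVar_smul (S : Matrix κ κ ℝ) (a : ℝ) (c : κ → ℝ) :
    respVar S (a • c) = a ^ 2 * respVar S c := by
  simp only [respVar, mulVec_smul, smul_dotProduct, dotProduct_smul, smul_eq_mul]; ring

lemma respVar_zero (S : Matrix κ κ ℝ) : respVar S 0 = 0 := by simp [respVar]

/-- The linear form `∑ j, a j ⬝ᵥ v j` in the random vectors `v j`. -/
def linearForm [Fintype J] (v : J → Ω → EuclideanSpace ℝ κ) (a : J → κ → ℝ) (ω : Ω) : ℝ :=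
  ∑ j, a j ⬝ᵥ (v j ω).ofLp

/-- `linearForm` as a continuous linear map in the vectors, through which Gaussianity is
transported. -/
noncomputable def linearFormCLM [Fintype J] (a : J → κ → ℝ) : (J → EuclideanSpace ℝ κ) →L[ℝ] ℝ :=
  ∑ j, (innerSL ℝ (WithLp.toLp 2 (a j))) ∘L
    ContinuousLinearMap.proj (R := ℝ) (φ := fun _ : J => EuclideanSpace ℝ κ) j

lemma innerSL_toLp_apply (a : κ → ℝ) (v : EuclideanSpace ℝ κ) :
    innerSL ℝ (WithLp.toLp 2 a) v = a ⬝ᵥ v.ofLp := by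
  simp [PiLp.inner_apply, dotProduct, mul_comm]

lemma linearFormCLM_apply [Fintype J] (v : J → Ω → EuclideanSpace ℝ κ) (a : J → κ → ℝ) (ω : Ω) :
    linearFormCLM a (fun j => v j ω) = linearForm v a ω := by
  simp only [linearFormCLM, linearForm, FunLike.coe_sum, Finset.sum_apply,
    ContinuousLinearMap.comp_apply, ContinuousLinearMap.proj_apply, innerSL_toLp_apply]

lemma linearForm_single [Fintype J] [DecidableEq J] (v : J → Ω → EuclideanSpace ℝ κ) (j : J)
    (a : κ → ℝ) (ω : Ω) : linearForm v (Pi.single j a) ω = a ⬝ᵥ (v j ω).ofLp := by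
  rw [linearForm, Fintype.sum_eq_single j fun k hk => by simp [Pi.single_eq_of_ne hk]]
  simp

lemma sum_mul_linearForm [Fintype J] {π : Type*} [Fintype π] (v : J → Ω → EuclideanSpace ℝ κ)
    (w : π → ℝ) (a : π → J → κ → ℝ) (ω : Ω) :
    ∑ p, w p * linearForm v (a p) ω = linearForm v (fun j => ∑ p, w p • a p j) ω := by
  simp_rw [linearForm, sum_dotProduct, smul_dotProduct, smul_eq_mul, Finset.mul_sum]
  exact Finset.sum_comm

variable [MeasurableSpace Ω] {μ : Measure Ω} [DecidableEq κ]

section SingleVector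

variable {v : Ω → EuclideanSpace ℝ κ} {S : Matrix κ κ ℝ}

lemma hasGaussianLaw_dotProduct (hv : HasLaw v (multivariateGaussian 0 S) μ) (a : κ → ℝ) :
    HasGaussianLaw (fun ω => a ⬝ᵥ (v ω).ofLp) μ := by
  simpa only [innerSL_toLp_apply] using hv.hasGaussianLaw.map_fun (innerSL ℝ (WithLp.toLp 2 a))

lemma integral_dotProduct (hv : HasLaw v (multivariateGaussian 0 S) μ) (a : κ → ℝ) :
    ∫ ω, a ⬝ᵥ (v ω).ofLp ∂μ = 0 := by
  simp_rw [← innerSL_toLp_apply]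
  rw [ContinuousLinearMap.integral_comp_comm _ hv.hasGaussianLaw.integrable, hv.integral_eq]
  simp

lemma covariance_dotProduct (hv : HasLaw v (multivariateGaussian 0 S) μ) (hS : S.PosSemidef)
    (a b : κ → ℝ) :
    cov[fun ω => a ⬝ᵥ (v ω).ofLp, fun ω => b ⬝ᵥ (v ω).ofLp; μ] = a ⬝ᵥ S *ᵥ b := by
  have h := hv.covariance_fun_comp
    (f := fun v => inner ℝ (WithLp.toLp 2 a : EuclideanSpace ℝ κ) v)
    (g := fun v => inner ℝ (WithLp.toLp 2 b : EuclideanSpace ℝ κ) v) (by fun_prop) (by fun_prop)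
  rw [← covarianceBilin_apply_eq_cov IsGaussian.memLp_two_id,
    covarianceBilin_multivariateGaussian hS] at h
  simpa only [← innerSL_apply_apply, innerSL_toLp_apply] using h

lemma dotProduct_ae_eq_zero (hv : HasLaw v (multivariateGaussian 0 S) μ) (hS : S.PosSemidef)
    {c : κ → ℝ} (hc : respVar S c = 0) : ∀ᵐ ω ∂μ, c ⬝ᵥ (v ω).ofLp = 0 := by
  have := hv.isProbabilityMeasure
  have hL := (hasGaussianLaw_dotProduct hv c).memLp_two
  have hvar := covariance_dotProduct hv hS c c
  rw [covariance_self hL.1.aemeasurable] at hvar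
  filter_upwards [ae_eq_integral_of_variance_eq_zero hL (hvar.trans hc)] with ω hω
  rw [hω, integral_dotProduct hv c]

end SingleVector

variable [Fintype J] {v : J → Ω → EuclideanSpace ℝ κ} {S : J → Matrix κ κ ℝ}

lemma hasGaussianLaw_linearForm (hv : ∀ j, HasLaw (v j) (multivariateGaussian 0 (S j)) μ)
    (hi : iIndepFun v μ) {K : Type*} [Finite K] (a : K → J → κ → ℝ) :
    HasGaussianLaw (fun ω k => linearForm v (a k) ω) μ := by
  have := Fintype.ofFinite K
  simpa only [ContinuousLinearMap.coe_pi', linearFormCLM_apply] using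
    (hi.hasGaussianLaw fun j => (hv j).hasGaussianLaw).map_fun
      (ContinuousLinearMap.pi fun k => linearFormCLM (a k))

lemma integral_linearForm (hv : ∀ j, HasLaw (v j) (multivariateGaussian 0 (S j)) μ)
    (a : J → κ → ℝ) : ∫ ω, linearForm v a ω ∂μ = 0 := by
  simp only [linearForm]
  rw [integral_finsetSum _ fun j _ => (hasGaussianLaw_dotProduct (hv j) (a j)).integrable]
  exact Finset.sum_eq_zero fun j _ => integral_dotProduct (hv j) (a j)

lemma covariance_linearForm (hv : ∀ j, HasLaw (v j) (multivariateGaussian 0 (S j)) μ)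
    (hS : ∀ j, (S j).PosSemidef) (hi : iIndepFun v μ) (a b : J → κ → ℝ) :
    cov[linearForm v a, linearForm v b; μ] = ∑ j, a j ⬝ᵥ S j *ᵥ b j := by
  have := hi.isProbabilityMeasure
  have hL : ∀ j (c : κ → ℝ), MemLp (fun ω => c ⬝ᵥ (v j ω).ofLp) 2 μ := fun j c =>
    (hasGaussianLaw_dotProduct (hv j) c).memLp_two
  refine (covariance_fun_sum_fun_sum (fun j => hL j (a j)) (fun j => hL j (b j))).trans
    (Finset.sum_congr rfl fun j _ => ?_)
  rw [Fintype.sum_eq_single j, covariance_dotProduct (hv j) (hS j)]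
  intro k hk
  have hindep := (hi.indepFun hk.symm).comp (φ := fun u => a j ⬝ᵥ u.ofLp)
    (ψ := fun u => b k ⬝ᵥ u.ofLp) (by simp only [dotProduct]; fun_prop)
    (by simp only [dotProduct]; fun_prop)
  exact hindep.covariance_eq_zero (hL j _) (hL k _)

lemma variance_linearForm (hv : ∀ j, HasLaw (v j) (multivariateGaussian 0 (S j)) μ)
    (hS : ∀ j, (S j).PosSemidef) (hi : iIndepFun v μ) (a : J → κ → ℝ) :
    Var[linearForm v a; μ] = ∑ j, respVar (S j) (a j) := by
  have hm : AEMeasurable (linearForm v a) μ :=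
    ((hasGaussianLaw_linearForm hv hi fun _ : Unit => a).eval ()).aemeasurable
  rw [← covariance_self hm, covariance_linearForm hv hS hi]
  rfl

lemma measure_abs_linearForm_quadratic_ge_le {K π : Type*} [Fintype K] [Fintype π]
    (hv : ∀ j, HasLaw (v j) (multivariateGaussian 0 (S j)) μ)
    (hS : ∀ j, (S j).PosSemidef) (hi : iIndepFun v μ) {a : K → π → J → κ → ℝ}
    (ha : ∀ k l, k ≠ l → ∀ p q j, a k p j = 0 ∨ a l q j = 0) {τ : K → ℝ}
    (hτ : ∀ k (w : π → ℝ), ∑ j, respVar (S j) (∑ p, w p • a k p j) ≤ τ k * ∑ p, w p ^ 2)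
    (m : K → π → ℝ) {b Q x t : ℝ} (hb : 0 < b) (hτb : ∀ k, 4 * τ k ≤ b)
    (hQ : ∑ k, (2 * Fintype.card π * τ k ^ 2 + 4 * τ k * ∑ p, m k p ^ 2) ≤ Q)
    (ht : 0 ≤ t) (hQx : 4 * Q * x ≤ t ^ 2) (hbx : 2 * b * x ≤ t) :
    μ {ω | t ≤ |∑ k, ∑ p, (linearForm v (a k p) ω ^ 2 + 2 * m k p * linearForm v (a k p) ω
        - ∑ j, respVar (S j) (a k p j))|} ≤ 2 * ENNReal.ofReal (Real.exp (-x)) := by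
  have hcov : ∀ k l, k ≠ l → ∀ p q, cov[linearForm v (a k p), linearForm v (a l q); μ] = 0 := by
    intro k l hkl p q
    rw [covariance_linearForm hv hS hi]
    exact Finset.sum_eq_zero fun j _ => by rcases ha k l hkl p q j with h | h <;> simp [h]
  have hvar : ∀ k (w : π → ℝ),
      Var[fun ω => ∑ p, w p * linearForm v (a k p) ω; μ] ≤ τ k * ∑ p, w p ^ 2 := fun k w => by
    simp_rw [sum_mul_linearForm]
    exact (variance_linearForm hv hS hi _).trans_le (hτ k w)
  simpa only [variance_linearForm hv hS hi] using
    measure_abs_block_quadratic_ge_le (Y := fun k p => linearForm v (a k p))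
      (hasGaussianLaw_linearForm hv hi fun x : K × π => a x.1 x.2)
      (fun k p => integral_linearForm hv _) hcov hvar m hb hτb hQ ht hQx hbx

lemma measure_abs_quadratic_ge_le {π : Type*} [Fintype π]
    (hv : ∀ j, HasLaw (v j) (multivariateGaussian 0 (S j)) μ)
    (hS : ∀ j, (S j).PosSemidef) (hi : iIndepFun v μ) (f : J → π → κ → ℝ) {τ : J → ℝ}
    (hτ : ∀ j (w : π → ℝ), respVar (S j) (∑ p, w p • f j p) ≤ τ j * ∑ p, w p ^ 2)
    {b Q x t : ℝ} (hb : 0 < b) (hτb : ∀ j, 4 * τ j ≤ b)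
    (hQ : ∑ j, 2 * Fintype.card π * τ j ^ 2 ≤ Q) (ht : 0 ≤ t) (hQx : 4 * Q * x ≤ t ^ 2)
    (hbx : 2 * b * x ≤ t) :
    μ {ω | t ≤ |∑ j, ∑ p, ((f j p ⬝ᵥ (v j ω).ofLp) ^ 2 - respVar (S j) (f j p))|}
      ≤ 2 * ENNReal.ofReal (Real.exp (-x)) := by
  classical
  have hblock : ∀ j (g : κ → ℝ), ∑ k, respVar (S k) (Pi.single (M := fun _ => κ → ℝ) j g k)
      = respVar (S j) g := fun j g => by
    rw [Fintype.sum_eq_single j fun k hk => by simp [Pi.single_eq_of_ne hk, respVar_zero]]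
    simp
  have hsingle : ∀ j (w : π → ℝ) k, ∑ p, w p • Pi.single (M := fun _ => κ → ℝ) j (f j p) k
      = Pi.single (M := fun _ => κ → ℝ) j (∑ p, w p • f j p) k := fun j w k => by
    rcases eq_or_ne k j with rfl | hk
    · simp
    · simp [Pi.single_eq_of_ne hk]
  have key := measure_abs_linearForm_quadratic_ge_le hv hS hi
    (a := fun j p => Pi.single j (f j p)) (fun k l hkl p q j => by
      rcases eq_or_ne j k with rfl | hjk
      · exact Or.inr (Pi.single_eq_of_ne hkl _)
      · exact Or.inl (Pi.single_eq_of_ne hjk _))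
    (τ := τ) (fun j w => by simp_rw [hsingle, hblock]; exact hτ j w) (fun _ _ => 0) hb hτb
    (by simpa using hQ) ht hQx hbx
  simpa only [linearForm_single, hblock, mul_zero, zero_mul, add_zero] using key

lemma measure_abs_sum_sq_response_ge_le
    (hv : ∀ j, HasLaw (v j) (multivariateGaussian 0 (S j)) μ)
    (hS : ∀ j, (S j).PosSemidef) (hi : iIndepFun v μ) (c : J → κ → ℝ) {β : J → ℝ}
    (hβ : ∀ j, 0 ≤ β j) {b Q x t : ℝ} (hb : 0 < b)
    (hβb : ∀ j, 4 * (β j * respVar (S j) (c j)) ≤ b)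
    (hQ : ∑ j, 2 * (β j * respVar (S j) (c j)) ^ 2 ≤ Q) (ht : 0 ≤ t) (hQx : 4 * Q * x ≤ t ^ 2)
    (hbx : 2 * b * x ≤ t) :
    μ {ω | t ≤ |∑ j, β j * ((c j ⬝ᵥ (v j ω).ofLp) ^ 2 - respVar (S j) (c j))|}
      ≤ 2 * ENNReal.ofReal (Real.exp (-x)) := by
  have key := measure_abs_quadratic_ge_le (π := Unit) hv hS hi (fun j _ => √(β j) • c j)
    (τ := fun j => β j * respVar (S j) (c j)) (fun j w => by
      simp [respVar_smul, Real.sq_sqrt (hβ j), mul_comm])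
    hb hβb (by simpa using hQ) ht hQx hbx
  simpa [respVar_smul, smul_dotProduct, mul_pow, Real.sq_sqrt, hβ, mul_sub] using key

end LinearForms

/-! ### Regression of Gaussian vectors on their responses -/

section Regression

variable {Ω ι τ κ π : Type*} [Fintype κ]

/-- The coefficient vector `S c / (cᵀ S c)` of the regression of a Gaussian vector with covariance
matrix `S` on its response to `c`; it is `0` when the response has variance `0`. -/
noncomputable def regCoef (S : Matrix κ κ ℝ) (c : κ → ℝ) : κ → ℝ := (respVar S c)⁻¹ • (S *ᵥ c)

/-- The residual of the regression of `v` on its response `c ⬝ᵥ v`. -/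
noncomputable def residual (S : Matrix κ κ ℝ) (c v : κ → ℝ) : κ → ℝ :=
  v - (c ⬝ᵥ v) • regCoef S c

/-- The transpose of `residual S c`: the linear form `f` applied to the residual, as a linear form
in the original vector. -/
noncomputable def residualForm (S : Matrix κ κ ℝ) (c f : κ → ℝ) : κ → ℝ :=
  f - (f ⬝ᵥ regCoef S c) • c

lemma dotProduct_residual (S : Matrix κ κ ℝ) (c f v : κ → ℝ) :
    f ⬝ᵥ residual S c v = residualForm S c f ⬝ᵥ v := by
  rw [residual, residualForm, dotProduct_sub, dotProduct_smul, sub_dotProduct, smul_dotProduct]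
  simp only [smul_eq_mul]; ring

lemma sum_smul_residualForm [Fintype π] (S : Matrix κ κ ℝ) (c : κ → ℝ) (w : π → ℝ)
    (f : π → κ → ℝ) :
    ∑ p, w p • residualForm S c (f p) = residualForm S c (∑ p, w p • f p) := by
  simp only [residualForm, smul_sub, Finset.sum_sub_distrib, sum_dotProduct, smul_dotProduct,
    Finset.sum_smul, smul_smul, smul_eq_mul]

lemma respVar_smul_regCoef {S : Matrix κ κ ℝ} (hS : S.PosSemidef) (c : κ → ℝ) :
    respVar S c • regCoef S c = S *ᵥ c := by
  classical
  by_cases h : respVar S c = 0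
  · rw [h, (hS.dotProduct_mulVec_zero_iff c).1 h, zero_smul]
  · rw [regCoef, smul_smul, mul_inv_cancel₀ h, one_smul]

lemma dotProduct_mulVec_eq_respVar_mul {S : Matrix κ κ ℝ} (hS : S.PosSemidef) (c f : κ → ℝ) :
    f ⬝ᵥ S *ᵥ c = respVar S c * (f ⬝ᵥ regCoef S c) := by
  rw [← respVar_smul_regCoef hS, dotProduct_smul, smul_eq_mul]

lemma dotProduct_mulVec_comm_of_isHermitian {S : Matrix κ κ ℝ} (hS : S.IsHermitian)
    (a b : κ → ℝ) : a ⬝ᵥ S *ᵥ b = b ⬝ᵥ S *ᵥ a := by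
  have h : Sᵀ = S := by rw [← conjTranspose_eq_transpose_of_trivial]; exact hS
  rw [dotProduct_mulVec, ← mulVec_transpose, h, dotProduct_comm]

lemma dotProduct_mulVec_residualForm {S : Matrix κ κ ℝ} (hS : S.PosSemidef) (c f : κ → ℝ) :
    c ⬝ᵥ S *ᵥ residualForm S c f = 0 := by
  rw [dotProduct_mulVec_comm_of_isHermitian hS.1, residualForm, sub_dotProduct, smul_dotProduct,
    dotProduct_mulVec_eq_respVar_mul hS, smul_eq_mul, ← respVar]
  ring

lemma respVar_residualForm {S : Matrix κ κ ℝ} (hS : S.PosSemidef) (c f : κ → ℝ) :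
    respVar S (residualForm S c f) = respVar S f - respVar S c * (f ⬝ᵥ regCoef S c) ^ 2 := by
  have horth := dotProduct_mulVec_residualForm hS c f
  have hcross := dotProduct_mulVec_eq_respVar_mul hS c f
  rw [respVar, residualForm, sub_dotProduct, smul_dotProduct, ← residualForm, horth, residualForm,
    mulVec_sub, mulVec_smul, dotProduct_sub, dotProduct_smul, hcross, ← respVar]
  simp only [smul_eq_mul]; ring

lemma respVar_residualForm_le {S : Matrix κ κ ℝ} (hS : S.PosSemidef) (c f : κ → ℝ) :
    respVar S (residualForm S c f) ≤ respVar S f := by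
  rw [respVar_residualForm hS]
  exact sub_le_self _ (mul_nonneg (respVar_nonneg hS c) (sq_nonneg _))

/-- The deviation of the quadratic form `∑ i, ∑ p, (f p ⬝ᵥ n⁻¹ ∑ t, r i t • v i t)²` from its mean
given the responses `r i t = c i ⬝ᵥ v i t`, as a function of `r` and the residuals `z`. -/
noncomputable def condDev [Fintype ι] [Fintype τ] [Fintype π] (S : ι → Matrix κ κ ℝ)
    (c : ι → κ → ℝ) (f : π → κ → ℝ) (n : ℝ) (r : ι × τ → ℝ) (z : (ι × τ) × κ → ℝ) : ℝ :=
  ∑ i, ∑ p, (((∑ t, r (i, t) ^ 2) / n * (f p ⬝ᵥ regCoef (S i) (c i))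
      + (∑ t, r (i, t) * (f p ⬝ᵥ fun k => z ((i, t), k))) / n) ^ 2
    - ((∑ t, r (i, t) ^ 2) / n * (f p ⬝ᵥ regCoef (S i) (c i))) ^ 2
    - (∑ t, r (i, t) ^ 2) / n ^ 2 * respVar (S i) (residualForm (S i) (c i) (f p)))

/-- The responses `c i ⬝ᵥ v i t` of all the vectors. -/
def responses (v : ι × τ → Ω → EuclideanSpace ℝ κ) (c : ι → κ → ℝ) (ω : Ω) (j : ι × τ) : ℝ :=
  c j.1 ⬝ᵥ (v j ω).ofLp

/-- The coordinates of the residuals of all the vectors. -/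
noncomputable def residuals (v : ι × τ → Ω → EuclideanSpace ℝ κ) (S : ι → Matrix κ κ ℝ)
    (c : ι → κ → ℝ) (ω : Ω) (x : (ι × τ) × κ) : ℝ :=
  residual (S x.1.1) (c x.1.1) (v x.1 ω).ofLp x.2

lemma measurable_condDev [Fintype ι] [Fintype τ] [Fintype π] (S : ι → Matrix κ κ ℝ)
    (c : ι → κ → ℝ) (f : π → κ → ℝ) (n : ℝ) :
    Measurable fun rz : (ι × τ → ℝ) × ((ι × τ) × κ → ℝ) => condDev S c f n rz.1 rz.2 := by
  simp only [condDev, dotProduct]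
  fun_prop

lemma residuals_eq_dotProduct [DecidableEq κ] (v : ι × τ → Ω → EuclideanSpace ℝ κ)
    (S : ι → Matrix κ κ ℝ) (c : ι → κ → ℝ) (ω : Ω) (x : (ι × τ) × κ) :
    residuals v S c ω x
      = residualForm (S x.1.1) (c x.1.1) (Pi.single x.2 1) ⬝ᵥ (v x.1 ω).ofLp := by
  rw [← dotProduct_residual, single_one_dotProduct, residuals]

variable [MeasurableSpace Ω] {μ : Measure Ω} [DecidableEq κ]
  {v : ι × τ → Ω → EuclideanSpace ℝ κ} {S : ι → Matrix κ κ ℝ}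

lemma aemeasurable_residuals [Countable ι] [Countable τ]
    (hv : ∀ j, HasLaw (v j) (multivariateGaussian 0 (S j.1)) μ) (c : ι → κ → ℝ) :
    AEMeasurable (residuals v S c) μ := by
  refine aemeasurable_pi_lambda _ fun x => ?_
  simp_rw [residuals_eq_dotProduct]
  exact (hasGaussianLaw_dotProduct (hv x.1) _).aemeasurable

lemma aemeasurable_responses [Countable ι] [Countable τ]
    (hv : ∀ j, HasLaw (v j) (multivariateGaussian 0 (S j.1)) μ) (c : ι → κ → ℝ) :
    AEMeasurable (responses v c) μ :=
  aemeasurable_pi_lambda _ fun j => (hasGaussianLaw_dotProduct (hv j) _).aemeasurable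

lemma indepFun_responses_residuals [Finite ι] [Finite τ]
    (hv : ∀ j, HasLaw (v j) (multivariateGaussian 0 (S j.1)) μ)
    (hS : ∀ i, (S i).PosSemidef) (hi : iIndepFun v μ) (c : ι → κ → ℝ) :
    IndepFun (responses v c) (residuals v S c) μ := by
  classical
  have := Fintype.ofFinite ι
  have := Fintype.ofFinite τ
  let a : ι × τ → ι × τ → κ → ℝ := fun j => Pi.single j (c j.1)
  let b : (ι × τ) × κ → ι × τ → κ → ℝ := fun x =>
    Pi.single x.1 (residualForm (S x.1.1) (c x.1.1) (Pi.single x.2 1))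
  have ha : responses v c = fun ω j => linearForm v (a j) ω := by
    ext ω j; exact (linearForm_single v j _ ω).symm
  have hb : residuals v S c = fun ω x => linearForm v (b x) ω := by
    ext ω x; rw [residuals_eq_dotProduct, linearForm_single]
  have hjoint : HasGaussianLaw (fun ω => (responses v c ω, residuals v S c ω)) μ := by
    simpa only [ha, hb, ContinuousLinearMap.prod_apply, ContinuousLinearMap.coe_pi',
      linearFormCLM_apply] using (hi.hasGaussianLaw fun j => (hv j).hasGaussianLaw).map_fun
        ((ContinuousLinearMap.pi fun j => linearFormCLM (a j)).prod
          (ContinuousLinearMap.pi fun x => linearFormCLM (b x)))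
  refine hjoint.indepFun_of_covariance_eval fun j x => ?_
  simp_rw [ha, hb]
  refine (covariance_linearForm hv (fun j => hS j.1) hi (a j) (b x)).trans
    (Finset.sum_eq_zero fun k _ => ?_)
  rcases eq_or_ne k j with rfl | hkj
  · rcases eq_or_ne k x.1 with rfl | hkx
    · simp only [a, b, Pi.single_eq_same, dotProduct_mulVec_residualForm (hS _)]
    · simp [b, Pi.single_eq_of_ne hkx]
  · simp [a, Pi.single_eq_of_ne hkj]

variable [Fintype ι] [Fintype τ] [Fintype π]

lemma measure_abs_condDev_ge_le (hv : ∀ j, HasLaw (v j) (multivariateGaussian 0 (S j.1)) μ)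
    (hS : ∀ i, (S i).PosSemidef) (hi : iIndepFun v μ) (c : ι → κ → ℝ) {f : π → κ → ℝ} {n : ℝ}
    {θ : ι → ℝ} (hθ : ∀ i (w : π → ℝ), respVar (S i) (∑ p, w p • f p) ≤ θ i * ∑ p, w p ^ 2)
    (r : ι × τ → ℝ) {b Q x t : ℝ} (hb : 0 < b)
    (hrb : ∀ i, 4 * (θ i * ((∑ t, r (i, t) ^ 2) / n ^ 2)) ≤ b)
    (hrQ : ∑ i, (2 * Fintype.card π * (θ i * ((∑ t, r (i, t) ^ 2) / n ^ 2)) ^ 2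
          + 4 * (θ i * ((∑ t, r (i, t) ^ 2) / n ^ 2)) *
            ∑ p, ((∑ t, r (i, t) ^ 2) / n * (f p ⬝ᵥ regCoef (S i) (c i))) ^ 2) ≤ Q)
    (ht : 0 ≤ t) (hQx : 4 * Q * x ≤ t ^ 2) (hbx : 2 * b * x ≤ t) :
    μ {ω | t ≤ |condDev S c f n r (residuals v S c ω)|} ≤ 2 * ENNReal.ofReal (Real.exp (-x)) := by
  classical
  let g : ι → (κ → ℝ) → ι × τ → κ → ℝ := fun i h j =>
    if j.1 = i then (r j / n) • residualForm (S i) (c i) h else 0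
  have hform : ∀ i h ω, linearForm v (g i h) ω
      = (∑ t, r (i, t) * (h ⬝ᵥ fun k => residuals v S c ω ((i, t), k))) / n := fun i h ω => by
    rw [linearForm, Fintype.sum_prod_type, Fintype.sum_eq_single i fun i' hi' => by simp [g, hi'],
      Finset.sum_div]
    refine Finset.sum_congr rfl fun t _ => ?_
    simp only [g, if_true, smul_dotProduct, ← dotProduct_residual, smul_eq_mul, residuals]
    ring
  have hvar : ∀ i h, ∑ j : ι × τ, respVar (S j.1) (g i h j)
      = (∑ t, r (i, t) ^ 2) / n ^ 2 * respVar (S i) (residualForm (S i) (c i) h) := fun i h => by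
    rw [Fintype.sum_prod_type, Fintype.sum_eq_single i fun i' hi' => by simp [g, hi', respVar_zero],
      Finset.sum_div, Finset.sum_mul]
    simp only [g, if_true, respVar_smul, div_pow]
  have hsum : ∀ i (w : π → ℝ) j, ∑ p, w p • g i (f p) j = g i (∑ p, w p • f p) j :=
    fun i w j => by
      simp only [g]
      split_ifs
      · simp only [smul_comm _ (r j / n), ← Finset.smul_sum, sum_smul_residualForm]
      · simp
  have key := measure_abs_linearForm_quadratic_ge_le hv (fun j => hS j.1) hi
    (a := fun i p => g i (f p)) (fun i l hil p q j => by
      by_cases hj : j.1 = i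
      · exact Or.inr (if_neg fun h => hil (hj.symm.trans h))
      · exact Or.inl (if_neg hj))
    (τ := fun i => θ i * ((∑ t, r (i, t) ^ 2) / n ^ 2)) (fun i w => by
      simp only [hsum, hvar]
      calc _ ≤ (∑ t, r (i, t) ^ 2) / n ^ 2 * (θ i * ∑ p, w p ^ 2) := by
            gcongr; exact (respVar_residualForm_le (hS i) _ _).trans (hθ i w)
        _ = _ := by ring)
    (fun i p => (∑ t, r (i, t) ^ 2) / n * (f p ⬝ᵥ regCoef (S i) (c i))) hb hrb hrQ ht hQx hbx
  convert! key using 6 with ω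
  rw [condDev]
  refine Finset.sum_congr rfl fun i _ => Finset.sum_congr rfl fun p _ => ?_
  rw [hform, hvar]; ring

-- The residuals are independent of the responses, so the tail bound for fixed `r` integrates.
lemma measure_mem_and_abs_condDev_ge_le [IsProbabilityMeasure μ]
    (hv : ∀ j, HasLaw (v j) (multivariateGaussian 0 (S j.1)) μ)
    (hS : ∀ i, (S i).PosSemidef) (hi : iIndepFun v μ) (c : ι → κ → ℝ) {f : π → κ → ℝ} {n : ℝ}
    {θ : ι → ℝ} (hθ : ∀ i (w : π → ℝ), respVar (S i) (∑ p, w p • f p) ≤ θ i * ∑ p, w p ^ 2)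
    {G : Set (ι × τ → ℝ)} (hG : MeasurableSet G) {b Q x t : ℝ} (hb : 0 < b)
    (hGb : ∀ r ∈ G, ∀ i, 4 * (θ i * ((∑ t, r (i, t) ^ 2) / n ^ 2)) ≤ b)
    (hGQ : ∀ r ∈ G, ∑ i, (2 * Fintype.card π * (θ i * ((∑ t, r (i, t) ^ 2) / n ^ 2)) ^ 2
          + 4 * (θ i * ((∑ t, r (i, t) ^ 2) / n ^ 2)) *
            ∑ p, ((∑ t, r (i, t) ^ 2) / n * (f p ⬝ᵥ regCoef (S i) (c i))) ^ 2) ≤ Q)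
    (ht : 0 ≤ t) (hQx : 4 * Q * x ≤ t ^ 2) (hbx : 2 * b * x ≤ t) :
    μ {ω | responses v c ω ∈ G ∧ t ≤ |condDev S c f n (responses v c ω) (residuals v S c ω)|}
      ≤ 2 * ENNReal.ofReal (Real.exp (-x)) := by
  have hA : MeasurableSet {rz : (ι × τ → ℝ) × ((ι × τ) × κ → ℝ) |
      rz.1 ∈ G ∧ t ≤ |condDev S c f n rz.1 rz.2|} :=
    (measurable_fst hG).inter (measurableSet_le measurable_const (measurable_condDev S c f n).abs)
  refine measure_prodMk_mem_le_of_indepFun (indepFun_responses_residuals hv hS hi c)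
    (aemeasurable_responses hv c) (aemeasurable_residuals hv c) hA fun r => ?_
  by_cases hr : r ∈ G
  · exact (measure_mono fun ω hω => hω.2).trans (measure_abs_condDev_ge_le hv hS hi c hθ r hb
      (hGb r hr) (hGQ r hr) ht hQx hbx)
  · exact (measure_mono_null (t := ∅) (fun ω hω => hr hω.1) measure_empty).trans_le zero_le

end Regression

/-! ### Algebra of the model -/

section Algebra

variable {I T B P R : ℕ}

/-- The entries of the rank-one matrix `u wᵀ`, as a linear form on `B × P` matrices. -/
def outerVec (u : Fin B → ℝ) (w : Fin P → ℝ) : Fin B × Fin P → ℝ := fun k => u k.1 * w k.2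

/-- The coefficients of the response `tr(Wᵀ X V)` as a linear form in `X`: the entries of
`W Vᵀ`. -/
def respCoef (W : Matrix (Fin B) (Fin R) ℝ) (V : Matrix (Fin P) (Fin R) ℝ) : Fin B × Fin P → ℝ :=
  fun k => (W * Vᵀ) k.1 k.2

/-- The variance of the response `tr(Wᵀ X V)` of a covariate matrix `X ∼ N(0, Γ ⊗ Δ)`. -/
abbrev responseVar (Γ : Matrix (Fin B) (Fin B) ℝ) (Δ : Matrix (Fin P) (Fin P) ℝ)
    (W : Matrix (Fin B) (Fin R) ℝ) (V : Matrix (Fin P) (Fin R) ℝ) : ℝ :=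
  respVar (Γ ⊗ₖ Δ) (respCoef W V)

/-- `M = Γ W Vᵀ Δ`, the covariance of the response and the covariates. -/
def signalMat (Γ : Matrix (Fin B) (Fin B) ℝ) (Δ : Matrix (Fin P) (Fin P) ℝ)
    (W : Matrix (Fin B) (Fin R) ℝ) (V : Matrix (Fin P) (Fin R) ℝ) : Matrix (Fin B) (Fin P) ℝ :=
  Γ * (W * Vᵀ) * Δᵀ

/-- The regression coefficients of the covariates on the response, as a matrix. -/
noncomputable def regMat (Γ : Matrix (Fin B) (Fin B) ℝ) (Δ : Matrix (Fin P) (Fin P) ℝ)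
    (W : Matrix (Fin B) (Fin R) ℝ) (V : Matrix (Fin P) (Fin R) ℝ) : Matrix (Fin B) (Fin P) ℝ :=
  (responseVar Γ Δ W V)⁻¹ • signalMat Γ Δ W V

/-- The squared Frobenius norm. -/
def frobSq {m n : ℕ} (A : Matrix (Fin m) (Fin n) ℝ) : ℝ := ∑ i, ∑ j, A i j ^ 2

lemma outerVec_dotProduct (u : Fin B → ℝ) (w : Fin P → ℝ) (X : Matrix (Fin B) (Fin P) ℝ) :
    outerVec u w ⬝ᵥ (fun k => X k.1 k.2) = u ⬝ᵥ X *ᵥ w := by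
  simp only [dotProduct, outerVec, mulVec, Fintype.sum_prod_type, Finset.mul_sum]
  exact Finset.sum_congr rfl fun b _ => Finset.sum_congr rfl fun p _ => by ring

lemma outerVec_single_dotProduct (u : Fin B → ℝ) (p : Fin P) (X : Matrix (Fin B) (Fin P) ℝ) :
    outerVec u (Pi.single p 1) ⬝ᵥ (fun k => X k.1 k.2) = (Xᵀ *ᵥ u) p := by
  rw [outerVec_dotProduct, dotProduct_mulVec_eq_transpose]
  simp

lemma sum_smul_outerVec_single (u : Fin B → ℝ) (w : Fin P → ℝ) :
    ∑ p, w p • outerVec u (Pi.single p 1) = outerVec u w := by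
  ext k
  simp [outerVec, Pi.single_apply, mul_comm]

lemma kronecker_mulVec (Γ : Matrix (Fin B) (Fin B) ℝ) (Δ : Matrix (Fin P) (Fin P) ℝ)
    (C : Matrix (Fin B) (Fin P) ℝ) :
    (Γ ⊗ₖ Δ) *ᵥ (fun k => C k.1 k.2) = fun k => (Γ * C * Δᵀ) k.1 k.2 := by
  ext k
  simp only [mulVec, dotProduct, kroneckerMap_apply, Fintype.sum_prod_type, mul_apply,
    transpose_apply, Finset.sum_mul]
  rw [Finset.sum_comm]
  exact Finset.sum_congr rfl fun b _ => Finset.sum_congr rfl fun p _ => by ring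

lemma kronecker_mulVec_outerVec (Γ : Matrix (Fin B) (Fin B) ℝ) (Δ : Matrix (Fin P) (Fin P) ℝ)
    (u : Fin B → ℝ) (w : Fin P → ℝ) :
    (Γ ⊗ₖ Δ) *ᵥ outerVec u w = outerVec (Γ *ᵥ u) (Δ *ᵥ w) := by
  ext k
  simp only [mulVec, dotProduct, kroneckerMap_apply, Fintype.sum_prod_type, outerVec,
    Finset.sum_mul_sum]
  exact Finset.sum_congr rfl fun b _ => Finset.sum_congr rfl fun p _ => by ring

lemma respVar_kronecker_outerVec (Γ : Matrix (Fin B) (Fin B) ℝ) (Δ : Matrix (Fin P) (Fin P) ℝ)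
    (u : Fin B → ℝ) (w : Fin P → ℝ) :
    respVar (Γ ⊗ₖ Δ) (outerVec u w) = (u ⬝ᵥ Γ *ᵥ u) * (w ⬝ᵥ Δ *ᵥ w) := by
  rw [respVar, kronecker_mulVec_outerVec]
  simp only [dotProduct, outerVec, Fintype.sum_prod_type, Finset.sum_mul_sum]
  exact Finset.sum_congr rfl fun b _ => Finset.sum_congr rfl fun p _ => by ring

lemma respVar_kronecker_outerVec_single (Γ : Matrix (Fin B) (Fin B) ℝ)
    (Δ : Matrix (Fin P) (Fin P) ℝ) (u : Fin B → ℝ) (p : Fin P) :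
    respVar (Γ ⊗ₖ Δ) (outerVec u (Pi.single p 1)) = (u ⬝ᵥ Γ *ᵥ u) * Δ p p := by
  rw [respVar_kronecker_outerVec]
  simp only [single_one_dotProduct, mulVec_single_one, col_apply]

lemma respVar_sum_smul_outerVec_le {Γ : Matrix (Fin B) (Fin B) ℝ} (hΓ : Γ.PosSemidef)
    (Δ : Matrix (Fin P) (Fin P) ℝ) {u : Fin B → ℝ} (hu : u ⬝ᵥ u = 1) (w : Fin P → ℝ) :
    respVar (Γ ⊗ₖ Δ) (∑ p, w p • outerVec u (Pi.single p 1))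
      ≤ specNorm Γ * specNorm Δ * ∑ p, w p ^ 2 := by
  have hΓu : u ⬝ᵥ Γ *ᵥ u ≤ specNorm Γ := by
    simpa only [hu, mul_one] using dotProduct_mulVec_self_le Γ u
  have hΔw : w ⬝ᵥ Δ *ᵥ w ≤ specNorm Δ * ∑ p, w p ^ 2 := by
    simpa only [dotProduct, ← sq] using dotProduct_mulVec_self_le Δ w
  have hΓ0 : 0 ≤ u ⬝ᵥ Γ *ᵥ u := hΓ.dotProduct_mulVec_nonneg u
  have hΔ0 := specNorm_nonneg Δ
  rw [sum_smul_outerVec_single, respVar_kronecker_outerVec]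
  calc _ ≤ (u ⬝ᵥ Γ *ᵥ u) * (specNorm Δ * ∑ p, w p ^ 2) := by gcongr
    _ ≤ specNorm Γ * (specNorm Δ * ∑ p, w p ^ 2) := by gcongr
    _ = _ := by ring

lemma trace_transpose_mul_mul (W : Matrix (Fin B) (Fin R) ℝ) (V : Matrix (Fin P) (Fin R) ℝ)
    (X : Matrix (Fin B) (Fin P) ℝ) :
    (Wᵀ * X * V).trace = respCoef W V ⬝ᵥ (vecOf X).ofLp := by
  have hcycle : (Wᵀ * X * V).trace = ((W * Vᵀ)ᵀ * X).trace := by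
    rw [transpose_mul, transpose_transpose, Matrix.mul_assoc V, trace_mul_comm V]
  rw [hcycle]
  simp only [trace, diag_apply, mul_apply, transpose_apply, dotProduct, respCoef, vecOf,
    Fintype.sum_prod_type]
  rw [Finset.sum_comm]

lemma trace_le_mul_specNorm {n : ℕ} (A : Matrix (Fin n) (Fin n) ℝ) :
    A.trace ≤ n * specNorm A := by
  have hdiag (p : Fin n) : A p p ≤ specNorm A := by
    simpa using dotProduct_mulVec_self_le A (Pi.single p 1)
  simpa [trace] using Finset.sum_le_sum fun p (_ : p ∈ Finset.univ) => hdiag p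

lemma frobSq_transpose {m n : ℕ} (A : Matrix (Fin m) (Fin n) ℝ) : frobSq Aᵀ = frobSq A := by
  simp only [frobSq, transpose_apply]; exact Finset.sum_comm

lemma frobSq_nonneg {m n : ℕ} (A : Matrix (Fin m) (Fin n) ℝ) : 0 ≤ frobSq A :=
  Finset.sum_nonneg fun _ _ => Finset.sum_nonneg fun _ _ => sq_nonneg _

lemma frobSq_mul_le {l m n : ℕ} (A : Matrix (Fin l) (Fin m) ℝ) (C : Matrix (Fin m) (Fin n) ℝ) :
    frobSq (A * C) ≤ specNorm A ^ 2 * frobSq C := by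
  rw [← frobSq_transpose, ← frobSq_transpose C]
  simp only [frobSq]
  rw [Finset.mul_sum]
  refine Finset.sum_le_sum fun j _ => ?_
  simpa [dotProduct, mulVec, mul_apply, sq] using mulVec_dotProduct_self_le A fun k => C k j

lemma frobSq_le {m n : ℕ} (A : Matrix (Fin m) (Fin n) ℝ) : frobSq A ≤ n * specNorm A ^ 2 := by
  have hone : frobSq (1 : Matrix (Fin n) (Fin n) ℝ) = n := by simp [frobSq, one_apply]
  have hmul := frobSq_mul_le A (1 : Matrix (Fin n) (Fin n) ℝ)
  rwa [Matrix.mul_one, hone, mul_comm] at hmul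

lemma respVar_kronecker_le (Γ : Matrix (Fin B) (Fin B) ℝ) (Δ : Matrix (Fin P) (Fin P) ℝ)
    (C : Matrix (Fin B) (Fin P) ℝ) :
    respVar (Γ ⊗ₖ Δ) (fun k => C k.1 k.2) ≤ specNorm Γ * specNorm Δ * frobSq C := by
  have hΓCΔ : frobSq (Γ * C * Δᵀ) ≤ (specNorm Γ * specNorm Δ) ^ 2 * frobSq C := by
    rw [← frobSq_transpose, transpose_mul, transpose_transpose]
    refine (frobSq_mul_le _ _).trans ?_
    rw [frobSq_transpose, mul_pow, mul_comm (specNorm Γ ^ 2), mul_assoc]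
    exact mul_le_mul_of_nonneg_left (frobSq_mul_le _ _) (by positivity)
  have hCauchySchwarz :
      respVar (Γ ⊗ₖ Δ) (fun k => C k.1 k.2) ^ 2 ≤ frobSq C * frobSq (Γ * C * Δᵀ) := by
    rw [respVar, kronecker_mulVec]
    simp only [frobSq, dotProduct, ← Fintype.sum_prod_type']
    exact Finset.sum_mul_sq_le_sq_mul_sq _ _ _
  have hC := frobSq_nonneg C
  have hΓ := specNorm_nonneg Γ
  have hΔ := specNorm_nonneg Δ
  refine le_of_sq_le_sq (hCauchySchwarz.trans ?_) (by positivity)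
  calc _ ≤ frobSq C * ((specNorm Γ * specNorm Δ) ^ 2 * frobSq C) := by gcongr
    _ = _ := by ring

lemma kronecker_mulVec_respCoef (Γ : Matrix (Fin B) (Fin B) ℝ) (Δ : Matrix (Fin P) (Fin P) ℝ)
    (W : Matrix (Fin B) (Fin R) ℝ) (V : Matrix (Fin P) (Fin R) ℝ) :
    (Γ ⊗ₖ Δ) *ᵥ respCoef W V = fun k => signalMat Γ Δ W V k.1 k.2 :=
  kronecker_mulVec Γ Δ (W * Vᵀ)

lemma regCoef_kronecker_respCoef (Γ : Matrix (Fin B) (Fin B) ℝ) (Δ : Matrix (Fin P) (Fin P) ℝ)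
    (W : Matrix (Fin B) (Fin R) ℝ) (V : Matrix (Fin P) (Fin R) ℝ) :
    regCoef (Γ ⊗ₖ Δ) (respCoef W V) = fun k => regMat Γ Δ W V k.1 k.2 := by
  rw [regCoef, kronecker_mulVec_respCoef]; rfl

lemma responseVar_nonneg {Γ : Matrix (Fin B) (Fin B) ℝ} {Δ : Matrix (Fin P) (Fin P) ℝ}
    (hΓ : Γ.PosSemidef) (hΔ : Δ.PosSemidef) (W : Matrix (Fin B) (Fin R) ℝ)
    (V : Matrix (Fin P) (Fin R) ℝ) : 0 ≤ responseVar Γ Δ W V :=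
  respVar_nonneg (hΓ.kronecker hΔ) _

lemma responseVar_smul_regMat {Γ : Matrix (Fin B) (Fin B) ℝ} {Δ : Matrix (Fin P) (Fin P) ℝ}
    (hΓ : Γ.PosSemidef) (hΔ : Δ.PosSemidef) (W : Matrix (Fin B) (Fin R) ℝ)
    (V : Matrix (Fin P) (Fin R) ℝ) :
    responseVar Γ Δ W V • regMat Γ Δ W V = signalMat Γ Δ W V := by
  have h := respVar_smul_regCoef (hΓ.kronecker hΔ) (respCoef W V)
  rw [regCoef_kronecker_respCoef, kronecker_mulVec_respCoef] at h
  ext b p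
  exact congrFun h (b, p)

lemma dotProduct_mul_transpose_mulVec {m n : ℕ} (A : Matrix (Fin m) (Fin n) ℝ) (u : Fin m → ℝ) :
    u ⬝ᵥ (A * Aᵀ) *ᵥ u = Aᵀ *ᵥ u ⬝ᵥ Aᵀ *ᵥ u := by
  rw [← mulVec_mulVec, dotProduct_mulVec_eq_transpose]

lemma dotProduct_mul_transpose_mulVec_nonneg {m n : ℕ} (A : Matrix (Fin m) (Fin n) ℝ)
    (u : Fin m → ℝ) : 0 ≤ u ⬝ᵥ (A * Aᵀ) *ᵥ u :=
  dotProduct_mul_transpose_mulVec A u ▸ dotProduct_self_nonneg _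

lemma responseVar_sq_mul_regMat {Γ : Matrix (Fin B) (Fin B) ℝ} {Δ : Matrix (Fin P) (Fin P) ℝ}
    (hΓ : Γ.PosSemidef) (hΔ : Δ.PosSemidef) (W : Matrix (Fin B) (Fin R) ℝ)
    (V : Matrix (Fin P) (Fin R) ℝ) (u : Fin B → ℝ) :
    responseVar Γ Δ W V ^ 2 * (u ⬝ᵥ (regMat Γ Δ W V * (regMat Γ Δ W V)ᵀ) *ᵥ u)
      = u ⬝ᵥ (signalMat Γ Δ W V * (signalMat Γ Δ W V)ᵀ) *ᵥ u := by
  rw [← responseVar_smul_regMat hΓ hΔ, transpose_smul, Matrix.smul_mul, Matrix.mul_smul,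
    smul_mulVec, smul_mulVec, dotProduct_smul, dotProduct_smul, smul_eq_mul, smul_eq_mul]
  ring

lemma sum_sq_outerVec_single_dotProduct_regCoef (Γ : Matrix (Fin B) (Fin B) ℝ)
    (Δ : Matrix (Fin P) (Fin P) ℝ) (W : Matrix (Fin B) (Fin R) ℝ)
    (V : Matrix (Fin P) (Fin R) ℝ) (u : Fin B → ℝ) :
    ∑ p, (outerVec u (Pi.single p 1) ⬝ᵥ regCoef (Γ ⊗ₖ Δ) (respCoef W V)) ^ 2
      = u ⬝ᵥ (regMat Γ Δ W V * (regMat Γ Δ W V)ᵀ) *ᵥ u := by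
  rw [dotProduct_mul_transpose_mulVec, regCoef_kronecker_respCoef]
  simp_rw [outerVec_single_dotProduct, dotProduct, sq]

section Lcoef

variable (Γ : Matrix (Fin B) (Fin B) ℝ) (Δ : Fin I → Matrix (Fin P) (Fin P) ℝ)
  (W : Matrix (Fin B) (Fin R) ℝ) (V : Fin I → Matrix (Fin P) (Fin R) ℝ) (i : Fin I)

lemma Lcoef_nonneg : 0 ≤ Lcoef Γ Δ W V i := by
  rw [Lcoef]; positivity

lemma responseVar_mul_le :
    responseVar Γ (Δ i) W (V i) * (specNorm Γ * specNorm (Δ i)) ≤ R * Lcoef Γ Δ W V i := by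
  have hΓ := specNorm_nonneg Γ
  have hΔ := specNorm_nonneg (Δ i)
  have hWV : frobSq (W * (V i)ᵀ) ≤ specNorm W ^ 2 * (R * specNorm (V i) ^ 2) :=
    (frobSq_mul_le W (V i)ᵀ).trans (by gcongr; rw [frobSq_transpose]; exact frobSq_le (V i))
  calc _ ≤ specNorm Γ * specNorm (Δ i) * (specNorm W ^ 2 * (R * specNorm (V i) ^ 2)) *
        (specNorm Γ * specNorm (Δ i)) := by
        gcongr
        exact (respVar_kronecker_le Γ (Δ i) (W * (V i)ᵀ)).trans (by gcongr)
    _ = _ := by rw [Lcoef]; ring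

lemma specNorm_signalMat_sq_le : specNorm (signalMat Γ (Δ i) W (V i)) ^ 2 ≤ Lcoef Γ Δ W V i := by
  have hΓ := specNorm_nonneg Γ
  have hΔ := specNorm_nonneg (Δ i)
  have hWV := (specNorm_mul_le W (V i)ᵀ).trans_eq (by rw [specNorm_transpose])
  have hΓWV := (specNorm_mul_le Γ (W * (V i)ᵀ)).trans (mul_le_mul_of_nonneg_left hWV hΓ)
  have hM := (specNorm_mul_le (Γ * (W * (V i)ᵀ)) (Δ i)ᵀ).trans_eq (by rw [specNorm_transpose])
  calc _ ≤ (specNorm Γ * (specNorm W * specNorm (V i)) * specNorm (Δ i)) ^ 2 :=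
        pow_le_pow_left₀ (specNorm_nonneg _)
          (hM.trans (mul_le_mul_of_nonneg_right hΓWV hΔ)) 2
    _ = _ := by rw [Lcoef]; ring

lemma dotProduct_signalMat_le (u : Fin B → ℝ) :
    u ⬝ᵥ (signalMat Γ (Δ i) W (V i) * (signalMat Γ (Δ i) W (V i))ᵀ) *ᵥ u
      ≤ Lcoef Γ Δ W V i * (u ⬝ᵥ u) := by
  rw [dotProduct_mul_transpose_mulVec]
  refine (mulVec_dotProduct_self_le _ u).trans ?_
  rw [specNorm_transpose]
  exact mul_le_mul_of_nonneg_right (specNorm_signalMat_sq_le Γ Δ W V i) (dotProduct_self_nonneg u)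

end Lcoef

end Algebra

/-! ### The conditional mean of `Â` given the responses -/

section Average

variable {I : ℕ}

lemma avg_mono {f g : Fin I → ℝ} (h : ∀ i, f i ≤ g i) : avg f ≤ avg g :=
  mul_le_mul_of_nonneg_left (Finset.sum_le_sum fun i _ => h i) (by positivity)

lemma avg_nonneg {f : Fin I → ℝ} (h : ∀ i, 0 ≤ f i) : 0 ≤ avg f :=
  mul_nonneg (by positivity) (Finset.sum_nonneg fun i _ => h i)

lemma avg_const_mul (a : ℝ) (f : Fin I → ℝ) : avg (fun i => a * f i) = a * avg f := by
  simp only [avg, ← Finset.mul_sum]; ring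

lemma avg_add (f g : Fin I → ℝ) : avg (fun i => f i + g i) = avg f + avg g := by
  simp only [avg, Finset.sum_add_distrib, mul_add]

lemma avg_sub (f g : Fin I → ℝ) : avg (fun i => f i - g i) = avg f - avg g := by
  simp only [avg, Finset.sum_sub_distrib, mul_sub]

lemma avg_const (hI : I ≠ 0) (a : ℝ) : avg (fun _ : Fin I => a) = a := by
  have : (I : ℝ) ≠ 0 := by exact_mod_cast hI
  simp [avg, this]

lemma sum_eq_mul_avg (hI : I ≠ 0) (f : Fin I → ℝ) : ∑ i, f i = I * avg f := by
  have : (I : ℝ) ≠ 0 := by exact_mod_cast hI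
  rw [avg, ← mul_assoc, mul_one_div_cancel this, one_mul]

lemma dotProduct_smul_sum_mulVec {n : ℕ} (A : Fin I → Matrix (Fin n) (Fin n) ℝ) (u : Fin n → ℝ) :
    u ⬝ᵥ ((1 / (I : ℝ)) • ∑ i, A i) *ᵥ u = avg fun i => u ⬝ᵥ A i *ᵥ u := by
  rw [smul_mulVec, dotProduct_smul, smul_eq_mul, sum_mulVec, dotProduct_sum, avg]

end Average

section Decomposition

variable {I T B P R : ℕ}

/-- `Γ W Q Wᵀ Γ`, whose `R`-th eigenvalue is `lamSignal`. -/
noncomputable abbrev signal (Γ : Matrix (Fin B) (Fin B) ℝ) (Δ : Fin I → Matrix (Fin P) (Fin P) ℝ)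
    (W : Matrix (Fin B) (Fin R) ℝ) (V : Fin I → Matrix (Fin P) (Fin R) ℝ) :
    Matrix (Fin B) (Fin B) ℝ :=
  Γ * W * Qmat Δ V * Wᵀ * Γ

/-- The weighted average of the matrices `A_i A_iᵀ`, for the regression coefficients `A_i`. -/
noncomputable def weightedReg (Γ : Matrix (Fin B) (Fin B) ℝ) (Δ : Fin I → Matrix (Fin P) (Fin P) ℝ)
    (W : Matrix (Fin B) (Fin R) ℝ) (V : Fin I → Matrix (Fin P) (Fin R) ℝ) (w : Fin I → ℝ) :
    Matrix (Fin B) (Fin B) ℝ :=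
  (1 / (I : ℝ)) • ∑ i, w i • (regMat Γ (Δ i) W (V i) * (regMat Γ (Δ i) W (V i))ᵀ)

/-- The empirical second moment of the responses `r (i, ·)` of the task `i`. -/
noncomputable def sampleVar (r : Fin I × Fin T → ℝ) (i : Fin I) : ℝ := (∑ t, r (i, t) ^ 2) / T

/-- The coefficient of `Γ` in the conditional mean of `Â` given the responses. -/
noncomputable def noiseCoef (Δ : Fin I → Matrix (Fin P) (Fin P) ℝ) (r : Fin I × Fin T → ℝ) : ℝ :=
  avg fun i => sampleVar r i / T * (Δ i).trace

/-- The part of the conditional mean of `Â` given the responses that comes from the regression of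
the covariates on the responses; its column space is contained in that of `Γ W`. -/
noncomputable def condSignal (Γ : Matrix (Fin B) (Fin B) ℝ) (Δ : Fin I → Matrix (Fin P) (Fin P) ℝ)
    (W : Matrix (Fin B) (Fin R) ℝ) (V : Fin I → Matrix (Fin P) (Fin R) ℝ)
    (r : Fin I × Fin T → ℝ) : Matrix (Fin B) (Fin B) ℝ :=
  weightedReg Γ Δ W V fun i =>
    sampleVar r i ^ 2 - sampleVar r i * responseVar Γ (Δ i) W (V i) / T

/-- The first-order deviation of `condSignal` caused by the deviations of the empirical second
moments of the responses from their variances. -/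
noncomputable def varDeviation (Γ : Matrix (Fin B) (Fin B) ℝ)
    (Δ : Fin I → Matrix (Fin P) (Fin P) ℝ) (W : Matrix (Fin B) (Fin R) ℝ)
    (V : Fin I → Matrix (Fin P) (Fin R) ℝ) (r : Fin I × Fin T → ℝ) : Matrix (Fin B) (Fin B) ℝ :=
  weightedReg Γ Δ W V fun i =>
    (sampleVar r i - responseVar Γ (Δ i) W (V i)) * responseVar Γ (Δ i) W (V i)

variable {Γ : Matrix (Fin B) (Fin B) ℝ} {Δ : Fin I → Matrix (Fin P) (Fin P) ℝ}
  {W : Matrix (Fin B) (Fin R) ℝ} {V : Fin I → Matrix (Fin P) (Fin R) ℝ}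

lemma signal_eq_smul_sum (hΓ : Γ.IsHermitian) (hΔ : ∀ i, (Δ i).IsHermitian) :
    signal Γ Δ W V
      = (1 / (I : ℝ)) • ∑ i, signalMat Γ (Δ i) W (V i) * (signalMat Γ (Δ i) W (V i))ᵀ := by
  rw [signal, Qmat, Matrix.mul_smul, Matrix.smul_mul, Matrix.smul_mul, Matrix.mul_sum,
    Matrix.sum_mul, Matrix.sum_mul]
  congr 1
  refine Finset.sum_congr rfl fun i _ => ?_
  simp only [signalMat, transpose_mul, transpose_transpose, (isHermitian_iff_isSymm.1 hΓ).eq,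
    (isHermitian_iff_isSymm.1 (hΔ i)).eq, Matrix.mul_assoc]

lemma isHermitian_signal (hΓ : Γ.IsHermitian) (hΔ : ∀ i, (Δ i).IsHermitian) :
    (signal Γ Δ W V).IsHermitian := by
  rw [signal_eq_smul_sum hΓ hΔ, isHermitian_iff_isSymm, IsSymm]
  simp only [transpose_smul, transpose_sum, transpose_mul, transpose_transpose]

lemma dotProduct_signal (hΓ : Γ.IsHermitian) (hΔ : ∀ i, (Δ i).IsHermitian) (u : Fin B → ℝ) :
    u ⬝ᵥ signal Γ Δ W V *ᵥ u
      = avg fun i => u ⬝ᵥ (signalMat Γ (Δ i) W (V i) * (signalMat Γ (Δ i) W (V i))ᵀ) *ᵥ u := by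
  rw [signal_eq_smul_sum hΓ hΔ, dotProduct_smul_sum_mulVec]

lemma isHermitian_weightedReg (w : Fin I → ℝ) : (weightedReg Γ Δ W V w).IsHermitian := by
  rw [isHermitian_iff_isSymm, IsSymm, weightedReg]
  simp only [transpose_smul, transpose_sum, transpose_mul, transpose_transpose]

lemma dotProduct_weightedReg (w : Fin I → ℝ) (u : Fin B → ℝ) :
    u ⬝ᵥ weightedReg Γ Δ W V w *ᵥ u
      = avg fun i => w i * (u ⬝ᵥ (regMat Γ (Δ i) W (V i) * (regMat Γ (Δ i) W (V i))ᵀ) *ᵥ u) := by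
  rw [weightedReg, dotProduct_smul_sum_mulVec]
  simp only [smul_mulVec, dotProduct_smul, smul_eq_mul]

lemma exists_weightedReg_eq (w : Fin I → ℝ) :
    ∃ K : Matrix (Fin R) (Fin B) ℝ, weightedReg Γ Δ W V w = Γ * W * K := by
  refine ⟨(1 / (I : ℝ)) • ∑ i, (w i * (responseVar Γ (Δ i) W (V i))⁻¹) •
    ((V i)ᵀ * (Δ i)ᵀ * (regMat Γ (Δ i) W (V i))ᵀ), ?_⟩
  rw [weightedReg, Matrix.mul_smul, Matrix.mul_sum]
  congr 1
  refine Finset.sum_congr rfl fun i _ => ?_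
  rw [Matrix.mul_smul, mul_smul]
  generalize (regMat Γ (Δ i) W (V i))ᵀ = N
  rw [regMat, Matrix.smul_mul, signalMat]
  simp only [Matrix.mul_assoc]

lemma sampleVar_nonneg (r : Fin I × Fin T → ℝ) (i : Fin I) : 0 ≤ sampleVar r i := by
  rw [sampleVar]; positivity

-- `q² - q σ / T` lies above its tangent line in `q` at `q = σ`.
lemma varDeviation_add_signal_le_condSignal (hΓ : Γ.PosSemidef) (hΔ : ∀ i, (Δ i).PosSemidef)
    (r : Fin I × Fin T → ℝ) (u : Fin B → ℝ) :
    (2 - 1 / (T : ℝ)) * (u ⬝ᵥ varDeviation Γ Δ W V r *ᵥ u)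
        + (1 - 1 / (T : ℝ)) * (u ⬝ᵥ signal Γ Δ W V *ᵥ u)
      ≤ u ⬝ᵥ condSignal Γ Δ W V r *ᵥ u := by
  rw [dotProduct_signal hΓ.1 fun i => (hΔ i).1, varDeviation, condSignal, dotProduct_weightedReg,
    dotProduct_weightedReg, ← avg_const_mul, ← avg_const_mul, ← avg_add]
  refine avg_mono fun i => ?_
  rw [← responseVar_sq_mul_regMat hΓ (hΔ i), div_eq_mul_one_div (sampleVar r i * _)]
  nlinarith [mul_nonneg (sq_nonneg (sampleVar r i - responseVar Γ (Δ i) W (V i)))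
    (dotProduct_mul_transpose_mulVec_nonneg (regMat Γ (Δ i) W (V i)) u)]

lemma half_signal_sub_le_condSignal (hΓ : Γ.PosSemidef) (hΔ : ∀ i, (Δ i).PosSemidef) (hT : 2 ≤ T)
    {r : Fin I × Fin T → ℝ} {s : ℝ} (hs : specNorm (varDeviation Γ Δ W V r) ≤ s)
    (u : Fin B → ℝ) :
    1 / 2 * (u ⬝ᵥ signal Γ Δ W V *ᵥ u) - 2 * s * (u ⬝ᵥ u) ≤ u ⬝ᵥ condSignal Γ Δ W V r *ᵥ u := by
  have hT2 : 1 / (T : ℝ) ≤ 1 / 2 :=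
    one_div_le_one_div_of_le (by norm_num) (by exact_mod_cast hT)
  have hT0 : 0 ≤ 1 / (T : ℝ) := by positivity
  have hdev := (abs_le.1 ((abs_dotProduct_mulVec_self_le (varDeviation Γ Δ W V r) u).trans
    (mul_le_mul_of_nonneg_right hs (dotProduct_self_nonneg u)))).1
  have hs0 : 0 ≤ s * (u ⬝ᵥ u) :=
    mul_nonneg ((specNorm_nonneg _).trans hs) (dotProduct_self_nonneg u)
  have hsignal : 0 ≤ u ⬝ᵥ signal Γ Δ W V *ᵥ u := by
    rw [dotProduct_signal hΓ.1 fun i => (hΔ i).1]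
    exact avg_nonneg fun i => dotProduct_mul_transpose_mulVec_nonneg _ _
  nlinarith [varDeviation_add_signal_le_condSignal (W := W) (V := V) hΓ hΔ r u]

lemma isHermitian_GammaHat (x : Fin I → Fin T → Matrix (Fin B) (Fin P) ℝ) :
    (GammaHat x).IsHermitian := by
  rw [isHermitian_iff_isSymm, IsSymm, GammaHat]
  simp only [transpose_smul, transpose_sum, transpose_mul, transpose_transpose]

lemma isHermitian_AHat (x : Fin I → Fin T → Matrix (Fin B) (Fin P) ℝ) (y : Fin I → Fin T → ℝ) :
    (AHat x y).IsHermitian := by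
  rw [isHermitian_iff_isSymm, IsSymm, AHat]
  simp only [transpose_smul, transpose_sum, transpose_mul, transpose_transpose]
  congr 1
  refine Finset.sum_congr rfl fun i _ => ?_
  rw [Finset.sum_comm]
  exact Finset.sum_congr rfl fun t _ => Finset.sum_congr rfl fun t' _ => by rw [mul_comm (y i t')]

lemma dotProduct_GammaHat (x : Fin I → Fin T → Matrix (Fin B) (Fin P) ℝ) (u : Fin B → ℝ) :
    u ⬝ᵥ GammaHat x *ᵥ u = (1 / ((I : ℝ) * T * P)) *
      ∑ j : Fin I × Fin T, ∑ p, (outerVec u (Pi.single p 1) ⬝ᵥ (vecOf (x j.1 j.2)).ofLp) ^ 2 := by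
  have hcoord (i : Fin I) (t : Fin T) (p : Fin P) :
      outerVec u (Pi.single p 1) ⬝ᵥ (vecOf (x i t)).ofLp = ((x i t)ᵀ *ᵥ u) p :=
    outerVec_single_dotProduct u p (x i t)
  simp_rw [GammaHat, smul_mulVec, dotProduct_smul, smul_eq_mul, Fintype.sum_prod_type, sum_mulVec,
    dotProduct_sum, dotProduct_mul_transpose_mulVec, hcoord, dotProduct, sq]

lemma dotProduct_sum_sum_mul_transpose_mulVec (x : Fin T → Matrix (Fin B) (Fin P) ℝ)
    (y : Fin T → ℝ) (u : Fin B → ℝ) :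
    u ⬝ᵥ (∑ t, ∑ t', (y t * y t') • (x t * (x t')ᵀ)) *ᵥ u
      = ∑ p, (∑ t, y t * ((x t)ᵀ *ᵥ u) p) ^ 2 := by
  have hsum : ∑ t, ∑ t', (y t * y t') • (x t * (x t')ᵀ)
      = (∑ t, y t • x t) * (∑ t, y t • x t)ᵀ := by
    simp_rw [transpose_sum, Matrix.sum_mul, Matrix.mul_sum, transpose_smul, Matrix.smul_mul,
      Matrix.mul_smul, smul_smul]
  rw [hsum, dotProduct_mul_transpose_mulVec, dotProduct]
  simp_rw [transpose_sum, transpose_smul, sum_mulVec, smul_mulVec, Finset.sum_apply, Pi.smul_apply,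
    smul_eq_mul, sq]

lemma dotProduct_AHat (x : Fin I → Fin T → Matrix (Fin B) (Fin P) ℝ) (y : Fin I → Fin T → ℝ)
    (u : Fin B → ℝ) :
    u ⬝ᵥ AHat x y *ᵥ u = avg fun i => ∑ p,
      ((∑ t, y i t * (outerVec u (Pi.single p 1) ⬝ᵥ (vecOf (x i t)).ofLp)) / T) ^ 2 := by
  have hcoord (i : Fin I) (t : Fin T) (p : Fin P) :
      outerVec u (Pi.single p 1) ⬝ᵥ (vecOf (x i t)).ofLp = ((x i t)ᵀ *ᵥ u) p :=
    outerVec_single_dotProduct u p (x i t)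
  rw [AHat, smul_mulVec, dotProduct_smul, smul_eq_mul, sum_mulVec, dotProduct_sum, avg,
    Finset.mul_sum, Finset.mul_sum]
  refine Finset.sum_congr rfl fun i _ => ?_
  rw [dotProduct_sum_sum_mul_transpose_mulVec]
  simp_rw [hcoord, div_pow, ← Finset.sum_div, ← mul_div_assoc, div_mul_eq_mul_div, div_div]

end Decomposition

section Model

variable {Ω : Type*} {I T B P R : ℕ}

/-- The covariates as vectors of Euclidean space. -/
noncomputable abbrev covVec (X : Fin I → Fin T → Ω → Matrix (Fin B) (Fin P) ℝ)
    (j : Fin I × Fin T) (ω : Ω) : EuclideanSpace ℝ (Fin B × Fin P) :=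
  vecOf (X j.1 j.2 ω)

/-- The responses `tr (Wᵀ X_{it} V_i)`, as linear forms in `covVec X`. -/
noncomputable abbrev taskResponses (W : Matrix (Fin B) (Fin R) ℝ)
    (V : Fin I → Matrix (Fin P) (Fin R) ℝ) (X : Fin I → Fin T → Ω → Matrix (Fin B) (Fin P) ℝ)
    (ω : Ω) : Fin I × Fin T → ℝ :=
  responses (covVec X) (fun i => respCoef W (V i)) ω

/-- `AHat` computed from the covariates and their responses at the outcome `ω`. -/
noncomputable abbrev sampleAHat (W : Matrix (Fin B) (Fin R) ℝ)
    (V : Fin I → Matrix (Fin P) (Fin R) ℝ) (X : Fin I → Fin T → Ω → Matrix (Fin B) (Fin P) ℝ)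
    (ω : Ω) : Matrix (Fin B) (Fin B) ℝ :=
  AHat (fun i t => X i t ω) fun i t => taskResponses W V X ω (i, t)

variable {Γ : Matrix (Fin B) (Fin B) ℝ} {Δ : Fin I → Matrix (Fin P) (Fin P) ℝ}
  {W : Matrix (Fin B) (Fin R) ℝ} {V : Fin I → Matrix (Fin P) (Fin R) ℝ}
  {X : Fin I → Fin T → Ω → Matrix (Fin B) (Fin P) ℝ}

lemma GaussianModel.hasLaw_covVec [MeasurableSpace Ω] {Pr : Measure Ω}
    (hX : GaussianModel Pr Γ Δ X) (j : Fin I × Fin T) :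
    HasLaw (covVec X j) (multivariateGaussian 0 (Γ ⊗ₖ Δ j.1)) Pr :=
  hX.1 j.1 j.2

lemma GaussianModel.iIndepFun_covVec [MeasurableSpace Ω] {Pr : Measure Ω}
    (hX : GaussianModel Pr Γ Δ X) : iIndepFun (covVec X) Pr :=
  hX.2

lemma sum_responses_mul_dotProduct {ι τ κ : Type*} [Fintype τ] [Fintype κ]
    (v : ι × τ → Ω → EuclideanSpace ℝ κ) (S : ι → Matrix κ κ ℝ) (c : ι → κ → ℝ) (f : κ → ℝ)
    (n : ℝ) (i : ι) (ω : Ω) :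
    (∑ t, responses v c ω (i, t) ^ 2) / n * (f ⬝ᵥ regCoef (S i) (c i))
        + (∑ t, responses v c ω (i, t) * (f ⬝ᵥ fun k => residuals v S c ω ((i, t), k))) / n
      = (∑ t, responses v c ω (i, t) * (f ⬝ᵥ (v (i, t) ω).ofLp)) / n := by
  have hres (t : τ) : f ⬝ᵥ (fun k => residuals v S c ω ((i, t), k))
      = f ⬝ᵥ (v (i, t) ω).ofLp - responses v c ω (i, t) * (f ⬝ᵥ regCoef (S i) (c i)) := by
    change f ⬝ᵥ residual (S i) (c i) (v (i, t) ω).ofLp = _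
    rw [residual, dotProduct_sub, dotProduct_smul, smul_eq_mul, responses]
  rw [div_mul_eq_mul_div, ← add_div, Finset.sum_mul, ← Finset.sum_add_distrib]
  congr 1
  refine Finset.sum_congr rfl fun t _ => ?_
  rw [hres]; ring

lemma dotProduct_sampleAHat_sub_condMean (hΓ : Γ.PosSemidef) (hΔ : ∀ i, (Δ i).PosSemidef)
    (u : Fin B → ℝ) (ω : Ω) :
    u ⬝ᵥ (sampleAHat W V X ω - noiseCoef Δ (taskResponses W V X ω) • Γ
        - condSignal Γ Δ W V (taskResponses W V X ω)) *ᵥ u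
      = (1 / (I : ℝ)) * condDev (fun i => Γ ⊗ₖ Δ i) (fun i => respCoef W (V i))
        (fun p : Fin P => outerVec u (Pi.single p 1)) T (taskResponses W V X ω)
        (residuals (covVec X) (fun i => Γ ⊗ₖ Δ i) (fun i => respCoef W (V i)) ω) := by
  rw [sub_mulVec, sub_mulVec, dotProduct_sub, dotProduct_sub, dotProduct_AHat, condSignal,
    dotProduct_weightedReg, smul_mulVec, dotProduct_smul, smul_eq_mul, noiseCoef,
    mul_comm (avg _), ← avg_const_mul, ← avg_sub, ← avg_sub, condDev, avg]
  congr 1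
  refine Finset.sum_congr rfl fun i _ => ?_
  rw [← sum_sq_outerVec_single_dotProduct_regCoef, trace, Finset.mul_sum, Finset.mul_sum,
    Finset.mul_sum, ← Finset.sum_sub_distrib, ← Finset.sum_sub_distrib]
  refine Finset.sum_congr rfl fun p _ => ?_
  have hrecombine := sum_responses_mul_dotProduct (covVec X) (fun i => Γ ⊗ₖ Δ i)
    (fun i => respCoef W (V i)) (outerVec u (Pi.single p 1)) T i ω
  rw [hrecombine, respVar_residualForm (hΓ.kronecker (hΔ i)),
    respVar_kronecker_outerVec_single, diag_apply, sampleVar]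
  ring

end Model

/-! ### The coefficients in the sample size -/

section Coefficients

variable {I B P R : ℕ} {Γ : Matrix (Fin B) (Fin B) ℝ} {Δ : Fin I → Matrix (Fin P) (Fin P) ℝ}
  {W : Matrix (Fin B) (Fin R) ℝ} {V : Fin I → Matrix (Fin P) (Fin R) ℝ}

lemma rank_bounds_of_lamSignal_pos (hlam : 0 < lamSignal Γ Δ W V) : 1 ≤ R ∧ R ≤ B := by
  by_contra h
  rw [lamSignal, eig_eq_zero fun h' => h h'.2] at hlam
  exact lt_irrefl _ hlam

lemma eig_pos (hΓ : Γ.PosDef) (hB : 1 ≤ B) : 0 < eig Γ B := by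
  rw [eig, dif_pos ⟨hΓ.1, hB, le_rfl⟩]
  have := hΓ.eigenvalues_pos ((Fintype.equivOfCardEq (Fintype.card_fin _))
    ⟨B - 1, by rw [Fintype.card_fin]; omega⟩)
  simpa [IsHermitian.eigenvalues] using this

lemma eig_le_specNorm (hΓ : Γ.IsHermitian) (hB : 1 ≤ B) : eig Γ B ≤ specNorm Γ := by
  have h := (eig_mul_dotProduct_le hΓ (Pi.single (⟨0, hB⟩ : Fin B) 1)).trans
    (dotProduct_mulVec_self_le Γ _)
  simpa using h

lemma one_le_kappa (hΓ : Γ.PosDef) (hB : 1 ≤ B) : 1 ≤ kappa Γ := by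
  rw [kappa, one_le_div (eig_pos hΓ hB)]; exact eig_le_specNorm hΓ.1 hB

lemma alphaCoef_nonneg : 0 ≤ alphaCoef Γ Δ W V :=
  div_nonneg (avg_nonneg fun _ => sq_nonneg _) (sq_nonneg _)

lemma muCoef_nonneg : 0 ≤ muCoef Γ Δ W V := div_nonneg (Real.sqrt_nonneg _) (sq_nonneg _)

lemma max_nuCoef_nonneg : 0 ≤ max (nuCoef Γ Δ W V) (nuCoef Γ Δ W V ^ 2) :=
  le_max_of_le_right (sq_nonneg _)

lemma psiCoef_nonneg : 0 ≤ psiCoef Δ :=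
  div_nonneg (avg_nonneg fun _ => sq_nonneg _) (sq_nonneg _)

lemma max_kappa_mul_nonneg : 0 ≤ max (kappa Γ * etaCoef Γ Δ W V * chiCoef Δ)
    (kappa Γ ^ 2 * etaCoef Γ Δ W V ^ 2 * psiCoef Δ) :=
  le_max_of_le_right (mul_nonneg (by positivity) psiCoef_nonneg)

lemma alphaCoef_le_kPrime : alphaCoef Γ Δ W V ≤ kPrime Γ Δ W V 1 1 1 1 := by
  rw [kPrime]
  linarith [muCoef_nonneg (Γ := Γ) (Δ := Δ) (W := W) (V := V),
    max_nuCoef_nonneg (Γ := Γ) (Δ := Δ) (W := W) (V := V),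
    max_kappa_mul_nonneg (Γ := Γ) (Δ := Δ) (W := W) (V := V)]

lemma max_nuCoef_le_kPrime :
    max (nuCoef Γ Δ W V) (nuCoef Γ Δ W V ^ 2) ≤ kPrime Γ Δ W V 1 1 1 1 := by
  rw [kPrime]
  linarith [alphaCoef_nonneg (Γ := Γ) (Δ := Δ) (W := W) (V := V),
    muCoef_nonneg (Γ := Γ) (Δ := Δ) (W := W) (V := V),
    max_kappa_mul_nonneg (Γ := Γ) (Δ := Δ) (W := W) (V := V)]

lemma max_kappa_mul_le_kPrime :
    max (kappa Γ * etaCoef Γ Δ W V * chiCoef Δ) (kappa Γ ^ 2 * etaCoef Γ Δ W V ^ 2 * psiCoef Δ)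
      ≤ kPrime Γ Δ W V 1 1 1 1 := by
  rw [kPrime]
  linarith [alphaCoef_nonneg (Γ := Γ) (Δ := Δ) (W := W) (V := V),
    muCoef_nonneg (Γ := Γ) (Δ := Δ) (W := W) (V := V),
    max_nuCoef_nonneg (Γ := Γ) (Δ := Δ) (W := W) (V := V),
    max_kappa_mul_nonneg (Γ := Γ) (Δ := Δ) (W := W) (V := V)]

lemma avg_Lcoef (hlam : 0 < lamSignal Γ Δ W V) :
    avg (fun i => Lcoef Γ Δ W V i) = etaCoef Γ Δ W V * lamSignal Γ Δ W V := by
  rw [etaCoef, div_mul_cancel₀ _ hlam.ne']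

lemma avg_Lcoef_sq (hlam : 0 < lamSignal Γ Δ W V) :
    avg (fun i => Lcoef Γ Δ W V i ^ 2) = alphaCoef Γ Δ W V * lamSignal Γ Δ W V ^ 2 := by
  rw [alphaCoef, div_mul_cancel₀ _ (by positivity)]

lemma Lcoef_le_nuCoef_mul (hlam : 0 < lamSignal Γ Δ W V) (i : Fin I) :
    Lcoef Γ Δ W V i ≤ nuCoef Γ Δ W V * lamSignal Γ Δ W V := by
  rw [nuCoef, div_mul_cancel₀ _ hlam.ne']
  exact le_ciSup (Set.finite_range fun i => Lcoef Γ Δ W V i).bddAbove i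

lemma lamSignal_le_avg_Lcoef (hΓ : Γ.IsHermitian) (hΔ : ∀ i, (Δ i).IsHermitian)
    (hlam : 0 < lamSignal Γ Δ W V) : lamSignal Γ Δ W V ≤ avg (fun i => Lcoef Γ Δ W V i) := by
  obtain ⟨h1R, hRB⟩ := rank_bounds_of_lamSignal_pos hlam
  obtain ⟨Y, hY, hYeig⟩ := exists_frame_eig_le (isHermitian_signal (W := W) (V := V) hΓ hΔ) hRB
  set a : Fin R → ℝ := Pi.single ⟨0, h1R⟩ 1 with ha
  have hYa : 0 < Y *ᵥ a ⬝ᵥ Y *ᵥ a := by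
    refine lt_of_le_of_ne (dotProduct_self_nonneg _) fun h0 => ?_
    have hentry := congrFun (hY a (dotProduct_self_eq_zero.1 h0.symm)) ⟨0, h1R⟩
    simp [ha] at hentry
  have hquad := hYeig a
  rw [dotProduct_signal hΓ hΔ] at hquad
  have hle := hquad.trans (avg_mono fun i => dotProduct_signalMat_le Γ Δ W V i (Y *ᵥ a))
  simp_rw [mul_comm (Lcoef _ _ _ _ _), avg_const_mul] at hle
  rw [mul_comm] at hle
  exact le_of_mul_le_mul_left hle hYa

lemma one_le_etaCoef (hΓ : Γ.IsHermitian) (hΔ : ∀ i, (Δ i).IsHermitian)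
    (hlam : 0 < lamSignal Γ Δ W V) : 1 ≤ etaCoef Γ Δ W V := by
  rw [etaCoef, one_le_div hlam]; exact lamSignal_le_avg_Lcoef hΓ hΔ hlam

lemma exists_Lcoef_pos (hΓ : Γ.IsHermitian) (hΔ : ∀ i, (Δ i).IsHermitian)
    (hlam : 0 < lamSignal Γ Δ W V) : ∃ i, 0 < Lcoef Γ Δ W V i := by
  by_contra! h
  have havg : avg (fun i => Lcoef Γ Δ W V i) ≤ 0 :=
    mul_nonpos_of_nonneg_of_nonpos (by positivity) (Finset.sum_nonpos fun i _ => h i)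
  linarith [lamSignal_le_avg_Lcoef hΓ hΔ hlam]

lemma tasks_ne_zero (hΓ : Γ.IsHermitian) (hΔ : ∀ i, (Δ i).IsHermitian)
    (hlam : 0 < lamSignal Γ Δ W V) : I ≠ 0 := by
  obtain ⟨i, _⟩ := exists_Lcoef_pos hΓ hΔ hlam
  exact (Nat.zero_lt_of_lt i.2).ne'

lemma etaCoef_le_nuCoef (hΓ : Γ.IsHermitian) (hΔ : ∀ i, (Δ i).IsHermitian)
    (hlam : 0 < lamSignal Γ Δ W V) : etaCoef Γ Δ W V ≤ nuCoef Γ Δ W V := by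
  have h := avg_mono (Lcoef_le_nuCoef_mul hlam)
  rw [avg_const (tasks_ne_zero hΓ hΔ hlam), avg_Lcoef hlam] at h
  exact le_of_mul_le_mul_right h hlam

lemma one_le_nuCoef (hΓ : Γ.IsHermitian) (hΔ : ∀ i, (Δ i).IsHermitian)
    (hlam : 0 < lamSignal Γ Δ W V) : 1 ≤ nuCoef Γ Δ W V :=
  (one_le_etaCoef hΓ hΔ hlam).trans (etaCoef_le_nuCoef hΓ hΔ hlam)

lemma exists_cov_ne_zero (hΓ : Γ.IsHermitian) (hΔ : ∀ i, (Δ i).IsHermitian)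
    (hlam : 0 < lamSignal Γ Δ W V) : ∃ i, Δ i ≠ 0 := by
  obtain ⟨i, hi⟩ := exists_Lcoef_pos hΓ hΔ hlam
  refine ⟨i, fun h0 => ?_⟩
  have hzero : specNorm (0 : Matrix (Fin P) (Fin P) ℝ) = 0 := by simp [specNorm]
  simp [Lcoef, h0, hzero] at hi

lemma covariates_ne_zero (hne : ∃ i, Δ i ≠ 0) : P ≠ 0 := by
  obtain ⟨i, hi⟩ := hne
  rintro rfl
  exact hi (Subsingleton.elim _ _)

lemma traceScale_pos (hΔ : ∀ i, (Δ i).PosSemidef) (hne : ∃ i, Δ i ≠ 0) : 0 < traceScale Δ := by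
  have hP : (0 : ℝ) < P := by exact_mod_cast Nat.pos_of_ne_zero (covariates_ne_zero hne)
  obtain ⟨i, hi⟩ := hne
  have hI : (0 : ℝ) < I := by exact_mod_cast Nat.zero_lt_of_lt i.2
  refine mul_pos (by positivity) (Finset.sum_pos' (fun j _ => (hΔ j).trace_nonneg)
    ⟨i, Finset.mem_univ i, lt_of_le_of_ne (hΔ i).trace_nonneg fun h => hi ?_⟩)
  exact (hΔ i).trace_eq_zero_iff.1 h.symm

lemma specNorm_le_chiCoef_mul (hts : 0 < traceScale Δ) (i : Fin I) :
    specNorm (Δ i) ≤ chiCoef Δ * traceScale Δ := by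
  rw [chiCoef, div_mul_cancel₀ _ hts.ne']
  exact le_ciSup (Set.finite_range fun i => specNorm (Δ i)).bddAbove i

lemma chiCoef_pos (hts : 0 < traceScale Δ) (hne : ∃ i, Δ i ≠ 0) : 0 < chiCoef Δ := by
  obtain ⟨i, hi⟩ := hne
  exact pos_of_mul_pos_left ((specNorm_pos_of_ne_zero hi).trans_le
    (specNorm_le_chiCoef_mul hts i)) hts.le

lemma avg_specNorm_sq (hts : 0 < traceScale Δ) :
    avg (fun i => specNorm (Δ i) ^ 2) = psiCoef Δ * traceScale Δ ^ 2 := by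
  rw [psiCoef, div_mul_cancel₀ _ (pow_pos hts 2).ne']

end Coefficients

/-! ### Tail bounds for the empirical second moments of the responses -/

section SampleVariance

variable {I T B P R : ℕ} {Γ : Matrix (Fin B) (Fin B) ℝ} {Δ : Fin I → Matrix (Fin P) (Fin P) ℝ}
  {W : Matrix (Fin B) (Fin R) ℝ} {V : Fin I → Matrix (Fin P) (Fin R) ℝ}
  {Ω : Type*} {X : Fin I → Fin T → Ω → Matrix (Fin B) (Fin P) ℝ}

lemma sum_mul_sq_sub_eq_avg_sampleVar (hI : I ≠ 0) (hT : T ≠ 0) (w σ : Fin I → ℝ)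
    (r : Fin I × Fin T → ℝ) :
    ∑ j : Fin I × Fin T, w j.1 / (I * T) * (r j ^ 2 - σ j.1)
      = avg fun i => w i * (sampleVar r i - σ i) := by
  have hI' : (I : ℝ) ≠ 0 := by exact_mod_cast hI
  have hT' : (T : ℝ) ≠ 0 := by exact_mod_cast hT
  rw [Fintype.sum_prod_type, avg, Finset.mul_sum]
  refine Finset.sum_congr rfl fun i _ => ?_
  dsimp only
  rw [← Finset.mul_sum, Finset.sum_sub_distrib, sampleVar, Finset.sum_const, Finset.card_univ,
    Fintype.card_fin, nsmul_eq_mul]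
  field_simp

variable [MeasurableSpace Ω] {μ : Measure Ω}

lemma measure_abs_avg_sampleVar_sub_ge_le (hΓ : Γ.PosSemidef) (hΔ : ∀ i, (Δ i).PosSemidef)
    (hX : GaussianModel μ Γ Δ X) (hI : I ≠ 0) (hT : T ≠ 0) {w : Fin I → ℝ} (hw : ∀ i, 0 ≤ w i)
    {M N x s : ℝ} (hM : 0 < M) (hwM : ∀ i, w i * responseVar Γ (Δ i) W (V i) ≤ M)
    (hwN : avg (fun i => (w i * responseVar Γ (Δ i) W (V i)) ^ 2) ≤ N) (hs : 0 ≤ s)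
    (hNx : 8 * N * x ≤ I * T * s ^ 2) (hMx : 8 * M * x ≤ I * T * s) :
    μ {ω | s ≤ |avg fun i => w i *
        (sampleVar (taskResponses W V X ω) i - responseVar Γ (Δ i) W (V i))|}
      ≤ 2 * ENNReal.ofReal (Real.exp (-x)) := by
  have hsq : ∑ j : Fin I × Fin T, 2 * (w j.1 / (I * T) * responseVar Γ (Δ j.1) W (V j.1)) ^ 2
      ≤ 2 * N / (I * T) := by
    calc _ = 2 / (I * T) * avg (fun i => (w i * responseVar Γ (Δ i) W (V i)) ^ 2) := by
          rw [Fintype.sum_prod_type, ← avg_const_mul, avg, Finset.mul_sum]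
          refine Finset.sum_congr rfl fun i _ => ?_
          dsimp only
          rw [Finset.sum_const, Finset.card_univ, Fintype.card_fin, nsmul_eq_mul]
          field_simp
      _ ≤ 2 / (I * T) * N := by gcongr
      _ = _ := by ring
  have key := measure_abs_sum_sq_response_ge_le hX.hasLaw_covVec
    (fun j => hΓ.kronecker (hΔ j.1)) hX.iIndepFun_covVec (fun j => respCoef W (V j.1))
    (β := fun j => w j.1 / (I * T)) (fun j => div_nonneg (hw j.1) (by positivity))
    (b := 4 * M / (I * T)) (by positivity) (fun j => by
      rw [div_mul_eq_mul_div, mul_div_assoc']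
      exact div_le_div_of_nonneg_right (by linarith [hwM j.1]) (by positivity))
    hsq hs (x := x)
    (by
      rw [mul_div_assoc', div_mul_eq_mul_div, div_le_iff₀ (by positivity)]
      linarith)
    (by
      rw [mul_div_assoc', div_mul_eq_mul_div, div_le_iff₀ (by positivity)]
      linarith)
  simp_rw [← sum_mul_sq_sub_eq_avg_sampleVar hI hT w fun i => responseVar Γ (Δ i) W (V i)]
  exact key

lemma sampleVar_taskResponses_ae_eq_zero (hΓ : Γ.PosSemidef) (hΔ : ∀ i, (Δ i).PosSemidef)
    (hX : GaussianModel μ Γ Δ X) {i : Fin I} (hi : responseVar Γ (Δ i) W (V i) = 0) :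
    ∀ᵐ ω ∂μ, sampleVar (taskResponses W V X ω) i = 0 := by
  have hresp : ∀ᵐ ω ∂μ, ∀ t, taskResponses W V X ω (i, t) = 0 :=
    ae_all_iff.2 fun t =>
      dotProduct_ae_eq_zero (hX.hasLaw_covVec (i, t)) (hΓ.kronecker (hΔ i)) hi
  filter_upwards [hresp] with ω hω
  simp [sampleVar, hω]

lemma measure_lt_sampleVar_le (hΓ : Γ.PosSemidef) (hΔ : ∀ i, (Δ i).PosSemidef)
    (hX : GaussianModel μ Γ Δ X) (hT : T ≠ 0) {Λ : ℝ} (hΛ : 1 ≤ Λ) (i : Fin I) :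
    μ {ω | 17 * Λ * responseVar Γ (Δ i) W (V i) < sampleVar (taskResponses W V X ω) i}
      ≤ 2 * ENNReal.ofReal (Real.exp (-(2 * Λ * T))) := by
  rcases (responseVar_nonneg hΓ (hΔ i) W (V i)).eq_or_lt with hσ | hσ
  · refine le_of_eq_of_le (measure_eq_zero_iff_ae_notMem.2 ?_) zero_le
    filter_upwards [sampleVar_taskResponses_ae_eq_zero hΓ hΔ hX hσ.symm] with ω hω
    simp [hω, ← hσ]
  have hI : I ≠ 0 := (Nat.zero_lt_of_lt i.2).ne'
  have hsingle (f : Fin I → ℝ) : avg (fun k => Pi.single (M := fun _ => ℝ) i (I : ℝ) k * f k)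
      = f i := by
    rw [avg, Fintype.sum_eq_single i fun k hk => by rw [Pi.single_eq_of_ne hk, zero_mul],
      Pi.single_eq_same]
    field_simp
  set σ := responseVar Γ (Δ i) W (V i)
  have key := measure_abs_avg_sampleVar_sub_ge_le (W := W) (V := V) hΓ hΔ hX hI hT
    (w := Pi.single i (I : ℝ)) (M := I * σ) (N := I * σ ^ 2) (x := 2 * Λ * T) (s := 16 * Λ * σ)
    (fun k => by rcases eq_or_ne k i with rfl | hk <;> simp [*])
    (by positivity)
    (fun k => by
      rcases eq_or_ne k i with rfl | hk
      · simp [σ]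
      · rw [Pi.single_eq_of_ne hk, zero_mul]; positivity)
    (by
      simp_rw [mul_pow, sq (Pi.single (M := fun _ => ℝ) i (I : ℝ) _), mul_assoc]
      rw [hsingle, Pi.single_eq_same])
    (by positivity)
    (by
      calc 8 * (I * σ ^ 2) * (2 * Λ * T) = 16 * (I * T * σ ^ 2 * Λ) * 1 := by ring
        _ ≤ 256 * (I * T * σ ^ 2 * Λ) * Λ := by gcongr; norm_num
        _ = _ := by ring)
    (le_of_eq (by ring))
  refine (measure_mono fun ω (hω : 17 * Λ * σ < _) => ?_).trans key
  rw [Set.mem_ofPred_eq, hsingle fun k => sampleVar (taskResponses W V X ω) k - _]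
  refine le_trans ?_ (le_abs_self _)
  nlinarith

lemma measure_exists_lt_sampleVar_le (hΓ : Γ.PosSemidef) (hΔ : ∀ i, (Δ i).PosSemidef)
    (hX : GaussianModel μ Γ Δ X) (hT : T ≠ 0) {Λ : ℝ} (hΛ : 1 ≤ Λ) :
    μ {ω | ∃ i, 17 * Λ * responseVar Γ (Δ i) W (V i) < sampleVar (taskResponses W V X ω) i}
      ≤ I * (2 * ENNReal.ofReal (Real.exp (-(2 * Λ * T)))) := by
  rw [Set.ofPred_exists]
  refine (measure_iUnion_fintype_le μ _).trans ?_
  refine (Finset.sum_le_sum fun i _ => measure_lt_sampleVar_le hΓ hΔ hX hT hΛ i).trans ?_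
  simp

lemma noiseWeight_mul_responseVar_le (i : Fin I) :
    Lcoef Γ Δ W V i * (specNorm Γ * specNorm (Δ i)) * responseVar Γ (Δ i) W (V i)
      ≤ R * Lcoef Γ Δ W V i ^ 2 := by
  have h := mul_le_mul_of_nonneg_left (responseVar_mul_le Γ Δ W V i) (Lcoef_nonneg Γ Δ W V i)
  linarith

lemma Lcoef_sq_le (hlam : 0 < lamSignal Γ Δ W V) (i : Fin I) :
    Lcoef Γ Δ W V i ^ 2 ≤ nuCoef Γ Δ W V ^ 2 * lamSignal Γ Δ W V ^ 2 := by
  rw [← mul_pow]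
  exact pow_le_pow_left₀ (Lcoef_nonneg Γ Δ W V i) (Lcoef_le_nuCoef_mul hlam i) 2

lemma avg_Lcoef_pow_four_le (hlam : 0 < lamSignal Γ Δ W V) :
    avg (fun i => Lcoef Γ Δ W V i ^ 4)
      ≤ nuCoef Γ Δ W V ^ 2 * alphaCoef Γ Δ W V * lamSignal Γ Δ W V ^ 4 := by
  calc _ ≤ avg fun i => nuCoef Γ Δ W V ^ 2 * lamSignal Γ Δ W V ^ 2 * Lcoef Γ Δ W V i ^ 2 :=
        avg_mono fun i => by
          rw [show Lcoef Γ Δ W V i ^ 4 = Lcoef Γ Δ W V i ^ 2 * Lcoef Γ Δ W V i ^ 2 by ring]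
          exact mul_le_mul_of_nonneg_right (Lcoef_sq_le hlam i) (sq_nonneg _)
    _ = _ := by rw [avg_const_mul, avg_Lcoef_sq hlam]; ring

lemma measure_abs_avg_Lcoef_mul_ge_le (hΓ : Γ.PosSemidef) (hΔ : ∀ i, (Δ i).PosSemidef)
    (hlam : 0 < lamSignal Γ Δ W V) (hX : GaussianModel μ Γ Δ X) (hT : T ≠ 0)
    (hB : nuCoef Γ Δ W V ^ 2 * B ≤ I * T) :
    μ {ω | 8 * R * lamSignal Γ Δ W V ^ 2 * (alphaCoef Γ Δ W V + 1)
        ≤ |avg fun i => Lcoef Γ Δ W V i * (specNorm Γ * specNorm (Δ i)) *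
          (sampleVar (taskResponses W V X ω) i - responseVar Γ (Δ i) W (V i))|}
      ≤ 2 * ENNReal.ofReal (Real.exp (-(B : ℝ))) := by
  have hR : (1 : ℝ) ≤ R := by exact_mod_cast (rank_bounds_of_lamSignal_pos hlam).1
  have hν : 0 < nuCoef Γ Δ W V :=
    one_pos.trans_le (one_le_nuCoef hΓ.1 (fun i => (hΔ i).1) hlam)
  have hα := alphaCoef_nonneg (Γ := Γ) (Δ := Δ) (W := W) (V := V)
  have hw (i : Fin I) : 0 ≤ Lcoef Γ Δ W V i * (specNorm Γ * specNorm (Δ i)) :=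
    mul_nonneg (Lcoef_nonneg Γ Δ W V i) (mul_nonneg (specNorm_nonneg _) (specNorm_nonneg _))
  refine measure_abs_avg_sampleVar_sub_ge_le hΓ hΔ hX (tasks_ne_zero hΓ.1 (fun i => (hΔ i).1) hlam)
    hT hw (M := R * (nuCoef Γ Δ W V ^ 2 * lamSignal Γ Δ W V ^ 2))
    (N := R ^ 2 * (nuCoef Γ Δ W V ^ 2 * alphaCoef Γ Δ W V * lamSignal Γ Δ W V ^ 4))
    (by positivity) (fun i => ?_) ?_ (by positivity) ?_ ?_
  · exact (noiseWeight_mul_responseVar_le i).trans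
      (mul_le_mul_of_nonneg_left (Lcoef_sq_le hlam i) (by positivity))
  · calc _ ≤ avg fun i => R ^ 2 * Lcoef Γ Δ W V i ^ 4 := avg_mono fun i => by
          refine (pow_le_pow_left₀ (mul_nonneg (hw i) (responseVar_nonneg hΓ (hΔ i) _ _))
            (noiseWeight_mul_responseVar_le i) 2).trans_eq (by ring)
      _ ≤ _ := by
          rw [avg_const_mul]
          exact mul_le_mul_of_nonneg_left (avg_Lcoef_pow_four_le hlam) (by positivity)
  · generalize alphaCoef Γ Δ W V = α at hα ⊢
    calc _ = 8 * R ^ 2 * lamSignal Γ Δ W V ^ 4 * α * (nuCoef Γ Δ W V ^ 2 * B) := by ring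
      _ ≤ 64 * R ^ 2 * lamSignal Γ Δ W V ^ 4 * (α + 1) ^ 2 * (I * T) := by
          gcongr
          · norm_num
          · nlinarith
      _ = _ := by ring
  · calc _ = 8 * R * lamSignal Γ Δ W V ^ 2 * (nuCoef Γ Δ W V ^ 2 * B) := by ring
      _ ≤ 8 * R * lamSignal Γ Δ W V ^ 2 * (I * T * (alphaCoef Γ Δ W V + 1)) := by
          refine mul_le_mul_of_nonneg_left (hB.trans ?_) (by positivity)
          exact le_mul_of_one_le_right (by positivity) (by linarith)
      _ = _ := by ring

lemma measure_lt_avg_sampleVar_le (hΓ : Γ.PosSemidef) (hΔ : ∀ i, (Δ i).PosSemidef)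
    (hlam : 0 < lamSignal Γ Δ W V) (hX : GaussianModel μ Γ Δ X) (hT : T ≠ 0)
    (hB : nuCoef Γ Δ W V ^ 2 * B ≤ I * T) :
    μ {ω | 17 * R * lamSignal Γ Δ W V ^ 2 * (alphaCoef Γ Δ W V + 1)
        < avg fun i => sampleVar (taskResponses W V X ω) i *
          (Lcoef Γ Δ W V i * (specNorm Γ * specNorm (Δ i)))}
      ≤ 2 * ENNReal.ofReal (Real.exp (-(B : ℝ))) := by
  refine (measure_mono fun ω hω => ?_).trans
    (measure_abs_avg_Lcoef_mul_ge_le hΓ hΔ hlam hX hT hB)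
  rw [Set.mem_ofPred_eq] at hω ⊢
  refine le_trans ?_ (le_abs_self _)
  have hmean : avg (fun i => Lcoef Γ Δ W V i * (specNorm Γ * specNorm (Δ i)) *
      responseVar Γ (Δ i) W (V i)) ≤ R * (alphaCoef Γ Δ W V * lamSignal Γ Δ W V ^ 2) := by
    rw [← avg_Lcoef_sq hlam, ← avg_const_mul]
    exact avg_mono noiseWeight_mul_responseVar_le
  have hslack : 0 ≤ R * lamSignal Γ Δ W V ^ 2 * (alphaCoef Γ Δ W V + 1) := by
    have := alphaCoef_nonneg (Γ := Γ) (Δ := Δ) (W := W) (V := V)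
    positivity
  have hRlam : 0 ≤ R * lamSignal Γ Δ W V ^ 2 := by positivity
  simp_rw [mul_sub]
  rw [avg_sub]
  simp_rw [mul_comm (sampleVar _ _)] at hω
  linarith

end SampleVariance

/-! ### Tail bounds for the quadratic forms of the estimators -/

section QuadraticForms

variable {I T B P R : ℕ} {Γ : Matrix (Fin B) (Fin B) ℝ} {Δ : Fin I → Matrix (Fin P) (Fin P) ℝ}
  {W : Matrix (Fin B) (Fin R) ℝ} {V : Fin I → Matrix (Fin P) (Fin R) ℝ}
  {Ω : Type*} {X : Fin I → Fin T → Ω → Matrix (Fin B) (Fin P) ℝ}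

lemma sum_trace_eq_mul_traceScale (hI : I ≠ 0) (hP : P ≠ 0) :
    ∑ i, (Δ i).trace = I * P * traceScale Δ := by
  rw [traceScale]
  field_simp

lemma sum_sq_sub_respVar_eq_mul_GammaHat (hI : I ≠ 0) (hT : T ≠ 0) (hP : P ≠ 0)
    (x : Fin I → Fin T → Matrix (Fin B) (Fin P) ℝ) (u : Fin B → ℝ) :
    ∑ j : Fin I × Fin T, ∑ p, ((outerVec u (Pi.single p 1) ⬝ᵥ (vecOf (x j.1 j.2)).ofLp) ^ 2
        - respVar (Γ ⊗ₖ Δ j.1) (outerVec u (Pi.single p 1)))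
      = I * T * P * (u ⬝ᵥ (GammaHat x - traceScale Δ • Γ) *ᵥ u) := by
  have hmean : ∑ j : Fin I × Fin T, ∑ p, respVar (Γ ⊗ₖ Δ j.1) (outerVec u (Pi.single p 1))
      = I * T * P * (traceScale Δ * (u ⬝ᵥ Γ *ᵥ u)) := by
    have htrace (i : Fin I) : ∑ p, Δ i p p = (Δ i).trace := rfl
    simp only [respVar_kronecker_outerVec_single, ← Finset.mul_sum, htrace]
    rw [Fintype.sum_prod_type]
    simp only [Finset.sum_const, Finset.card_univ, Fintype.card_fin, nsmul_eq_mul,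
      ← Finset.mul_sum, sum_trace_eq_mul_traceScale hI hP]
    ring
  simp only [Finset.sum_sub_distrib]
  rw [hmean, sub_mulVec, dotProduct_sub, dotProduct_GammaHat, smul_mulVec, dotProduct_smul,
    smul_eq_mul, mul_sub, ← mul_assoc _ (1 / _), mul_one_div_cancel (by positivity), one_mul]

lemma sum_sq_specNorm_mul_eq (hI : I ≠ 0) (hts : 0 < traceScale Δ) (n g : ℝ) :
    ∑ j : Fin I × Fin T, 2 * n * (g * specNorm (Δ j.1)) ^ 2
      = 2 * n * (I * T) * (g ^ 2 * (psiCoef Δ * traceScale Δ ^ 2)) := by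
  rw [Fintype.sum_prod_type]
  simp only [Finset.sum_const, Finset.card_univ, Fintype.card_fin, nsmul_eq_mul, mul_pow,
    ← Finset.mul_sum]
  rw [sum_eq_mul_avg hI, avg_specNorm_sq hts]
  ring

variable [MeasurableSpace Ω] {μ : Measure Ω}

lemma measure_lt_abs_GammaHat_le (hΓ : Γ.PosSemidef) (hΓ0 : Γ ≠ 0) (hΔ : ∀ i, (Δ i).PosSemidef)
    (hne : ∃ i, Δ i ≠ 0) (hX : GaussianModel μ Γ Δ X) (hT : T ≠ 0) {e : ℝ} (he : 0 ≤ e)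
    (hψ : 32 * psiCoef Δ * B ≤ I * T * P * e ^ 2) (hχ : 32 * chiCoef Δ * B ≤ I * T * P * e)
    {u : Fin B → ℝ} (hu : u ⬝ᵥ u = 1) :
    μ {ω | traceScale Δ * specNorm Γ * e
        < |u ⬝ᵥ (GammaHat (fun i t => X i t ω) - traceScale Δ • Γ) *ᵥ u|}
      ≤ 2 * ENNReal.ofReal (Real.exp (-(4 * B : ℝ))) := by
  have hI : I ≠ 0 := by
    rintro rfl
    exact hne.choose.elim0
  have hP := covariates_ne_zero hne
  have hts := traceScale_pos hΔ hne
  have hχ0 := chiCoef_pos hts hne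
  have hg := specNorm_pos_of_ne_zero hΓ0
  have key := measure_abs_quadratic_ge_le hX.hasLaw_covVec (fun j => hΓ.kronecker (hΔ j.1))
    hX.iIndepFun_covVec (fun _ p => outerVec u (Pi.single p 1))
    (fun j w => respVar_sum_smul_outerVec_le hΓ (Δ j.1) hu w)
    (b := 4 * (specNorm Γ * (chiCoef Δ * traceScale Δ))) (x := 4 * B)
    (t := I * T * P * (traceScale Δ * specNorm Γ * e)) (by positivity)
    (fun j => by gcongr; exact specNorm_le_chiCoef_mul hts j.1)
    (sum_sq_specNorm_mul_eq hI hts _ (specNorm Γ)).le (by positivity)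
    (by
      rw [Fintype.card_fin]
      calc _ = I * T * P * (traceScale Δ * specNorm Γ) ^ 2 * (32 * psiCoef Δ * B) := by ring
        _ ≤ I * T * P * (traceScale Δ * specNorm Γ) ^ 2 * (I * T * P * e ^ 2) := by gcongr
        _ = _ := by ring)
    (by
      calc _ = traceScale Δ * specNorm Γ * (32 * chiCoef Δ * B) := by ring
        _ ≤ traceScale Δ * specNorm Γ * (I * T * P * e) := by gcongr
        _ = _ := by ring)
  refine (measure_mono fun ω hω => ?_).trans key
  rw [Set.mem_ofPred_eq] at hω ⊢
  rw [sum_sq_sub_respVar_eq_mul_GammaHat hI hT hP fun i t => X i t ω, abs_mul,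
    abs_of_pos (by positivity : (0 : ℝ) < I * T * P)]
  gcongr

lemma measure_lt_abs_varDeviation_le (hΓ : Γ.PosSemidef) (hΔ : ∀ i, (Δ i).PosSemidef)
    (hlam : 0 < lamSignal Γ Δ W V) (hX : GaussianModel μ Γ Δ X) (hT : T ≠ 0) {θ : ℝ} (hθ : 0 ≤ θ)
    (hα : alphaCoef Γ Δ W V * B ≤ θ ^ 2 * (I * T)) (hν : nuCoef Γ Δ W V * B ≤ θ * (I * T))
    {u : Fin B → ℝ} (hu : u ⬝ᵥ u = 1) :
    μ {ω | 32 * θ * lamSignal Γ Δ W V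
        < |u ⬝ᵥ varDeviation Γ Δ W V (taskResponses W V X ω) *ᵥ u|}
      ≤ 2 * ENNReal.ofReal (Real.exp (-(4 * B : ℝ))) := by
  have hν0 : 0 < nuCoef Γ Δ W V :=
    one_pos.trans_le (one_le_nuCoef hΓ.1 (fun i => (hΔ i).1) hlam)
  set A := fun i => u ⬝ᵥ (regMat Γ (Δ i) W (V i) * (regMat Γ (Δ i) W (V i))ᵀ) *ᵥ u
  have hA (i : Fin I) : 0 ≤ A i := dotProduct_mul_transpose_mulVec_nonneg _ _
  have hσ (i : Fin I) := responseVar_nonneg hΓ (hΔ i) W (V i)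
  have hweight (i : Fin I) : responseVar Γ (Δ i) W (V i) * A i * responseVar Γ (Δ i) W (V i)
      ≤ Lcoef Γ Δ W V i := by
    calc _ = responseVar Γ (Δ i) W (V i) ^ 2 * A i := by ring
      _ ≤ Lcoef Γ Δ W V i * (u ⬝ᵥ u) := by
          rw [responseVar_sq_mul_regMat hΓ (hΔ i)]
          exact dotProduct_signalMat_le Γ Δ W V i u
      _ = _ := by rw [hu, mul_one]
  have key := measure_abs_avg_sampleVar_sub_ge_le hΓ hΔ hX
    (tasks_ne_zero hΓ.1 (fun i => (hΔ i).1) hlam) hT (fun i => mul_nonneg (hσ i) (hA i))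
    (M := nuCoef Γ Δ W V * lamSignal Γ Δ W V)
    (N := alphaCoef Γ Δ W V * lamSignal Γ Δ W V ^ 2) (x := 4 * B)
    (s := 32 * θ * lamSignal Γ Δ W V) (by positivity)
    (fun i => (hweight i).trans (Lcoef_le_nuCoef_mul hlam i))
    (by
      rw [← avg_Lcoef_sq hlam]
      exact avg_mono fun i => pow_le_pow_left₀
        (mul_nonneg (mul_nonneg (hσ i) (hA i)) (hσ i)) (hweight i) 2)
    (by positivity)
    (by
      calc _ = 32 * lamSignal Γ Δ W V ^ 2 * (alphaCoef Γ Δ W V * B) := by ring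
        _ ≤ 1024 * lamSignal Γ Δ W V ^ 2 * (θ ^ 2 * (I * T)) := by
            refine mul_le_mul ?_ hα (mul_nonneg alphaCoef_nonneg (Nat.cast_nonneg B))
              (by positivity)
            gcongr
            norm_num
        _ = _ := by ring)
    (by
      calc _ = 32 * lamSignal Γ Δ W V * (nuCoef Γ Δ W V * B) := by ring
        _ ≤ 32 * lamSignal Γ Δ W V * (θ * (I * T)) := by gcongr
        _ = _ := by ring)
  refine (measure_mono fun ω hω => ?_).trans key
  rw [Set.mem_ofPred_eq, varDeviation, dotProduct_weightedReg] at hω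
  refine hω.le.trans_eq (congrArg (fun f => |avg f|) (funext fun i => ?_))
  ring

end QuadraticForms

section GoodResponses

variable {I T B P R : ℕ} {Γ : Matrix (Fin B) (Fin B) ℝ} {Δ : Fin I → Matrix (Fin P) (Fin P) ℝ}
  {W : Matrix (Fin B) (Fin R) ℝ} {V : Fin I → Matrix (Fin P) (Fin R) ℝ} {Λ pm : ℝ}

/-- The responses for which the conditional deviation of `Â` is under control: no empirical second
moment exceeds its mean by more than the factor `17 Λ`, and the average that governs the conditional
variance is bounded. -/
def goodResponses (T : ℕ) (Γ : Matrix (Fin B) (Fin B) ℝ) (Δ : Fin I → Matrix (Fin P) (Fin P) ℝ)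
    (W : Matrix (Fin B) (Fin R) ℝ) (V : Fin I → Matrix (Fin P) (Fin R) ℝ) (Λ : ℝ) :
    Set (Fin I × Fin T → ℝ) :=
  {r | (∀ i, sampleVar r i ≤ 17 * Λ * responseVar Γ (Δ i) W (V i)) ∧
    avg (fun i => sampleVar r i * (Lcoef Γ Δ W V i * (specNorm Γ * specNorm (Δ i))))
      ≤ 17 * R * lamSignal Γ Δ W V ^ 2 * (alphaCoef Γ Δ W V + 1)}

lemma measurableSet_goodResponses : MeasurableSet (goodResponses T Γ Δ W V Λ) := by
  have hvar (i : Fin I) : Measurable fun r : Fin I × Fin T → ℝ => sampleVar r i := by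
    unfold sampleVar
    fun_prop
  rw [goodResponses, Set.ofPred_and, Set.ofPred_forall]
  refine (MeasurableSet.iInter fun i => measurableSet_le (hvar i) measurable_const).inter
    (measurableSet_le ?_ measurable_const)
  unfold avg
  fun_prop

lemma sum_sq_div_sq_eq_sampleVar_div (r : Fin I × Fin T → ℝ) (i : Fin I) :
    (∑ t, r (i, t) ^ 2) / (T : ℝ) ^ 2 = sampleVar r i / T := by
  rw [sampleVar, div_div, sq]

lemma specNorm_mul_sampleVar_le (hΛ : 0 ≤ Λ) {r : Fin I × Fin T → ℝ}
    (hr : r ∈ goodResponses T Γ Δ W V Λ) (i : Fin I) :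
    specNorm Γ * specNorm (Δ i) * (sampleVar r i / T) ≤ 17 * Λ * R * Lcoef Γ Δ W V i / T := by
  rw [← mul_div_assoc]
  refine div_le_div_of_nonneg_right ?_ (Nat.cast_nonneg T)
  calc _ ≤ specNorm Γ * specNorm (Δ i) * (17 * Λ * responseVar Γ (Δ i) W (V i)) :=
        mul_le_mul_of_nonneg_left (hr.1 i) (mul_nonneg (specNorm_nonneg _) (specNorm_nonneg _))
    _ = 17 * Λ * (responseVar Γ (Δ i) W (V i) * (specNorm Γ * specNorm (Δ i))) := by ring
    _ ≤ 17 * Λ * (R * Lcoef Γ Δ W V i) :=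
        mul_le_mul_of_nonneg_left (responseVar_mul_le Γ Δ W V i) (by linarith)
    _ = _ := by ring

lemma sum_sq_sampleVar_mul_regCoef_le (hΓ : Γ.PosSemidef) (hΔ : ∀ i, (Δ i).PosSemidef)
    {r : Fin I × Fin T → ℝ} (hr : r ∈ goodResponses T Γ Δ W V Λ) {u : Fin B → ℝ}
    (hu : u ⬝ᵥ u = 1) (i : Fin I) :
    ∑ p, (sampleVar r i * (outerVec u (Pi.single p 1) ⬝ᵥ
      regCoef (Γ ⊗ₖ Δ i) (respCoef W (V i)))) ^ 2 ≤ 289 * Λ ^ 2 * Lcoef Γ Δ W V i := by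
  simp_rw [mul_pow]
  rw [← Finset.mul_sum, sum_sq_outerVec_single_dotProduct_regCoef]
  calc _ ≤ (17 * Λ * responseVar Γ (Δ i) W (V i)) ^ 2 * _ :=
        mul_le_mul_of_nonneg_right (pow_le_pow_left₀ (sampleVar_nonneg r i) (hr.1 i) 2)
          (dotProduct_mul_transpose_mulVec_nonneg _ _)
    _ = 289 * Λ ^ 2 * (responseVar Γ (Δ i) W (V i) ^ 2 *
        (u ⬝ᵥ (regMat Γ (Δ i) W (V i) * (regMat Γ (Δ i) W (V i))ᵀ) *ᵥ u)) := by ring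
    _ ≤ 289 * Λ ^ 2 * (Lcoef Γ Δ W V i * (u ⬝ᵥ u)) := by
        rw [responseVar_sq_mul_regMat hΓ (hΔ i)]
        exact mul_le_mul_of_nonneg_left (dotProduct_signalMat_le Γ Δ W V i u) (by positivity)
    _ = _ := by rw [hu, mul_one]

lemma condVariance_le (hΓ : Γ.PosSemidef) (hΔ : ∀ i, (Δ i).PosSemidef) (hΛ : 0 ≤ Λ)
    {r : Fin I × Fin T → ℝ} (hr : r ∈ goodResponses T Γ Δ W V Λ) {u : Fin B → ℝ}
    (hu : u ⬝ᵥ u = 1) (i : Fin I) :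
    2 * (P : ℝ) * (specNorm Γ * specNorm (Δ i) * (sampleVar r i / T)) ^ 2
        + 4 * (specNorm Γ * specNorm (Δ i) * (sampleVar r i / T)) *
          ∑ p, (sampleVar r i * (outerVec u (Pi.single p 1) ⬝ᵥ
            regCoef (Γ ⊗ₖ Δ i) (respCoef W (V i)))) ^ 2
      ≤ 578 * P * Λ ^ 2 * R ^ 2 / T ^ 2 * Lcoef Γ Δ W V i ^ 2
        + 1156 * Λ ^ 2 / T *
          (sampleVar r i * (Lcoef Γ Δ W V i * (specNorm Γ * specNorm (Δ i)))) := by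
  have hnonneg : 0 ≤ specNorm Γ * specNorm (Δ i) * (sampleVar r i / T) :=
    mul_nonneg (mul_nonneg (specNorm_nonneg _) (specNorm_nonneg _))
      (div_nonneg (sampleVar_nonneg r i) (Nat.cast_nonneg T))
  refine add_le_add ?_ ?_
  · calc _ ≤ 2 * (P : ℝ) * (17 * Λ * R * Lcoef Γ Δ W V i / T) ^ 2 := by
          gcongr
          exact specNorm_mul_sampleVar_le hΛ hr i
      _ = _ := by ring
  · calc _ ≤ 4 * (specNorm Γ * specNorm (Δ i) * (sampleVar r i / T)) *
          (289 * Λ ^ 2 * Lcoef Γ Δ W V i) :=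
          mul_le_mul_of_nonneg_left (sum_sq_sampleVar_mul_regCoef_le hΓ hΔ hr hu i)
            (by positivity)
      _ = _ := by ring

lemma sum_condVariance_le (hΓ : Γ.PosSemidef) (hΔ : ∀ i, (Δ i).PosSemidef)
    (hlam : 0 < lamSignal Γ Δ W V) (hΛ : 0 ≤ Λ) (hpm : 1 ≤ pm) (hPT : P / T ≤ pm)
    {r : Fin I × Fin T → ℝ} (hr : r ∈ goodResponses T Γ Δ W V Λ) {u : Fin B → ℝ}
    (hu : u ⬝ᵥ u = 1) :
    ∑ i, (2 * (P : ℝ) * (specNorm Γ * specNorm (Δ i) * (sampleVar r i / T)) ^ 2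
        + 4 * (specNorm Γ * specNorm (Δ i) * (sampleVar r i / T)) *
          ∑ p, (sampleVar r i * (outerVec u (Pi.single p 1) ⬝ᵥ
            regCoef (Γ ⊗ₖ Δ i) (respCoef W (V i)))) ^ 2)
      ≤ 20230 * (I / T * Λ ^ 2 * R ^ 2 * pm * lamSignal Γ Δ W V ^ 2 * (alphaCoef Γ Δ W V + 1)) := by
  have hI := tasks_ne_zero hΓ.1 (fun i => (hΔ i).1) hlam
  have hR : (1 : ℝ) ≤ R := by exact_mod_cast (rank_bounds_of_lamSignal_pos hlam).1
  refine (Finset.sum_le_sum fun i _ => condVariance_le hΓ hΔ hΛ hr hu i).trans ?_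
  rw [Finset.sum_add_distrib, sum_eq_mul_avg hI, sum_eq_mul_avg hI, avg_const_mul, avg_const_mul,
    avg_Lcoef_sq hlam]
  have hα := alphaCoef_nonneg (Γ := Γ) (Δ := Δ) (W := W) (V := V)
  have havg := hr.2
  set lam := lamSignal Γ Δ W V
  set α := alphaCoef Γ Δ W V
  calc _ ≤ I * (578 * P * Λ ^ 2 * R ^ 2 / T ^ 2 * (α * lam ^ 2))
        + I * (1156 * Λ ^ 2 / T * (17 * R * lam ^ 2 * (α + 1))) := by gcongr
    _ = 578 * (I / T * Λ ^ 2 * R ^ 2 * lam ^ 2) * ((P / T) * α)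
        + 19652 * (I / T * Λ ^ 2 * R * lam ^ 2 * (α + 1)) * 1 := by ring
    _ ≤ 578 * (I / T * Λ ^ 2 * R ^ 2 * lam ^ 2) * (pm * (α + 1))
        + 19652 * (I / T * Λ ^ 2 * R * lam ^ 2 * (α + 1)) * (R * pm) := by
        gcongr
        · linarith
        · exact one_le_mul_of_one_le_of_one_le hR hpm
    _ = _ := by ring

variable {Ω : Type*} [MeasurableSpace Ω] {μ : Measure Ω} [IsProbabilityMeasure μ]
  {X : Fin I → Fin T → Ω → Matrix (Fin B) (Fin P) ℝ}

lemma measure_goodResponses_and_abs_condDev_ge_le (hΓ : Γ.PosSemidef)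
    (hΔ : ∀ i, (Δ i).PosSemidef) (hlam : 0 < lamSignal Γ Δ W V) (hX : GaussianModel μ Γ Δ X)
    (hT : T ≠ 0) (hΛ : 0 < Λ) (hpm : 1 ≤ pm) (hPT : P / T ≤ pm) {x t : ℝ} (ht : 0 ≤ t)
    (htQ : 80920 * (I / T * Λ ^ 2 * R ^ 2 * pm * lamSignal Γ Δ W V ^ 2
      * (alphaCoef Γ Δ W V + 1)) * x ≤ t ^ 2)
    (htb : 136 * (Λ * R * (nuCoef Γ Δ W V * lamSignal Γ Δ W V) / T) * x ≤ t)
    {u : Fin B → ℝ} (hu : u ⬝ᵥ u = 1) :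
    μ {ω | taskResponses W V X ω ∈ goodResponses T Γ Δ W V Λ ∧
        t ≤ |condDev (fun i => Γ ⊗ₖ Δ i) (fun i => respCoef W (V i))
          (fun p : Fin P => outerVec u (Pi.single p 1)) T (taskResponses W V X ω)
          (residuals (covVec X) (fun i => Γ ⊗ₖ Δ i) (fun i => respCoef W (V i)) ω)|}
      ≤ 2 * ENNReal.ofReal (Real.exp (-x)) := by
  have hR : (1 : ℝ) ≤ R := by exact_mod_cast (rank_bounds_of_lamSignal_pos hlam).1
  have hν0 : 0 < nuCoef Γ Δ W V :=
    one_pos.trans_le (one_le_nuCoef hΓ.1 (fun i => (hΔ i).1) hlam)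
  have hscale (r) (hr : r ∈ goodResponses T Γ Δ W V Λ) (i : Fin I) :
      4 * (specNorm Γ * specNorm (Δ i) * ((∑ t, r (i, t) ^ 2) / (T : ℝ) ^ 2))
        ≤ 68 * (Λ * R * (nuCoef Γ Δ W V * lamSignal Γ Δ W V) / T) := by
    rw [sum_sq_div_sq_eq_sampleVar_div]
    calc _ ≤ 4 * (17 * Λ * R * Lcoef Γ Δ W V i / T) :=
          mul_le_mul_of_nonneg_left (specNorm_mul_sampleVar_le hΛ.le hr i) (by norm_num)
      _ ≤ 4 * (17 * Λ * R * (nuCoef Γ Δ W V * lamSignal Γ Δ W V) / T) := by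
          gcongr
          exact Lcoef_le_nuCoef_mul hlam i
      _ = _ := by ring
  have hvariance (r) (hr : r ∈ goodResponses T Γ Δ W V Λ) :
      ∑ i, (2 * (Fintype.card (Fin P) : ℝ) *
            (specNorm Γ * specNorm (Δ i) * ((∑ t, r (i, t) ^ 2) / (T : ℝ) ^ 2)) ^ 2
          + 4 * (specNorm Γ * specNorm (Δ i) * ((∑ t, r (i, t) ^ 2) / (T : ℝ) ^ 2)) *
            ∑ p, ((∑ t, r (i, t) ^ 2) / (T : ℝ) * (outerVec u (Pi.single p 1) ⬝ᵥ
              regCoef (Γ ⊗ₖ Δ i) (respCoef W (V i)))) ^ 2)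
        ≤ 20230 * (I / T * Λ ^ 2 * R ^ 2 * pm * lamSignal Γ Δ W V ^ 2
          * (alphaCoef Γ Δ W V + 1)) := by
    simp only [sum_sq_div_sq_eq_sampleVar_div, Fintype.card_fin]
    exact sum_condVariance_le hΓ hΔ hlam hΛ.le hpm hPT hr hu
  exact measure_mem_and_abs_condDev_ge_le (v := covVec X) (S := fun i => Γ ⊗ₖ Δ i)
    hX.hasLaw_covVec (fun i => hΓ.kronecker (hΔ i)) hX.iIndepFun_covVec (fun i => respCoef W (V i))
    (fun i w => respVar_sum_smul_outerVec_le hΓ (Δ i) hu w) measurableSet_goodResponses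
    (by positivity) hscale hvariance ht (le_of_eq_of_le (by ring) htQ)
    (le_of_eq_of_le (by ring) htb)

lemma measure_goodResponses_and_lt_abs_AHat_le (hΓ : Γ.PosSemidef) (hΔ : ∀ i, (Δ i).PosSemidef)
    (hlam : 0 < lamSignal Γ Δ W V) (hX : GaussianModel μ Γ Δ X) (hT : T ≠ 0) {θ : ℝ} (hθ : 0 ≤ θ)
    (hΛ : 0 < Λ) (hpm : 1 ≤ pm) (hPT : P / T ≤ pm)
    (hα : (alphaCoef Γ Δ W V + 1) * (R ^ 2 * Λ ^ 2 * pm * B) ≤ 2 * θ ^ 2 * (I * T))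
    (hν : nuCoef Γ Δ W V * (R * Λ * B) ≤ θ * (I * T)) {u : Fin B → ℝ} (hu : u ⬝ᵥ u = 1) :
    μ {ω | taskResponses W V X ω ∈ goodResponses T Γ Δ W V Λ ∧
        805 * θ * lamSignal Γ Δ W V
          < |u ⬝ᵥ (sampleAHat W V X ω - noiseCoef Δ (taskResponses W V X ω) • Γ
            - condSignal Γ Δ W V (taskResponses W V X ω)) *ᵥ u|}
      ≤ 2 * ENNReal.ofReal (Real.exp (-(4 * B : ℝ))) := by
  have hI := tasks_ne_zero hΓ.1 (fun i => (hΔ i).1) hlam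
  have hvar : 80920 * (I / T * Λ ^ 2 * R ^ 2 * pm * lamSignal Γ Δ W V ^ 2
      * (alphaCoef Γ Δ W V + 1)) * (4 * B) ≤ (I * (805 * θ * lamSignal Γ Δ W V)) ^ 2 := by
    calc _ = 323680 * (lamSignal Γ Δ W V ^ 2 * (I / T)) *
          ((alphaCoef Γ Δ W V + 1) * (R ^ 2 * Λ ^ 2 * pm * B)) := by ring
      _ ≤ 323680 * (lamSignal Γ Δ W V ^ 2 * (I / T)) * (2 * θ ^ 2 * (I * T)) := by gcongr
      _ = 647360 * (I * θ * lamSignal Γ Δ W V) ^ 2 := by field_simp; ring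
      _ ≤ 648025 * (I * θ * lamSignal Γ Δ W V) ^ 2 := by gcongr; norm_num
      _ = _ := by ring
  have hscale : 136 * (Λ * R * (nuCoef Γ Δ W V * lamSignal Γ Δ W V) / T) * (4 * B)
      ≤ I * (805 * θ * lamSignal Γ Δ W V) := by
    calc _ = 544 * (lamSignal Γ Δ W V / T) * (nuCoef Γ Δ W V * (R * Λ * B)) := by ring
      _ ≤ 544 * (lamSignal Γ Δ W V / T) * (θ * (I * T)) := by gcongr
      _ = 544 * (I * θ * lamSignal Γ Δ W V) := by field_simp
      _ ≤ 805 * (I * θ * lamSignal Γ Δ W V) := by gcongr; norm_num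
      _ = _ := by ring
  refine (measure_mono fun ω hω => ?_).trans (measure_goodResponses_and_abs_condDev_ge_le
    hΓ hΔ hlam hX hT hΛ hpm hPT (by positivity) hvar hscale hu)
  have hdev := hω.2.le
  rw [dotProduct_sampleAHat_sub_condMean hΓ hΔ, abs_mul, abs_of_pos (by positivity),
    one_div_mul_eq_div, le_div_iff₀' (by positivity)] at hdev
  exact And.intro hω.1 hdev

end GoodResponses

/-! ### Accuracy of the output on the good event -/

section Accuracy

variable {I T B P R : ℕ} {Γ : Matrix (Fin B) (Fin B) ℝ} {Δ : Fin I → Matrix (Fin P) (Fin P) ℝ}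
  {W : Matrix (Fin B) (Fin R) ℝ} {V : Fin I → Matrix (Fin P) (Fin R) ℝ} {Λ θ : ℝ}

lemma noiseCoef_nonneg (hΔ : ∀ i, (Δ i).PosSemidef) (r : Fin I × Fin T → ℝ) :
    0 ≤ noiseCoef Δ r :=
  avg_nonneg fun i => mul_nonneg (div_nonneg (sampleVar_nonneg r i) (Nat.cast_nonneg T))
    (hΔ i).trace_nonneg

lemma specNorm_mul_sampleVar_mul_trace_le (hΛ : 0 ≤ Λ) {r : Fin I × Fin T → ℝ} {i : Fin I}
    (hr : sampleVar r i ≤ 17 * Λ * responseVar Γ (Δ i) W (V i)) :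
    specNorm Γ * (sampleVar r i / T * (Δ i).trace) ≤ 17 * (P * R * Λ / T) * Lcoef Γ Δ W V i := by
  have hΓ := specNorm_nonneg Γ
  have hΔ := specNorm_nonneg (Δ i)
  have hvar := sampleVar_nonneg r i
  calc _ ≤ specNorm Γ * (sampleVar r i / T * (P * specNorm (Δ i))) := by
        gcongr; exact trace_le_mul_specNorm _
    _ ≤ specNorm Γ * (17 * Λ * responseVar Γ (Δ i) W (V i) / T * (P * specNorm (Δ i))) := by
        gcongr
    _ = 17 * (P * Λ / T) * (responseVar Γ (Δ i) W (V i) * (specNorm Γ * specNorm (Δ i))) := by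
        ring
    _ ≤ 17 * (P * Λ / T) * (R * Lcoef Γ Δ W V i) :=
        mul_le_mul_of_nonneg_left (responseVar_mul_le Γ Δ W V i) (by positivity)
    _ = _ := by ring

lemma noiseCoef_mul_specNorm_le (hlam : 0 < lamSignal Γ Δ W V) (hΛ : 0 ≤ Λ)
    {r : Fin I × Fin T → ℝ} (hr : ∀ i, sampleVar r i ≤ 17 * Λ * responseVar Γ (Δ i) W (V i)) :
    noiseCoef Δ r * specNorm Γ
      ≤ 17 * (P * R * Λ * etaCoef Γ Δ W V / T) * lamSignal Γ Δ W V := by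
  have havg := avg_mono fun i => specNorm_mul_sampleVar_mul_trace_le hΛ (hr i)
  rw [avg_const_mul, avg_const_mul, avg_Lcoef hlam] at havg
  calc _ = _ := mul_comm _ _
    _ ≤ _ := havg
    _ = _ := by ring

/-- How much more accurately `Γ̂` has to be estimated than `Â`: whitening costs a factor `κ_Γ`, and
the noise term `noiseCoef Δ r • Γ` in the conditional mean of `Â` is of relative size
`P R Λ η / T`. -/
noncomputable def covPrecision (T : ℕ) (Γ : Matrix (Fin B) (Fin B) ℝ)
    (Δ : Fin I → Matrix (Fin P) (Fin P) ℝ) (W : Matrix (Fin B) (Fin R) ℝ)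
    (V : Fin I → Matrix (Fin P) (Fin R) ℝ) (Λ : ℝ) : ℝ :=
  max (kappa Γ) (P * R * Λ * etaCoef Γ Δ W V / T)

/-- The function `c` of the condition number in the sample-size condition. -/
noncomputable def condConst (x : ℝ) : ℝ := 4000000 * (1 + x ^ 2)

lemma one_lt_condConst (x : ℝ) : 1 < condConst x := by
  rw [condConst]
  nlinarith [sq_nonneg x]

-- Apply the perturbation bound to `s • Γ`, the matrix that `Γ̂` estimates: it has the same
-- condition number, and `c • Γ = (c / s) • (s • Γ)`.
lemma subspaceDist_le_of_isOutput (hΓ : Γ.PosDef) (h1R : 1 ≤ R) (hRB : R ≤ B)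
    {x : Fin I → Fin T → Matrix (Fin B) (Fin P) ℝ} {y : Fin I → Fin T → ℝ}
    {What Y : Matrix (Fin B) (Fin R) ℝ} {K : Matrix (Fin R) (Fin B) ℝ} {s e c t h : ℝ} (hs : 0 < s)
    (he : kappa Γ * e ≤ 1 / 2) (hG : specNorm (GammaHat x - s • Γ) ≤ s * (specNorm Γ * e))
    (hc : 0 ≤ c) (hA : specNorm (AHat x y - c • Γ - Γ * W * K) ≤ t) (hY : ∀ a, Y *ᵥ a = 0 → a = 0)
    (hYH : ∀ a, h * (Y *ᵥ a ⬝ᵥ Y *ᵥ a) ≤ Y *ᵥ a ⬝ᵥ (Γ * W * K) *ᵥ (Y *ᵥ a))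
    (hh : 0 < h) (hth : 2 * (t + c * (specNorm Γ * e)) ≤ h)
    (hδ : 6 * kappa Γ ^ 2 * ((t + c * (specNorm Γ * e)) / h) + kappa Γ * e ≤ 1 / 2)
    (hout : IsOutput x y What) :
    subspaceDist What W
      ≤ 3 * (6 * kappa Γ ^ 2 * ((t + c * (specNorm Γ * e)) / h) + kappa Γ * e) := by
  obtain ⟨U, hU, rfl⟩ := hout
  have hl := eig_pos hΓ (h1R.trans hRB)
  have hlg := eig_le_specNorm hΓ.1 (h1R.trans hRB)
  have hratio : s * specNorm Γ / (s * eig Γ B) = kappa Γ := mul_div_mul_left _ _ hs.ne'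
  have hrel : s * (specNorm Γ * e) / (s * eig Γ B) = kappa Γ * e := by rw [← hratio]; ring
  have hnoise : c / s * (s * (specNorm Γ * e)) = c * (specNorm Γ * e) := by field_simp
  have hsignal : (s • Γ) * W * (s⁻¹ • K) = Γ * W * K := by
    rw [Matrix.smul_mul, Matrix.smul_mul, Matrix.mul_smul, smul_inv_smul₀ hs.ne']
  have hshift : (c / s) • s • Γ = c • Γ := by rw [smul_smul, div_mul_cancel₀ _ hs.ne']
  have key := subspaceDist_invSqrt_mul_le (Γ := s • Γ) (g := s * specNorm Γ) (l := s * eig Γ B)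
    (c := c / s) (K := s⁻¹ • K) (W := W) (t := t) (Y := Y) (h := h) h1R hRB (mul_pos hs hl)
    (mul_le_mul_of_nonneg_left hlg hs.le)
    (fun v => ?_) (fun v => ?_) (isHermitian_GammaHat x) hG ?_ (isHermitian_AHat x y)
    (div_nonneg hc hs.le) (by rwa [hshift, hsignal]) hY (by rwa [hsignal]) hh
    (by rwa [hnoise]) hU (by rwa [hratio, hrel, hnoise])
  · rwa [hratio, hrel, hnoise] at key
  · rw [smul_mulVec, dotProduct_smul, smul_eq_mul, mul_assoc]
    exact mul_le_mul_of_nonneg_left (eig_mul_dotProduct_le hΓ.1 v) hs.le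
  · rw [smul_mulVec, dotProduct_smul, smul_eq_mul, mul_assoc]
    exact mul_le_mul_of_nonneg_left (dotProduct_mulVec_self_le Γ v) hs.le
  · rw [← hrel, div_le_iff₀ (mul_pos hs hl)] at he
    linarith

lemma exists_frame_le_condSignal (hΓ : Γ.PosSemidef) (hΔ : ∀ i, (Δ i).PosSemidef) (hRB : R ≤ B)
    (hT : 2 ≤ T) {r : Fin I × Fin T → ℝ}
    (hr : specNorm (varDeviation Γ Δ W V r) ≤ lamSignal Γ Δ W V / 8) :
    ∃ Y : Matrix (Fin B) (Fin R) ℝ, (∀ a, Y *ᵥ a = 0 → a = 0) ∧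
      ∀ a, lamSignal Γ Δ W V / 4 * (Y *ᵥ a ⬝ᵥ Y *ᵥ a)
        ≤ Y *ᵥ a ⬝ᵥ condSignal Γ Δ W V r *ᵥ (Y *ᵥ a) := by
  obtain ⟨Y, hY, hYeig⟩ :=
    exists_frame_eig_le (isHermitian_signal (W := W) (V := V) hΓ.1 fun i => (hΔ i).1) hRB
  refine ⟨Y, hY, fun a => ?_⟩
  have hcond := half_signal_sub_le_condSignal hΓ hΔ hT hr (Y *ᵥ a)
  have hsignal := hYeig a
  rw [← lamSignal] at hsignal
  linarith

lemma deviation_lt_third {κ s e lam : ℝ} (hκ : 1 ≤ κ) (hlam : 0 < lam) (hθ : 0 < θ)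
    (hs : s ≤ 43168 * θ * lam) (he : κ * e ≤ 1024 * θ) :
    6 * κ ^ 2 * (s / (lam / 4)) + κ * e < θ * condConst κ / 3 := by
  have hrel : s / (lam / 4) ≤ 172672 * θ := by
    rw [div_le_iff₀ (by positivity)]; linarith
  have hθκ : θ ≤ κ ^ 2 * θ := le_mul_of_one_le_left hθ.le (one_le_pow₀ hκ)
  calc _ ≤ 6 * κ ^ 2 * (172672 * θ) + 1024 * (κ ^ 2 * θ) :=
        add_le_add (mul_le_mul_of_nonneg_left hrel (by positivity)) (by linarith)
    _ < _ := by rw [condConst]; nlinarith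

lemma subspaceDist_lt_of_deviations (hΓ : Γ.PosDef) (hΔ : ∀ i, (Δ i).PosSemidef)
    (hlam : 0 < lamSignal Γ Δ W V) (hT : 2 ≤ T) (hθ : 0 < θ) (hθ1 : θ * condConst (kappa Γ) ≤ 1)
    (hΛ : 0 ≤ Λ) {x : Fin I → Fin T → Matrix (Fin B) (Fin P) ℝ} {y : Fin I → Fin T → ℝ}
    {r : Fin I × Fin T → ℝ} (hr : ∀ i, sampleVar r i ≤ 17 * Λ * responseVar Γ (Δ i) W (V i))
    (hG : specNorm (GammaHat x - traceScale Δ • Γ)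
      ≤ 32 * (traceScale Δ * specNorm Γ * (32 * θ / covPrecision T Γ Δ W V Λ)))
    (hR : specNorm (varDeviation Γ Δ W V r) ≤ 32 * (32 * θ * lamSignal Γ Δ W V))
    (hA : specNorm (AHat x y - noiseCoef Δ r • Γ - condSignal Γ Δ W V r)
      ≤ 32 * (805 * θ * lamSignal Γ Δ W V))
    {What : Matrix (Fin B) (Fin R) ℝ} (hout : IsOutput x y What) :
    subspaceDist What W < θ * condConst (kappa Γ) := by
  obtain ⟨h1R, hRB⟩ := rank_bounds_of_lamSignal_pos hlam
  have hκ := one_le_kappa hΓ (h1R.trans hRB)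
  have hθ_small : θ ≤ 1 / 4000000 := by
    rw [condConst] at hθ1
    nlinarith [mul_nonneg hθ.le (sq_nonneg (kappa Γ))]
  have hκD : kappa Γ ≤ covPrecision T Γ Δ W V Λ := le_max_left _ _
  have hηD : P * R * Λ * etaCoef Γ Δ W V / T ≤ covPrecision T Γ Δ W V Λ := le_max_right _ _
  set D := covPrecision T Γ Δ W V Λ
  have hD : 0 < D := by linarith
  have hκe : kappa Γ * (1024 * θ / D) ≤ 1024 * θ := by
    rw [mul_div_assoc', div_le_iff₀ hD]
    nlinarith
  have hnoise : noiseCoef Δ r * (specNorm Γ * (1024 * θ / D)) ≤ 17408 * θ * lamSignal Γ Δ W V :=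
    calc _ = noiseCoef Δ r * specNorm Γ * (1024 * θ / D) := by ring
      _ ≤ 17 * D * lamSignal Γ Δ W V * (1024 * θ / D) :=
          mul_le_mul_of_nonneg_right
            ((noiseCoef_mul_specNorm_le hlam hΛ hr).trans (by gcongr)) (by positivity)
      _ = _ := by field_simp; ring
  obtain ⟨Y, hY, hYH⟩ := exists_frame_le_condSignal hΓ.posSemidef hΔ hRB hT
    (hR.trans (by nlinarith))
  obtain ⟨K, hK⟩ : ∃ K, condSignal Γ Δ W V r = Γ * W * K := exists_weightedReg_eq _
  rw [hK] at hA hYH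
  have hδ := deviation_lt_third hκ hlam hθ
    (s := 32 * (805 * θ * lamSignal Γ Δ W V) + noiseCoef Δ r * (specNorm Γ * (1024 * θ / D)))
    (by linarith) hκe
  have key := subspaceDist_le_of_isOutput hΓ h1R hRB
    (traceScale_pos hΔ (exists_cov_ne_zero hΓ.1 (fun i => (hΔ i).1) hlam))
    (hκe.trans (by linarith)) (hG.trans_eq (by ring)) (noiseCoef_nonneg hΔ r) hA hY hYH
    (by positivity) (by nlinarith) (by linarith) hout
  linarith

end Accuracy

/-! ### Union bounds -/

section UnionBounds

variable {Ω : Type*} [MeasurableSpace Ω] {μ : Measure Ω}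

lemma five_pow_mul_exp_le {n : ℕ} (hn : n ≠ 0) :
    (5 : ℝ) ^ n * (2 * Real.exp (-(4 * n : ℝ))) ≤ Real.exp (-(n : ℝ)) := by
  have hexp3 : (10 : ℝ) ≤ Real.exp 3 := by
    calc (10 : ℝ) ≤ 2.7182818283 ^ 3 := by norm_num
      _ ≤ Real.exp 1 ^ 3 := by gcongr; exact Real.exp_one_gt_d9.le
      _ = Real.exp 3 := by rw [← Real.exp_nat_mul]; norm_num
  have hbase : 5 * Real.exp (-3) ≤ 1 / 2 := by
    rw [Real.exp_neg, ← div_eq_mul_inv, div_le_iff₀ (by positivity)]; linarith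
  have hpow : (5 * Real.exp (-3)) ^ n ≤ 1 / 2 :=
    (pow_le_of_le_one (by positivity) (by linarith) hn).trans hbase
  have hsplit : Real.exp (-(4 * n : ℝ)) = Real.exp (-3) ^ n * Real.exp (-(n : ℝ)) := by
    rw [← Real.exp_nat_mul, ← Real.exp_add]; congr 1; ring
  calc _ = (5 * Real.exp (-3)) ^ n * 2 * Real.exp (-(n : ℝ)) := by rw [hsplit, mul_pow]; ring
    _ ≤ 1 / 2 * 2 * Real.exp (-(n : ℝ)) := by gcongr
    _ = _ := by ring

lemma measure_inter_lt_specNorm_le {n : ℕ} (hn : n ≠ 0) {A : Ω → Matrix (Fin n) (Fin n) ℝ}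
    (hA : ∀ ω, (A ω).IsHermitian) {G : Set Ω} {t : ℝ} (ht : 0 ≤ t)
    (hG : ∀ u : Fin n → ℝ, u ⬝ᵥ u = 1 → μ (G ∩ {ω | t < |u ⬝ᵥ A ω *ᵥ u|})
      ≤ 2 * ENNReal.ofReal (Real.exp (-(4 * n : ℝ)))) :
    μ (G ∩ {ω | 32 * t < specNorm (A ω)}) ≤ ENNReal.ofReal (Real.exp (-(n : ℝ))) := by
  obtain ⟨N, hcard, hunit, hN⟩ := exists_finset_specNorm_le n
  have hcover : G ∩ {ω | 32 * t < specNorm (A ω)} ⊆ ⋃ u ∈ N, G ∩ {ω | t < |u ⬝ᵥ A ω *ᵥ u|} := by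
    rintro ω ⟨hωG, hω⟩
    by_contra hsmall
    simp only [Set.mem_iUnion, Set.mem_inter_iff, Set.mem_ofPred_eq, hωG, true_and, not_exists,
      not_lt] at hsmall
    exact (hN _ (hA ω) t ht hsmall).not_gt hω
  refine (measure_mono hcover).trans ((measure_biUnion_finset_le N _).trans
    ((Finset.sum_le_sum fun u hu => hG u (hunit u hu)).trans ?_))
  rw [Finset.sum_const, nsmul_eq_mul]
  calc _ ≤ ((5 ^ n : ℕ) : ENNReal) * (2 * ENNReal.ofReal (Real.exp (-(4 * n : ℝ)))) := by
        gcongr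
    _ = ENNReal.ofReal ((5 : ℝ) ^ n * (2 * Real.exp (-(4 * n : ℝ)))) := by
        rw [ENNReal.ofReal_mul (by positivity), ENNReal.ofReal_mul (by positivity),
          ENNReal.ofReal_pow (by positivity)]
        norm_num
    _ ≤ _ := ENNReal.ofReal_le_ofReal (five_pow_mul_exp_le hn)

lemma measure_lt_specNorm_le {n : ℕ} (hn : n ≠ 0) {A : Ω → Matrix (Fin n) (Fin n) ℝ}
    (hA : ∀ ω, (A ω).IsHermitian) {t : ℝ} (ht : 0 ≤ t)
    (hu : ∀ u : Fin n → ℝ, u ⬝ᵥ u = 1 → μ {ω | t < |u ⬝ᵥ A ω *ᵥ u|}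
      ≤ 2 * ENNReal.ofReal (Real.exp (-(4 * n : ℝ)))) :
    μ {ω | 32 * t < specNorm (A ω)} ≤ ENNReal.ofReal (Real.exp (-(n : ℝ))) := by
  simpa only [Set.univ_inter] using
    measure_inter_lt_specNorm_le (G := Set.univ) hn hA ht (by simpa only [Set.univ_inter] using hu)

lemma tasks_mul_exp_le {I T B : ℕ} (hI : I ≠ 0) (hT : 2 ≤ T) (hB : B ≠ 0)
    (hBI : (B : ℝ) ≤ I * T) {Λ : ℝ} (hΛ : Real.log (I * T) / T ≤ Λ) :
    (I : ENNReal) * (2 * ENNReal.ofReal (Real.exp (-(2 * Λ * T))))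
      ≤ ENNReal.ofReal (1 / (B : ℝ)) := by
  have hT2 : (2 : ℝ) ≤ T := by exact_mod_cast hT
  have hIT : (0 : ℝ) < I * T := by positivity
  have hlog : Real.log (I * T) ≤ Λ * T := (div_le_iff₀ (by linarith)).1 hΛ
  have hexp : Real.exp (-(2 * Λ * T)) ≤ ((I * T : ℝ) ^ 2)⁻¹ := by
    calc Real.exp (-(2 * Λ * T)) ≤ Real.exp (-((2 : ℕ) * Real.log (I * T))) :=
          Real.exp_le_exp.2 (by push_cast; linarith)
      _ = _ := by rw [Real.exp_neg, Real.exp_nat_mul, Real.exp_log hIT]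
  have hreal : (I : ℝ) * (2 * Real.exp (-(2 * Λ * T))) ≤ 1 / B := by
    calc (I : ℝ) * (2 * Real.exp (-(2 * Λ * T))) ≤ I * (2 * ((I * T : ℝ) ^ 2)⁻¹) := by gcongr
      _ = 2 / (T * (I * T)) := by field_simp
      _ ≤ 2 / (2 * B) := by gcongr
      _ = 1 / B := by field_simp
  calc _ = ENNReal.ofReal ((I : ℝ) * (2 * Real.exp (-(2 * Λ * T)))) := by
        rw [ENNReal.ofReal_mul (by positivity), ENNReal.ofReal_mul (by positivity)]
        simp
    _ ≤ _ := ENNReal.ofReal_le_ofReal hreal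

lemma measureReal_le_of_subset_union {S E₁ E₂ E₃ E₄ : Set Ω} {a b : ℝ} (ha : 0 ≤ a) (hb : 0 ≤ b)
    (hS : S ⊆ E₁ ∪ (E₂ ∪ (E₃ ∪ E₄))) (h₁ : μ E₁ ≤ ENNReal.ofReal a + 2 * ENNReal.ofReal b)
    (h₂ : μ E₂ ≤ ENNReal.ofReal b) (h₃ : μ E₃ ≤ ENNReal.ofReal b) (h₄ : μ E₄ ≤ ENNReal.ofReal b) :
    μ.real S ≤ a + 5 * b := by
  refine ENNReal.toReal_le_of_le_ofReal (by positivity) ?_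
  calc μ S ≤ μ E₁ + (μ E₂ + (μ E₃ + μ E₄)) :=
        (measure_mono hS).trans <| (measure_union_le _ _).trans <| add_le_add_right
          ((measure_union_le _ _).trans <| add_le_add_right (measure_union_le _ _) _) _
    _ ≤ ENNReal.ofReal a + 2 * ENNReal.ofReal b + (ENNReal.ofReal b +
        (ENNReal.ofReal b + ENNReal.ofReal b)) := by gcongr
    _ = ENNReal.ofReal a + 5 * ENNReal.ofReal b := by ring
    _ = _ := by
        rw [ENNReal.ofReal_add ha (by positivity), ENNReal.ofReal_mul (by norm_num)]
        norm_num

end UnionBounds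

/-! ### Consequences of the sample-size condition -/

section SampleSize

/-- The factor `R⁴ Λ² pm B` that multiplies `k ε⁻²` in the sample-size condition, where `Λ` bounds
`log (I T) / T` and `pm` bounds `P / T`. -/
def effDim (R B : ℕ) (Λ pm : ℝ) : ℝ := R ^ 4 * Λ ^ 2 * pm * B

variable {I T B P R : ℕ} {Γ : Matrix (Fin B) (Fin B) ℝ} {Δ : Fin I → Matrix (Fin P) (Fin P) ℝ}
  {W : Matrix (Fin B) (Fin R) ℝ} {V : Fin I → Matrix (Fin P) (Fin R) ℝ} {Λ pm θ : ℝ}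

lemma sq_mul_sq_mul_le_effDim (hR : 1 ≤ R) (hpm : 1 ≤ pm) :
    R ^ 2 * Λ ^ 2 * pm * B ≤ effDim R B Λ pm := by
  have hRr : (1 : ℝ) ≤ R := by exact_mod_cast hR
  rw [effDim]
  gcongr
  norm_num

lemma mul_mul_le_effDim (hR : 1 ≤ R) (hΛ : 1 ≤ Λ) (hpm : 1 ≤ pm) :
    R * Λ * B ≤ effDim R B Λ pm := by
  have hRr : (1 : ℝ) ≤ R := by exact_mod_cast hR
  calc (R : ℝ) * Λ * B = R * Λ * 1 * B := by ring
    _ ≤ R ^ 2 * Λ ^ 2 * pm * B := by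
        gcongr
        · exact le_self_pow₀ hRr two_ne_zero
        · exact le_self_pow₀ hΛ two_ne_zero
    _ ≤ _ := sq_mul_sq_mul_le_effDim hR hpm

lemma le_effDim (hR : 1 ≤ R) (hΛ : 1 ≤ Λ) (hpm : 1 ≤ pm) : B ≤ effDim R B Λ pm := by
  have hRr : (1 : ℝ) ≤ R := by exact_mod_cast hR
  exact (le_mul_of_one_le_left (Nat.cast_nonneg B)
    (one_le_mul_of_one_le_of_one_le hRr hΛ)).trans (mul_mul_le_effDim hR hΛ hpm)

lemma kPrime_mul_effDim_le {ε : ℝ} (hε : 0 < ε)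
    (hN : kConst Γ Δ W V 1 1 1 1 condConst * (ε ^ 2)⁻¹ * (R : ℝ) ^ 4 * Λ ^ 2 * pm * B ≤ I * T) :
    kPrime Γ Δ W V 1 1 1 1 * effDim R B Λ pm ≤ (ε / condConst (kappa Γ)) ^ 2 * (I * T) := by
  have hc : 0 < condConst (kappa Γ) := one_pos.trans (one_lt_condConst _)
  calc _ = (ε / condConst (kappa Γ)) ^ 2 *
        (kConst Γ Δ W V 1 1 1 1 condConst * (ε ^ 2)⁻¹ * (R : ℝ) ^ 4 * Λ ^ 2 * pm * B) := by
        rw [kConst, effDim]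
        field_simp
    _ ≤ _ := by gcongr

lemma mul_le_sq_mul_samples_of_le_kPrime {a b : ℝ} (ha0 : 0 ≤ a) (ha : a ≤ kPrime Γ Δ W V 1 1 1 1)
    (hb0 : 0 ≤ b) (hb : b ≤ effDim R B Λ pm)
    (hsize : kPrime Γ Δ W V 1 1 1 1 * effDim R B Λ pm ≤ θ ^ 2 * (I * T)) :
    a * b ≤ θ ^ 2 * (I * T) :=
  (mul_le_mul ha hb hb0 (ha0.trans ha)).trans hsize

lemma mul_le_mul_samples_of_le_kPrime {a b : ℝ} (ha0 : 0 ≤ a) (ha : a ≤ kPrime Γ Δ W V 1 1 1 1)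
    (hb0 : 0 ≤ b) (hb : b ≤ effDim R B Λ pm) (hθ : 0 ≤ θ) (hθ1 : θ ≤ 1)
    (hsize : kPrime Γ Δ W V 1 1 1 1 * effDim R B Λ pm ≤ θ ^ 2 * (I * T)) :
    a * b ≤ θ * (I * T) :=
  (mul_le_sq_mul_samples_of_le_kPrime ha0 ha hb0 hb hsize).trans
    (mul_le_mul_of_nonneg_right (pow_le_of_le_one hθ hθ1 two_ne_zero) (by positivity))

lemma nuCoef_sq_mul_le_samples (hR : 1 ≤ R) (hθ : 0 ≤ θ) (hθ1 : θ ≤ 1) (hΛ : 1 ≤ Λ) (hpm : 1 ≤ pm)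
    (hsize : kPrime Γ Δ W V 1 1 1 1 * effDim R B Λ pm ≤ θ ^ 2 * (I * T)) :
    nuCoef Γ Δ W V ^ 2 * B ≤ I * T :=
  calc nuCoef Γ Δ W V ^ 2 * B ≤ θ ^ 2 * (I * T) :=
        mul_le_sq_mul_samples_of_le_kPrime (sq_nonneg _)
          ((le_max_right _ _).trans max_nuCoef_le_kPrime) (Nat.cast_nonneg B)
          (le_effDim hR hΛ hpm) hsize
    _ ≤ I * T := mul_le_of_le_one_left (by positivity) (pow_le_one₀ hθ hθ1)

lemma psiCoef_mul_covPrecision_sq_le (hκ : 1 ≤ kappa Γ) (hη : 1 ≤ etaCoef Γ Δ W V) (hP : P ≠ 0)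
    (hT : T ≠ 0) (hR : 1 ≤ R) (hΛ : 1 ≤ Λ) (hpm : 1 ≤ pm) (hPT : P / T ≤ pm)
    (hsize : kappa Γ ^ 2 * etaCoef Γ Δ W V ^ 2 * psiCoef Δ * effDim R B Λ pm
      ≤ θ ^ 2 * (I * T)) :
    psiCoef Δ * B * covPrecision T Γ Δ W V Λ ^ 2 ≤ P * (θ ^ 2 * (I * T)) := by
  have hψ := psiCoef_nonneg (Δ := Δ)
  have hP1 : (1 : ℝ) ≤ P := by exact_mod_cast Nat.one_le_iff_ne_zero.2 hP
  have hT1 : (1 : ℝ) ≤ T := by exact_mod_cast Nat.one_le_iff_ne_zero.2 hT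
  rcases max_choice (kappa Γ) (P * R * Λ * etaCoef Γ Δ W V / T) with hmax | hmax <;>
    rw [covPrecision, hmax]
  · calc psiCoef Δ * B * kappa Γ ^ 2 = 1 * (kappa Γ ^ 2 * 1 * psiCoef Δ * B) := by ring
      _ ≤ P * (kappa Γ ^ 2 * etaCoef Γ Δ W V ^ 2 * psiCoef Δ * effDim R B Λ pm) := by
          gcongr
          · exact one_le_pow₀ hη
          · exact le_effDim hR hΛ hpm
      _ ≤ _ := by gcongr
  · calc psiCoef Δ * B * (P * R * Λ * etaCoef Γ Δ W V / T) ^ 2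
        = P * (1 * etaCoef Γ Δ W V ^ 2 * psiCoef Δ
          * (R ^ 2 * Λ ^ 2 * (P / T * (1 / T)) * B)) := by ring
      _ ≤ P * (kappa Γ ^ 2 * etaCoef Γ Δ W V ^ 2 * psiCoef Δ
          * (R ^ 2 * Λ ^ 2 * (pm * 1) * B)) := by
          gcongr
          · exact one_le_pow₀ hκ
          · exact (div_le_one (by linarith)).2 hT1
      _ ≤ P * (kappa Γ ^ 2 * etaCoef Γ Δ W V ^ 2 * psiCoef Δ * effDim R B Λ pm) := by
          rw [mul_one]
          gcongr
          exact sq_mul_sq_mul_le_effDim hR hpm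
      _ ≤ _ := by gcongr

lemma chiCoef_mul_covPrecision_le (hκ : 1 ≤ kappa Γ) (hη : 1 ≤ etaCoef Γ Δ W V)
    (hχ : 0 ≤ chiCoef Δ) (hP : P ≠ 0) (hT : T ≠ 0) (hR : 1 ≤ R) (hΛ : 1 ≤ Λ) (hpm : 1 ≤ pm)
    (hsize : kappa Γ * etaCoef Γ Δ W V * chiCoef Δ * effDim R B Λ pm ≤ θ * (I * T)) :
    chiCoef Δ * B * covPrecision T Γ Δ W V Λ ≤ P * (θ * (I * T)) := by
  have hP1 : (1 : ℝ) ≤ P := by exact_mod_cast Nat.one_le_iff_ne_zero.2 hP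
  have hT1 : (1 : ℝ) ≤ T := by exact_mod_cast Nat.one_le_iff_ne_zero.2 hT
  rcases max_choice (kappa Γ) (P * R * Λ * etaCoef Γ Δ W V / T) with hmax | hmax <;>
    rw [covPrecision, hmax]
  · calc chiCoef Δ * B * kappa Γ = 1 * (kappa Γ * 1 * chiCoef Δ * B) := by ring
      _ ≤ P * (kappa Γ * etaCoef Γ Δ W V * chiCoef Δ * effDim R B Λ pm) := by
          gcongr
          exact le_effDim hR hΛ hpm
      _ ≤ _ := by gcongr
  · calc chiCoef Δ * B * (P * R * Λ * etaCoef Γ Δ W V / T)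
        = P * (1 * etaCoef Γ Δ W V * chiCoef Δ * (R * Λ * B / T)) := by ring
      _ ≤ P * (kappa Γ * etaCoef Γ Δ W V * chiCoef Δ * effDim R B Λ pm) := by
          gcongr
          exact (div_le_self (by positivity) hT1).trans (mul_mul_le_effDim hR hΛ hpm)
      _ ≤ _ := by gcongr

end SampleSize

/-! ### Conclusion -/

section Conclusion

variable {I T B P R : ℕ} {Γ : Matrix (Fin B) (Fin B) ℝ} {Δ : Fin I → Matrix (Fin P) (Fin P) ℝ}
  {W : Matrix (Fin B) (Fin R) ℝ} {V : Fin I → Matrix (Fin P) (Fin R) ℝ} {Λ pm θ : ℝ}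
  {Ω : Type*} [MeasurableSpace Ω] {μ : Measure Ω} {X : Fin I → Fin T → Ω → Matrix (Fin B) (Fin P) ℝ}

lemma measure_notMem_goodResponses_le (hΓ : Γ.PosSemidef) (hΔ : ∀ i, (Δ i).PosSemidef)
    (hlam : 0 < lamSignal Γ Δ W V) (hX : GaussianModel μ Γ Δ X) (hT : 2 ≤ T) (hΛ : 1 ≤ Λ)
    (hΛlog : Real.log (I * T) / T ≤ Λ) (hB : nuCoef Γ Δ W V ^ 2 * B ≤ I * T) :
    μ {ω | taskResponses W V X ω ∉ goodResponses T Γ Δ W V Λ}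
      ≤ ENNReal.ofReal (1 / (B : ℝ)) + 2 * ENNReal.ofReal (Real.exp (-(B : ℝ))) := by
  obtain ⟨h1R, hRB⟩ := rank_bounds_of_lamSignal_pos hlam
  have hν := one_le_nuCoef hΓ.1 (fun i => (hΔ i).1) hlam
  have hBI : (B : ℝ) ≤ I * T :=
    (le_mul_of_one_le_left (Nat.cast_nonneg B) (one_le_pow₀ hν)).trans hB
  have hI := tasks_ne_zero hΓ.1 (fun i => (hΔ i).1) hlam
  refine (measure_mono fun ω hω => ?_).trans <| (measure_union_le _ _).trans <| add_le_add
    ((measure_exists_lt_sampleVar_le (W := W) (V := V) hΓ hΔ hX (by omega) hΛ).trans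
      (tasks_mul_exp_le hI hT (by omega) hBI hΛlog))
    (measure_lt_avg_sampleVar_le hΓ hΔ hlam hX (by omega) hB)
  rw [Set.mem_ofPred_eq, goodResponses, Set.mem_ofPred_eq, not_and_or] at hω
  simpa only [Set.mem_union, Set.mem_ofPred_eq, not_forall, not_le] using hω

lemma measure_lt_specNorm_GammaHat_le (hΓ : Γ.PosDef) (hΔ : ∀ i, (Δ i).PosSemidef)
    (hlam : 0 < lamSignal Γ Δ W V) (hX : GaussianModel μ Γ Δ X) (hT : T ≠ 0) (hθ : 0 < θ)
    (hθ1 : θ ≤ 1) (hΛ : 1 ≤ Λ) (hpm : 1 ≤ pm) (hPT : P / T ≤ pm)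
    (hsize : kPrime Γ Δ W V 1 1 1 1 * effDim R B Λ pm ≤ θ ^ 2 * (I * T)) :
    μ {ω | 32 * (traceScale Δ * specNorm Γ * (32 * θ / covPrecision T Γ Δ W V Λ))
        < specNorm (GammaHat (fun i t => X i t ω) - traceScale Δ • Γ)}
      ≤ ENNReal.ofReal (Real.exp (-(B : ℝ))) := by
  obtain ⟨h1R, hRB⟩ := rank_bounds_of_lamSignal_pos hlam
  have hκ := one_le_kappa hΓ (h1R.trans hRB)
  have hη := one_le_etaCoef hΓ.1 (fun i => (hΔ i).1) hlam
  have hne := exists_cov_ne_zero hΓ.1 (fun i => (hΔ i).1) hlam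
  have hts := traceScale_pos hΔ hne
  have hχ := chiCoef_pos hts hne
  have hψ := psiCoef_nonneg (Δ := Δ)
  have hdim : 0 ≤ effDim R B Λ pm := (Nat.cast_nonneg B).trans (le_effDim h1R hΛ hpm)
  have hD : 0 < covPrecision T Γ Δ W V Λ := lt_max_of_lt_left (by linarith)
  have hΓ0 : Γ ≠ 0 := by
    rintro rfl
    norm_num [kappa, specNorm] at hκ
  have hψ_size := psiCoef_mul_covPrecision_sq_le hκ hη (covariates_ne_zero hne) hT h1R hΛ hpm hPT
    (mul_le_sq_mul_samples_of_le_kPrime (by positivity)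
      ((le_max_right _ _).trans max_kappa_mul_le_kPrime) hdim le_rfl hsize)
  have hχ_size := chiCoef_mul_covPrecision_le hκ hη hχ.le (covariates_ne_zero hne) hT h1R hΛ hpm
    (mul_le_mul_samples_of_le_kPrime (by positivity)
      ((le_max_left _ _).trans max_kappa_mul_le_kPrime) hdim le_rfl hθ.le hθ1 hsize)
  have hg := specNorm_nonneg Γ
  refine measure_lt_specNorm_le (by omega) (fun ω => (isHermitian_GammaHat _).sub ?_)
    (by positivity) fun u hu =>
      measure_lt_abs_GammaHat_le hΓ.posSemidef hΓ0 hΔ hne hX hT (by positivity) ?_ ?_ hu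
  · rw [IsHermitian, conjTranspose_smul, star_trivial, hΓ.1]
  · rw [div_pow, mul_div_assoc', le_div_iff₀ (by positivity)]
    linarith [show 0 ≤ P * (θ ^ 2 * (I * T)) by positivity]
  · rw [mul_div_assoc', le_div_iff₀ hD]
    linarith

lemma measure_lt_specNorm_varDeviation_le (hΓ : Γ.PosSemidef) (hΔ : ∀ i, (Δ i).PosSemidef)
    (hlam : 0 < lamSignal Γ Δ W V) (hX : GaussianModel μ Γ Δ X) (hT : T ≠ 0) (hθ : 0 ≤ θ)
    (hθ1 : θ ≤ 1) (hΛ : 1 ≤ Λ) (hpm : 1 ≤ pm)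
    (hsize : kPrime Γ Δ W V 1 1 1 1 * effDim R B Λ pm ≤ θ ^ 2 * (I * T)) :
    μ {ω | 32 * (32 * θ * lamSignal Γ Δ W V)
        < specNorm (varDeviation Γ Δ W V (taskResponses W V X ω))}
      ≤ ENNReal.ofReal (Real.exp (-(B : ℝ))) := by
  obtain ⟨h1R, hRB⟩ := rank_bounds_of_lamSignal_pos hlam
  have hν := one_le_nuCoef hΓ.1 (fun i => (hΔ i).1) hlam
  have hα_size := mul_le_sq_mul_samples_of_le_kPrime alphaCoef_nonneg alphaCoef_le_kPrime
    (Nat.cast_nonneg B) (le_effDim h1R hΛ hpm) hsize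
  have hν_size := mul_le_mul_samples_of_le_kPrime (by linarith)
    ((le_max_left _ _).trans max_nuCoef_le_kPrime) (Nat.cast_nonneg B) (le_effDim h1R hΛ hpm)
    hθ hθ1 hsize
  exact measure_lt_specNorm_le (by omega) (fun ω => isHermitian_weightedReg _) (by positivity)
    fun u hu => measure_lt_abs_varDeviation_le hΓ hΔ hlam hX hT hθ hα_size hν_size hu

variable [IsProbabilityMeasure μ]

lemma measure_goodResponses_inter_lt_specNorm_AHat_le (hΓ : Γ.PosSemidef)
    (hΔ : ∀ i, (Δ i).PosSemidef) (hlam : 0 < lamSignal Γ Δ W V) (hX : GaussianModel μ Γ Δ X)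
    (hT : T ≠ 0) (hθ : 0 ≤ θ) (hθ1 : θ ≤ 1) (hΛ : 1 ≤ Λ) (hpm : 1 ≤ pm) (hPT : P / T ≤ pm)
    (hsize : kPrime Γ Δ W V 1 1 1 1 * effDim R B Λ pm ≤ θ ^ 2 * (I * T)) :
    μ ({ω | taskResponses W V X ω ∈ goodResponses T Γ Δ W V Λ} ∩
      {ω | 32 * (805 * θ * lamSignal Γ Δ W V)
        < specNorm (sampleAHat W V X ω - noiseCoef Δ (taskResponses W V X ω) • Γ
          - condSignal Γ Δ W V (taskResponses W V X ω))})
      ≤ ENNReal.ofReal (Real.exp (-(B : ℝ))) := by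
  obtain ⟨h1R, hRB⟩ := rank_bounds_of_lamSignal_pos hlam
  have hν := one_le_nuCoef hΓ.1 (fun i => (hΔ i).1) hlam
  have hα_size := mul_le_sq_mul_samples_of_le_kPrime alphaCoef_nonneg alphaCoef_le_kPrime
    (by positivity) (sq_mul_sq_mul_le_effDim h1R hpm) hsize
  have hone_size := mul_le_sq_mul_samples_of_le_kPrime zero_le_one
    (hν.trans ((le_max_left _ _).trans max_nuCoef_le_kPrime)) (by positivity)
    (sq_mul_sq_mul_le_effDim h1R hpm) hsize
  have hν_size := mul_le_mul_samples_of_le_kPrime (by linarith)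
    ((le_max_left _ _).trans max_nuCoef_le_kPrime) (by positivity) (mul_mul_le_effDim h1R hΛ hpm)
    hθ hθ1 hsize
  refine measure_inter_lt_specNorm_le (by omega) (fun ω => ?_) (by positivity) fun u hu =>
    measure_goodResponses_and_lt_abs_AHat_le hΓ hΔ hlam hX hT hθ (by linarith) hpm hPT
      (by linarith) hν_size hu
  refine ((isHermitian_AHat _ _).sub ?_).sub (isHermitian_weightedReg _)
  rw [IsHermitian, conjTranspose_smul, star_trivial, hΓ.1]

lemma measureReal_le_subspaceDist_le (hΓ : Γ.PosDef) (hΔ : ∀ i, (Δ i).PosSemidef)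
    (hlam : 0 < lamSignal Γ Δ W V) (hX : GaussianModel μ Γ Δ X)
    {What : Ω → Matrix (Fin B) (Fin R) ℝ}
    (hout : ∀ ω, IsOutput (fun i t => X i t ω) (fun i t => taskResponses W V X ω (i, t)) (What ω))
    (hT : 2 ≤ T) (hθ : 0 < θ) (hθ1 : θ * condConst (kappa Γ) ≤ 1) (hΛ : 1 ≤ Λ)
    (hΛlog : Real.log (I * T) / T ≤ Λ) (hpm : 1 ≤ pm) (hPT : P / T ≤ pm)
    (hsize : kPrime Γ Δ W V 1 1 1 1 * effDim R B Λ pm ≤ θ ^ 2 * (I * T)) :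
    μ.real {ω | θ * condConst (kappa Γ) ≤ subspaceDist (What ω) W}
      ≤ 1 / (B : ℝ) + 5 * Real.exp (-(B : ℝ)) := by
  have hθ_le : θ ≤ 1 := (le_mul_of_one_le_right hθ.le (one_lt_condConst _).le).trans hθ1
  refine measureReal_le_of_subset_union (by positivity) (by positivity) (fun ω hω => ?_)
    (measure_notMem_goodResponses_le hΓ.posSemidef hΔ hlam hX hT hΛ hΛlog
      (nuCoef_sq_mul_le_samples (rank_bounds_of_lamSignal_pos hlam).1 hθ.le hθ_le hΛ hpm hsize))
    (measure_lt_specNorm_GammaHat_le hΓ hΔ hlam hX (by omega) hθ hθ_le hΛ hpm hPT hsize)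
    (measure_lt_specNorm_varDeviation_le hΓ.posSemidef hΔ hlam hX (by omega) hθ.le hθ_le hΛ hpm
      hsize)
    (measure_goodResponses_inter_lt_specNorm_AHat_le hΓ.posSemidef hΔ hlam hX (by omega) hθ.le
      hθ_le hΛ hpm hPT hsize)
  by_contra hgood
  simp only [Set.mem_union, Set.mem_inter_iff, Set.mem_ofPred_eq, not_or, not_and, not_not,
    not_lt] at hgood
  obtain ⟨hr, hG, hR, hA⟩ := hgood
  exact hω.not_gt (subspaceDist_lt_of_deviations hΓ hΔ hlam hT hθ hθ1 (by linarith) hr.1 hG hR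
    (hA hr) (hout ω))

end Conclusion

end MultiTask

theorem theorem1_general {I T B P R : ℕ} {Γ : Matrix (Fin B) (Fin B) ℝ}
    {Δ : Fin I → Matrix (Fin P) (Fin P) ℝ} {W : Matrix (Fin B) (Fin R) ℝ}
    {V : Fin I → Matrix (Fin P) (Fin R) ℝ} (hΓ : Γ.PosDef) (hΔ : ∀ i, (Δ i).PosSemidef)
    (hlam : 0 < MultiTask.lamSignal Γ Δ W V) {Ω : Type*} [MeasurableSpace Ω] {Pr : Measure Ω}
    [IsProbabilityMeasure Pr] {X : Fin I → Fin T → Ω → Matrix (Fin B) (Fin P) ℝ}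
    {y : Fin I → Fin T → Ω → ℝ} {What : Ω → Matrix (Fin B) (Fin R) ℝ} {ε : ℝ}
    (hX : MultiTask.GaussianModel Pr Γ Δ X) (hy : ∀ i t ω, y i t ω = (Wᵀ * X i t ω * V i).trace)
    (hout : ∀ ω, MultiTask.IsOutput (fun i t => X i t ω) (fun i t => y i t ω) (What ω))
    (hε : 0 < ε) (hT : 2 ≤ T)
    (hN : MultiTask.kConst Γ Δ W V 1 1 1 1 MultiTask.condConst * (ε ^ 2)⁻¹ * (R : ℝ) ^ 4
      * max (Real.log (I * T) / T) 1 ^ 2 * max ((P : ℝ) / T) 1 * B ≤ I * T) :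
    Pr.real {ω | MultiTask.subspaceDist (What ω) W ≥ ε}
      ≤ 1 / (B : ℝ) + 5 * Real.exp (-(B : ℝ)) := by
  rcases le_or_gt ε 1 with hε1 | hε1
  · have hc := one_pos.trans (MultiTask.one_lt_condConst (MultiTask.kappa Γ))
    have hθ : ε / MultiTask.condConst (MultiTask.kappa Γ)
        * MultiTask.condConst (MultiTask.kappa Γ) = ε := div_mul_cancel₀ ε hc.ne'
    simp only [hy, MultiTask.trace_transpose_mul_mul] at hout
    have hprob := MultiTask.measureReal_le_subspaceDist_le hΓ hΔ hlam hX hout hT (div_pos hε hc)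
      (hθ.trans_le hε1) (le_max_right _ _) (le_max_left _ _) (le_max_right _ _) (le_max_left _ _)
      (MultiTask.kPrime_mul_effDim_le hε hN)
    rwa [hθ] at hprob
  · have hempty : {ω | MultiTask.subspaceDist (What ω) W ≥ ε} = ∅ :=
      Set.eq_empty_of_forall_notMem fun ω hω =>
        ((MultiTask.subspaceDist_le_one (What ω) W).trans_lt hε1).not_ge hω
    rw [hempty, measureReal_empty]
    positivity

theorem theorem1 :
    ∃ (c₁ c₂ c₃ D' : ℝ) (c : ℝ → ℝ),
      0 < c₁ ∧ 0 < c₂ ∧ 0 < c₃ ∧ 0 < D' ∧ (∀ x, 1 < c x) ∧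
      ∀ (I T B P R : ℕ) (Γ : Matrix (Fin B) (Fin B) ℝ)
        (Δ : Fin I → Matrix (Fin P) (Fin P) ℝ)
        (W : Matrix (Fin B) (Fin R) ℝ) (V : Fin I → Matrix (Fin P) (Fin R) ℝ),
        Γ.PosDef → (∀ i, (Δ i).PosSemidef) → 0 < MultiTask.lamSignal Γ Δ W V →
        ∀ (Ω : Type*) [MeasurableSpace Ω] (Pr : MeasureTheory.Measure Ω)
          [MeasureTheory.IsProbabilityMeasure Pr]
          (X : Fin I → Fin T → Ω → Matrix (Fin B) (Fin P) ℝ)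
          (y : Fin I → Fin T → Ω → ℝ)
          (What : Ω → Matrix (Fin B) (Fin R) ℝ) (ε : ℝ),
          MultiTask.GaussianModel Pr Γ Δ X →
          (∀ i t ω, y i t ω = Matrix.trace (W.transpose * X i t ω * V i)) →
          (∀ ω, MultiTask.IsOutput (fun i t => X i t ω) (fun i t => y i t ω) (What ω)) →
          0 < ε →
          R < T →
          (I : ℝ) * T ≥ MultiTask.kConst Γ Δ W V c₁ c₂ c₃ D' c * (ε ^ 2)⁻¹ * (R : ℝ) ^ 4
              * max (Real.log ((I : ℝ) * T) / T) 1 ^ 2 * max ((P : ℝ) / T) 1 * B →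
          Pr.real {ω | MultiTask.subspaceDist (What ω) W ≥ ε}
            ≤ 1 / (B : ℝ) + 9 * Real.exp (-(B : ℝ)) := by
  refine ⟨1, 1, 1, 1, MultiTask.condConst, one_pos, one_pos, one_pos, one_pos,
    MultiTask.one_lt_condConst, ?_⟩
  intro I T B P R Γ Δ W V hΓ hΔ hlam Ω _ Pr _ X y What ε hX hy hout hε hRT hN
  have hT : 2 ≤ T := (Nat.succ_le_succ (MultiTask.rank_bounds_of_lamSignal_pos hlam).1).trans hRT
  exact (theorem1_general hΓ hΔ hlam hX hy hout hε hT hN).trans (by gcongr; norm_num)
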